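/- Let $M$ be a smooth (finite-dimensional, Hausdorff, second countable) manifold with an open cover $\{U_i\}$, and let $(\mathfrak g,[-,-],(-,-))$ be a finite-dimensional real quadratic Lie algebra (a Lie algebra with a nondegenerate invariant symmetric bilinear form). A Courant algebroid is a vector bundle $C\to M$ with an anchor $\rho:C\to TM$, a nondegenerate symmetric fibrewise pairing $\langle-,-\rangle$ and a bilinear bracket $[\![-,-]\!]$ on $\Gamma(C)$ that is a (left) Leibniz bracket and satisfies $\langle[\![e_1,e_1]\!],e_2\rangle=\frac12\rho(e_2)\langle e_1,e_1\rangle$ and $\rho(e_1)\langle e_2,e_3\rangle=\langle[\![e_1,e_2]\!],e_3\rangle+\langle e_2,[\![e_1,e_3]\!]\rangle$. It is transitive if $\rho$ is surjective; put then $\mathcal G=\ker\rho/(\ker\rho)^\perp$, with its induced fibrewise bracket and metric. A connection on it is a pair $(s,\sigma)$ of an isotropic splitting $s:TM\to C$ of $\rho$ and a splitting $\sigma:\mathcal G\to\ker\rho$ of the quotient map with $\langle s(X),\sigma(a)\rangle=0$. The standard transitive Courant algebroid over an open $U$ is $TU\oplus(U\times\mathfrak g)\oplus T^*U$, with anchor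 the projection to $TU$, pairing $\langle X+a+\xi,Y+b+\eta\rangle=\frac12(\xi(Y)+\eta(X))+(a,b)$ and bracket $$[\![X+a+\xi,Y+b+\eta]\!]=[X,Y]+X(b)-Y(a)+[a,b]+L_X\eta-i_Yd\xi+\mathcal P(a,b),\quad \mathcal P(a,b)(Z)=2(b,Z(a)).$$ Its automorphisms are the matrices $\Lambda=\begin{pmatrix}1&0&0\\ \phi&\tau&0\\ \beta&-2\phi^\star\tau&1\end{pmatrix}$, where $\phi\in\Omega^1(U,\mathfrak g)$, $\phi^\star(a)(X)=(a,\phi(X))$, $\tau$ is a smooth family of orthogonal automorphisms of the Lie algebra $\mathfrak g$ and $\beta:TU\to T^*U$ is a bundle map, such that $\frac12(\beta(X)(Y)+\beta(Y)(X))+(\phi(X),\phi(Y))=0$, $\tau(X(b))-X(\tau(b))-[\phi(X),\tau(b)]=0$, $d\phi+\frac12[\phi,\phi]=0$ and $L_X(\beta(Y))-i_Yd(\beta(X))-\beta([X,Y])+\mathcal P(\phi(X),\phi(Y))=0$. For $\theta\in\Omega^1(U,\mathfrak g)$ put $\mathrm{cs}_3(\theta)=(\theta,d\theta)+\frac13(\theta,[\theta,\theta])$.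 For pairs $(\tilde\theta,\tilde B),(\theta,B)\in\Omega^1(U,\mathfrak g)\times\Omega^2(U)$, a 1-morphism $(\tilde\theta,\tilde B)\to(\theta,B)$ is such a $\Lambda$ with $$\theta=\tau\tilde\theta+\phi,\qquad i_X(\tilde B-B)=\beta(X)+(\theta,\theta(X))-(\tilde\theta,\tilde\theta(X))-2\phi^\star\tau(\tilde\theta(X)),\qquad \mathrm{cs}_3(\tilde\theta)-\mathrm{cs}_3(\theta)=d(\tilde B-B).$$ A transitive Courant data consists of pairs $(\theta_i,B_i)$ on the $U_i$ and 1-morphisms $\Lambda_{ij}:(\theta_j,B_j)\to(\theta_i,B_i)$ on $U_{ij}=U_i\cap U_j$ with $\Lambda_{ij}\Lambda_{jk}=\Lambda_{ik}$ on $U_i\cap U_j\cap U_k$. A 1-morphism $(\tilde\theta_i,\tilde B_i;\tilde\Lambda_{ij})\to(\theta_i,B_i;\Lambda_{ij})$ of such data consists of 1-morphisms $\Lambda_i:(\tilde\theta_i,\tilde B_i)\to(\theta_i,B_i)$ on $U_i$ with $\Lambda_{ij}\Lambda_j=\Lambda_i\tilde\Lambda_{ij}$ on $U_{ij}$. Then: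 (1) Every transitive Courant data glues to a transitive Courant algebroid $C$ with a connection $(s,\sigma)$: there are isomorphisms $\Psi_i$ from $C|_{U_i}$ to the standard transitive Courant algebroid over $U_i$ with $\Psi_i=\Lambda_{ij}\Psi_j$ on $U_{ij}$, the bundle $\mathcal G$ is glued correspondingly from the $U_i\times\mathfrak g$ by the $\tau_{ij}$ as a bundle of quadratic Lie algebras, and in these trivialisations, over $U_i$, $s(X)=X+\theta_i(X)-(\theta_i,\theta_i(X))-i_XB_i$ and $\sigma(a)=a-2(\theta_i,a)$. (2) Every 1-morphism $(\Lambda_i)$ of transitive Courant data glues to an isomorphism of Courant algebroids between the glued Courant algebroids, namely the unique one given by $\Lambda_i$ over each $U_i$, and this isomorphism preserves the connections $(s,\sigma)$. (3) For every transitive Courant data there are a connection $\nabla$ on $\mathcal G$, a 2-form $R\in\Omega^2(M,\mathcal G)$ and a 3-form $H\in\Omega^3(M)$ that over each $U_i$ are given by $$\nabla_Xa=X(a)+[\theta_i(X),a],\qquad R=d\theta_i+\tfrac12[\theta_i,\theta_i],\qquad H=\mathrm{cs}_3(\theta_i)-dB_i ;$$ the bundle $TM\oplus\mathcal G\oplus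 T^*M$ with anchor the projection to $TM$, pairing $\frac12(\xi(Y)+\eta(X))+(a,b)$ and bracket $$[\![X+a+\xi,Y+b+\eta]\!]=[X,Y]+\nabla_Xb-\nabla_Ya+[a,b]+R(X,Y)+L_X\eta-i_Yd\xi+P(a,b)-2Q(X,b)+2Q(Y,a)+H(X,Y,\cdot),$$ where $P(a,b)(Z)=2(b,\nabla_Za)$ and $Q(X,a)(Z)=(a,R(X,Z))$, is a Courant algebroid; and $\mathcal S(X+a+\xi)=s(X)+\sigma(a)+\xi$ is an isomorphism of Courant algebroids from it to the glued Courant algebroid $C$. -/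

import Mathlib

open Bundle TopologicalSpace
open scoped Manifold ContDiff

noncomputable section

namespace TCA

universe uE uM uF uG uI w w'

/-! ### Quadratic Lie algebras -/

/-- A (real, finite-dimensional once `𝔤` is) quadratic Lie algebra structure on the vector space
`𝔤`: a Lie bracket and a nondegenerate invariant symmetric bilinear form. -/
structure QuadraticLieAlgebra (𝔤 : Type uG) [NormedAddCommGroup 𝔤] [NormedSpace ℝ 𝔤] where
  bracket : 𝔤 →L[ℝ] 𝔤 →L[ℝ] 𝔤
  form : 𝔤 →L[ℝ] 𝔤 →L[ℝ] ℝ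
  bracket_self : ∀ a, bracket a a = 0
  jacobi : ∀ a b c, bracket a (bracket b c) = bracket (bracket a b) c + bracket b (bracket a c)
  form_symm : ∀ a b, form a b = form b a
  form_invariant : ∀ a b c, form (bracket a b) c = form a (bracket b c)
  form_nondegenerate : ∀ a, (∀ b, form a b = 0) → a = 0

/-! ### Smooth vector bundles -/

section Bundles

variable (E : Type uE) [NormedAddCommGroup E] [NormedSpace ℝ E]
  (M : Type uM) [TopologicalSpace M] [ChartedSpace E M]
  (F : Type uF) [NormedAddCommGroup F] [NormedSpace ℝ F]

/-- A smooth real vector bundle over `M` with model fibre `F` (Mathlib's smooth vector bundles,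
with the family of fibres and all its structure bundled into one object). -/
structure VB where
  Fib : M → Type w
  [acg : ∀ x, AddCommGroup (Fib x)]
  [mod : ∀ x, Module ℝ (Fib x)]
  [fibTop : ∀ x, TopologicalSpace (Fib x)]
  [totTop : TopologicalSpace (TotalSpace F Fib)]
  [fib : FiberBundle F Fib]
  [vec : VectorBundle ℝ F Fib]
  [smooth : ContMDiffVectorBundle ∞ F Fib 𝓘(ℝ, E)]

attribute [instance] VB.acg VB.mod VB.fibTop VB.totTop VB.fib VB.vec VB.smooth

variable {E M F}

namespace VB

instance isTopologicalAddGroup (V : VB.{uE, uM, uF, w} E M F) (x : M) :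
    IsTopologicalAddGroup (V.Fib x) :=
  (VectorBundle.continuousLinearEquivAt ℝ F V.Fib x).toContinuousAddEquiv.isTopologicalAddGroup

instance continuousSMul (V : VB.{uE, uM, uF, w} E M F) (x : M) :
    ContinuousSMul ℝ (V.Fib x) :=
  (VectorBundle.continuousLinearEquivAt ℝ F V.Fib x).continuousSMul

/-- The space `Γ(V)` of smooth sections. -/
abbrev Sec (V : VB.{uE, uM, uF, w} E M F) : Type _ := ContMDiffSection 𝓘(ℝ, E) F ∞ V.Fib

/-- The section `e` of `V` (no continuity assumed) is smooth at the point `x`. -/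
def SmoothAt (V : VB.{uE, uM, uF, w} E M F) (e : ∀ x, V.Fib x) (x : M) : Prop :=
  ContMDiffAt 𝓘(ℝ, E) (𝓘(ℝ, E).prod 𝓘(ℝ, F)) ∞ (fun y => TotalSpace.mk' F y (e y)) x

end VB

/-- The function `f` on `M` with values in the normed space `F` is smooth at `x`. -/
abbrev FnSmoothAt (f : M → F) (x : M) : Prop := ContMDiffAt 𝓘(ℝ, E) 𝓘(ℝ, F) ∞ f x

/-- The tangent space `T_x M`. -/
abbrev Tan (x : M) : Type uE := TangentSpace 𝓘(ℝ, E) x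

/-- The cotangent space `T*_x M`. -/
abbrev Cotan (x : M) : Type uE := Tan (E := E) x →L[ℝ] ℝ

/-- The vector field `X` is smooth at `x`. -/
def VFSmoothAt [IsManifold 𝓘(ℝ, E) ∞ M] (X : ∀ x : M, Tan (E := E) x) (x : M) : Prop :=
  ContMDiffAt 𝓘(ℝ, E) (𝓘(ℝ, E).prod 𝓘(ℝ, E)) ∞
    (fun y => (TotalSpace.mk' E y (X y) : TangentBundle 𝓘(ℝ, E) M)) x

/-- The derivative `v(f)` of the vector-valued function `f` in direction `v ∈ T_x M`. -/
abbrev dd (f : M → F) (x : M) (v : Tan (E := E) x) : F := mvfderiv 𝓘(ℝ, E) f x v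

/-- The Lie bracket `[X, Y]` of vector fields. -/
abbrev lie (X Y : ∀ x : M, Tan (E := E) x) : ∀ x : M, Tan (E := E) x :=
  VectorField.mlieBracket 𝓘(ℝ, E) X Y

/-! ### Differential forms

Forms are given pointwise; forms on an open set `U` are represented by families indexed by all
points of `M`, of which only the values on `U` matter.  Smoothness is tested on vector fields. -/

section Forms

variable [IsManifold 𝓘(ℝ, E) ∞ M]

/-- `θ` is a smooth `F`-valued 1-form on `U`. -/
def SmoothOneForm (U : Opens M) (θ : ∀ x : M, Tan (E := E) x →L[ℝ] F) : Prop :=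
  ∀ x ∈ U, ∀ X : ∀ y : M, Tan (E := E) y, VFSmoothAt X x → FnSmoothAt (E := E) (fun y => θ y (X y)) x

/-- `β : TU → T*U` is a smooth bundle map. -/
def SmoothBilin (U : Opens M) (β : ∀ x : M, Tan (E := E) x →L[ℝ] Cotan (E := E) x) : Prop :=
  ∀ x ∈ U, ∀ X Y : ∀ y : M, Tan (E := E) y, VFSmoothAt X x → VFSmoothAt Y x →
    FnSmoothAt (E := E) (fun y => β y (X y) (Y y)) x

/-- `α` is a smooth 2-form on `U`. -/
def SmoothTwoForm (U : Opens M) (α : ∀ x : M, Tan (E := E) x [⋀^Fin 2]→ₗ[ℝ] ℝ) : Prop :=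
  ∀ x ∈ U, ∀ X Y : ∀ y : M, Tan (E := E) y, VFSmoothAt X x → VFSmoothAt Y x →
    FnSmoothAt (E := E) (fun y => α y ![X y, Y y]) x

/-- `α` is a smooth 3-form on `M`. -/
def SmoothThreeForm (α : ∀ x : M, Tan (E := E) x [⋀^Fin 3]→ₗ[ℝ] ℝ) : Prop :=
  ∀ x : M, ∀ X Y Z : ∀ y : M, Tan (E := E) y,
    VFSmoothAt X x → VFSmoothAt Y x → VFSmoothAt Z x →
    FnSmoothAt (E := E) (fun y => α y ![X y, Y y, Z y]) x

/-- `R` is a smooth 2-form on `M` with values in the vector bundle `V`. -/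
def SmoothBundleTwoForm (V : VB.{uE, uM, uF, w} E M F)
    (R : ∀ x : M, Tan (E := E) x [⋀^Fin 2]→ₗ[ℝ] V.Fib x) : Prop :=
  ∀ x : M, ∀ X Y : ∀ y : M, Tan (E := E) y, VFSmoothAt X x → VFSmoothAt Y x →
    V.SmoothAt (fun y => R y ![X y, Y y]) x

/-- The exterior derivative `dθ(X, Y) = X(θ(Y)) - Y(θ(X)) - θ([X, Y])` of an `F`-valued 1-form. -/
def dOne (θ : ∀ x : M, Tan (E := E) x →L[ℝ] F) (X Y : ∀ x : M, Tan (E := E) x) (x : M) : F :=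
  dd (fun y => θ y (Y y)) x (X x) - dd (fun y => θ y (X y)) x (Y x) - θ x (lie X Y x)

/-- The exterior derivative of a 2-form, evaluated on vector fields. -/
def dTwo (B : ∀ x : M, Tan (E := E) x [⋀^Fin 2]→ₗ[ℝ] ℝ) (X Y Z : ∀ x : M, Tan (E := E) x)
    (x : M) : ℝ :=
  dd (fun y => B y ![Y y, Z y]) x (X x) - dd (fun y => B y ![X y, Z y]) x (Y x)
    + dd (fun y => B y ![X y, Y y]) x (Z x)
    - B x ![lie X Y x, Z x] + B x ![lie X Z x, Y x] - B x ![lie Y Z x, X x]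

/-- The Lie derivative `(L_X η)(Z) = X(η(Z)) - η([X, Z])` of a 1-form. -/
def lieDer (X : ∀ x : M, Tan (E := E) x) (η : ∀ x : M, Cotan (E := E) x)
    (Z : ∀ x : M, Tan (E := E) x) (x : M) : ℝ :=
  dd (fun y => η y (Z y)) x (X x) - η x (lie X Z x)

/-- The Chern-Simons 3-form `cs₃(θ) = (θ, dθ) + ⅓ (θ, [θ, θ])`, evaluated on vector fields.  Here
`(α, α)(X, Y, Z) = (α(X), α(Y, Z)) + (α(Y), α(Z, X)) + (α(Z), α(X, Y))` for a `𝔤`-valued 1-form `α`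
and a `𝔤`-valued 2-form `α`, and `[θ, θ](X, Y) = 2 [θ(X), θ(Y)]`. -/
def cs3 {𝔤 : Type uG} [NormedAddCommGroup 𝔤] [NormedSpace ℝ 𝔤] (𝔮 : QuadraticLieAlgebra 𝔤)
    (θ : ∀ x : M, Tan (E := E) x →L[ℝ] 𝔤) (X Y Z : ∀ x : M, Tan (E := E) x) (x : M) : ℝ :=
  (𝔮.form (θ x (X x)) (dOne θ Y Z x) + 𝔮.form (θ x (Y x)) (dOne θ Z X x)
      + 𝔮.form (θ x (Z x)) (dOne θ X Y x))
    + (1 / 3 : ℝ) *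
      (𝔮.form (θ x (X x)) ((2 : ℝ) • 𝔮.bracket (θ x (Y x)) (θ x (Z x)))
        + 𝔮.form (θ x (Y x)) ((2 : ℝ) • 𝔮.bracket (θ x (Z x)) (θ x (X x)))
        + 𝔮.form (θ x (Z x)) ((2 : ℝ) • 𝔮.bracket (θ x (X x)) (θ x (Y x))))

/-! ### Courant algebroids -/

/-- A Courant algebroid structure on the vector bundle `C`: an anchor `ρ : C → TM`, a nondegenerate
symmetric pairing on the fibres, and a bilinear bracket on `Γ(C)` that makes it a Leibniz algebra,
subject to the two compatibility axioms. -/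
structure CourantAlgebroid (C : VB.{uE, uM, uF, w} E M F) where
  anchor : ∀ x : M, C.Fib x →ₗ[ℝ] Tan (E := E) x
  pairing : ∀ x : M, C.Fib x →ₗ[ℝ] C.Fib x →ₗ[ℝ] ℝ
  bracket : C.Sec →ₗ[ℝ] C.Sec →ₗ[ℝ] C.Sec
  anchor_smooth : ∀ (e : C.Sec) (x : M), VFSmoothAt (fun y => anchor y (e y)) x
  pairing_smooth : ∀ (e₁ e₂ : C.Sec) (x : M),
    FnSmoothAt (E := E) (fun y => pairing y (e₁ y) (e₂ y)) x
  pairing_symm : ∀ x u v, pairing x u v = pairing x v u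
  pairing_nondegenerate : ∀ x u, (∀ v, pairing x u v = 0) → u = 0
  leibniz : ∀ e₁ e₂ e₃ : C.Sec,
    bracket e₁ (bracket e₂ e₃) = bracket (bracket e₁ e₂) e₃ + bracket e₂ (bracket e₁ e₃)
  pairing_bracket_self : ∀ (e₁ e₂ : C.Sec) (x : M),
    pairing x (bracket e₁ e₁ x) (e₂ x) =
      (1 / 2 : ℝ) * dd (fun y => pairing y (e₁ y) (e₁ y)) x (anchor x (e₂ x))
  anchor_pairing : ∀ (e₁ e₂ e₃ : C.Sec) (x : M),
    dd (fun y => pairing y (e₂ y) (e₃ y)) x (anchor x (e₁ x)) =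
      pairing x (bracket e₁ e₂ x) (e₃ x) + pairing x (e₂ x) (bracket e₁ e₃ x)

namespace CourantAlgebroid

variable {C : VB.{uE, uM, uF, w} E M F} (A : CourantAlgebroid C)

/-- `A` is transitive: the anchor is surjective. -/
def IsTransitive : Prop := ∀ x, Function.Surjective (A.anchor x)

/-- The fibre at `x` of `ker ρ`. -/
abbrev Ker (x : M) : Submodule ℝ (C.Fib x) := LinearMap.ker (A.anchor x)

/-- An isomorphism of Courant algebroids over the identity of `M`: an isomorphism of smooth vector
bundles that preserves anchor, pairing and bracket. -/
@[ext]
structure Iso {F' : Type uG} [NormedAddCommGroup F'] [NormedSpace ℝ F']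
    {C' : VB.{uE, uM, uG, w'} E M F'} (A : CourantAlgebroid C) (A' : CourantAlgebroid C') where
  map : ∀ x : M, C.Fib x ≃ₗ[ℝ] C'.Fib x
  smooth_iff : ∀ (e : ∀ x, C.Fib x) (x : M),
    C'.SmoothAt (fun y => map y (e y)) x ↔ C.SmoothAt e x
  map_anchor : ∀ x e, A'.anchor x (map x e) = A.anchor x e
  map_pairing : ∀ x u v, A'.pairing x (map x u) (map x v) = A.pairing x u v
  map_bracket : ∀ (e₁ e₂ : C.Sec) (e₁' e₂' : C'.Sec),
    (∀ x, e₁' x = map x (e₁ x)) → (∀ x, e₂' x = map x (e₂ x)) →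
    ∀ x, A'.bracket e₁' e₂' x = map x (A.bracket e₁ e₂ x)

/-- The exact sequence `0 → (ker ρ)^⊥ → ker ρ → 𝒢 → 0` of vector bundles, which exhibits the vector
bundle `𝒢` as the quotient `ker ρ / (ker ρ)^⊥`, with the induced fibrewise Lie bracket and
metric. -/
structure AdjointBundle {𝔤 : Type uG} [NormedAddCommGroup 𝔤] [NormedSpace ℝ 𝔤]
    (𝒢 : VB.{uE, uM, uG, w'} E M 𝔤) where
  proj : ∀ x : M, A.Ker x →ₗ[ℝ] 𝒢.Fib x
  bracket : ∀ x : M, 𝒢.Fib x →ₗ[ℝ] 𝒢.Fib x →ₗ[ℝ] 𝒢.Fib x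
  metric : ∀ x : M, 𝒢.Fib x →ₗ[ℝ] 𝒢.Fib x →ₗ[ℝ] ℝ
  proj_smooth : ∀ (e : ∀ y, A.Ker y) (x : M),
    C.SmoothAt (fun y => (e y : C.Fib y)) x → 𝒢.SmoothAt (fun y => proj y (e y)) x
  proj_surjective : ∀ x, Function.Surjective (proj x)
  proj_eq_zero_iff : ∀ x (e : A.Ker x),
    proj x e = 0 ↔ ∀ e' : A.Ker x, A.pairing x (e : C.Fib x) (e' : C.Fib x) = 0
  proj_bracket : ∀ (e₁ e₂ : C.Sec) (h₁ : ∀ x, e₁ x ∈ A.Ker x) (h₂ : ∀ x, e₂ x ∈ A.Ker x) (x : M),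
    ∃ h : A.bracket e₁ e₂ x ∈ A.Ker x,
      proj x ⟨A.bracket e₁ e₂ x, h⟩ = bracket x (proj x ⟨e₁ x, h₁ x⟩) (proj x ⟨e₂ x, h₂ x⟩)
  proj_metric : ∀ x (e₁ e₂ : A.Ker x),
    metric x (proj x e₁) (proj x e₂) = A.pairing x (e₁ : C.Fib x) (e₂ : C.Fib x)

/-- A connection of the transitive Courant algebroid `A`: an isotropic splitting `s : TM → C` of the
anchor and a splitting `σ : 𝒢 → ker ρ` of `ker ρ → 𝒢` that is orthogonal to `s`. -/
structure Connection {A : CourantAlgebroid C} {𝔤 : Type uG} [NormedAddCommGroup 𝔤]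
    [NormedSpace ℝ 𝔤] {𝒢 : VB.{uE, uM, uG, w'} E M 𝔤} (L : A.AdjointBundle 𝒢) where
  s : ∀ x : M, Tan (E := E) x →ₗ[ℝ] C.Fib x
  σ : ∀ x : M, 𝒢.Fib x →ₗ[ℝ] A.Ker x
  s_smooth : ∀ (X : ∀ y : M, Tan (E := E) y) (x : M),
    VFSmoothAt X x → C.SmoothAt (fun y => s y (X y)) x
  σ_smooth : ∀ (a : ∀ y, 𝒢.Fib y) (x : M),
    𝒢.SmoothAt a x → C.SmoothAt (fun y => (σ y (a y) : C.Fib y)) x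
  anchor_s : ∀ x v, A.anchor x (s x v) = v
  isotropic : ∀ x u v, A.pairing x (s x u) (s x v) = 0
  proj_σ : ∀ x a, L.proj x (σ x a) = a
  orthogonal : ∀ x v a, A.pairing x (s x v) (σ x a : C.Fib x) = 0

end CourantAlgebroid

end Forms

/-! ### The standard transitive Courant algebroid and transitive Courant data -/

section Standard

variable (E) in
/-- The fibre `T_x M ⊕ 𝔤 ⊕ T*_x M` of the standard transitive Courant algebroid. -/
abbrev StdFib (𝔤 : Type uG) [NormedAddCommGroup 𝔤] [NormedSpace ℝ 𝔤] (x : M) : Type (max uE uG) :=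
  Tan (E := E) x × 𝔤 × Cotan (E := E) x

variable [IsManifold 𝓘(ℝ, E) ∞ M] {𝔤 : Type uG} [NormedAddCommGroup 𝔤] [NormedSpace ℝ 𝔤]

/-- The section `X + a + ξ` is smooth at `x`: its three components are. -/
def StdSmoothAt (e : ∀ y : M, StdFib E 𝔤 y) (x : M) : Prop :=
  VFSmoothAt (fun y => (e y).1) x ∧ FnSmoothAt (E := E) (fun y => (e y).2.1) x ∧
    ∀ Z : ∀ y : M, Tan (E := E) y, VFSmoothAt Z x →
      FnSmoothAt (E := E) (fun y => (e y).2.2 (Z y)) x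

variable (𝔮 : QuadraticLieAlgebra 𝔤)

/-- The pairing `½(ξ(Y) + η(X)) + (a, b)`. -/
def stdPairing (x : M) (u v : StdFib E 𝔤 x) : ℝ :=
  (1 / 2 : ℝ) * (u.2.2 v.1 + v.2.2 u.1) + 𝔮.form u.2.1 v.2.1

/-- `u` is the value at `x` of the standard bracket of the sections `e₁ = X + a + ξ` and
`e₂ = Y + b + η`, that is of
`[X, Y] + X(b) - Y(a) + [a, b] + L_X η - i_Y dξ + 𝒫(a, b)`, where `𝒫(a, b)(Z) = 2 (b, Z(a))`.  The
1-form part is evaluated on arbitrary vector fields `Z`. -/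
def IsStdBracketAt (e₁ e₂ : ∀ y : M, StdFib E 𝔤 y) (x : M) (u : StdFib E 𝔤 x) : Prop :=
  u.1 = lie (fun y => (e₁ y).1) (fun y => (e₂ y).1) x ∧
  u.2.1 = dd (fun y => (e₂ y).2.1) x (e₁ x).1 - dd (fun y => (e₁ y).2.1) x (e₂ x).1
    + 𝔮.bracket (e₁ x).2.1 (e₂ x).2.1 ∧
  ∀ Z : ∀ y : M, Tan (E := E) y, VFSmoothAt Z x →
    u.2.2 (Z x) =
      lieDer (fun y => (e₁ y).1) (fun y => (e₂ y).2.2) Z x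
        - dOne (fun y => (e₁ y).2.2) (fun y => (e₂ y).1) Z x
        + 2 * 𝔮.form (e₂ x).2.1 (dd (fun y => (e₁ y).2.1) x (Z x))

variable (E) in
/-- An automorphism, over the open set `W`, of the standard transitive Courant algebroid, given by
the matrix with rows `(1, 0, 0)`, `(φ, τ, 0)`, `(β, -2 φ⋆ τ, 1)`. -/
structure StdAut (W : Opens M) where
  φ : ∀ x : M, Tan (E := E) x →L[ℝ] 𝔤
  τ : M → (𝔤 →L[ℝ] 𝔤)
  β : ∀ x : M, Tan (E := E) x →L[ℝ] Cotan (E := E) x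
  φ_smooth : SmoothOneForm W φ
  τ_smooth : ∀ x ∈ W, FnSmoothAt (E := E) τ x
  β_smooth : SmoothBilin W β
  τ_bijective : ∀ x ∈ W, Function.Bijective (τ x)
  τ_bracket : ∀ x ∈ W, ∀ a b, τ x (𝔮.bracket a b) = 𝔮.bracket (τ x a) (τ x b)
  τ_form : ∀ x ∈ W, ∀ a b, 𝔮.form (τ x a) (τ x b) = 𝔮.form a b
  β_symm : ∀ x ∈ W, ∀ u v : Tan (E := E) x,
    (1 / 2 : ℝ) * (β x u v + β x v u) + 𝔮.form (φ x u) (φ x v) = 0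
  τ_deriv : ∀ x ∈ W, ∀ b : M → 𝔤, FnSmoothAt (E := E) b x → ∀ v : Tan (E := E) x,
    τ x (dd b x v) - dd (fun y => τ y (b y)) x v - 𝔮.bracket (φ x v) (τ x (b x)) = 0
  φ_flat : ∀ x ∈ W, ∀ X Y : ∀ y : M, Tan (E := E) y, VFSmoothAt X x → VFSmoothAt Y x →
    dOne φ X Y x + 𝔮.bracket (φ x (X x)) (φ x (Y x)) = 0
  /-- `L_X (β(Y)) - i_Y d(β(X)) - β([X, Y]) + 𝒫(φ(X), φ(Y)) = 0`. -/
  β_deriv : ∀ x ∈ W, ∀ X Y Z : ∀ y : M, Tan (E := E) y,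
    VFSmoothAt X x → VFSmoothAt Y x → VFSmoothAt Z x →
    lieDer X (fun y => β y (Y y)) Z x - dOne (fun y => β y (X y)) Y Z x - β x (lie X Y x) (Z x)
      + 2 * 𝔮.form (φ x (Y x)) (dd (fun y => φ y (X y)) x (Z x)) = 0

variable {𝔮} in
/-- The action of the matrix on the fibre over `x`:
`X + a + ξ ↦ X + (φ(X) + τ(a)) + (β(X) - 2 φ⋆ τ(a) + ξ)`, where `φ⋆(a)(Y) = (a, φ(Y))`. -/
def StdAut.act {W : Opens M} (Λ : StdAut E 𝔮 W) (x : M) (e : StdFib E 𝔤 x) : StdFib E 𝔤 x :=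
  (e.1, Λ.φ x e.1 + Λ.τ x e.2.1,
    Λ.β x e.1 - (2 : ℝ) • (𝔮.form (Λ.τ x e.2.1)).comp (Λ.φ x) + e.2.2)

variable (E 𝔤) in
/-- The connection data `(θ, B)`, `θ ∈ Ω¹(W, 𝔤)` and `B ∈ Ω²(W)`, on the standard transitive Courant
algebroid over the open set `W`. -/
structure ConnData (W : Opens M) where
  θ : ∀ x : M, Tan (E := E) x →L[ℝ] 𝔤
  B : ∀ x : M, Tan (E := E) x [⋀^Fin 2]→ₗ[ℝ] ℝ
  θ_smooth : SmoothOneForm W θ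
  B_smooth : SmoothTwoForm W B

variable {𝔮} in
/-- Over `W ⊆ W₁ ∩ W₂`, the automorphism `Λ` is a 1-morphism from (the restriction of) `(θ', B')` to
(the restriction of) `(θ, B)`. -/
structure StdAut.IsMor {W W₁ W₂ : Opens M} (Λ : StdAut E 𝔮 W)
    (P' : ConnData E 𝔤 W₁) (P : ConnData E 𝔤 W₂) : Prop where
  le₁ : W ≤ W₁
  le₂ : W ≤ W₂
  /-- `θ(X) = τ θ'(X) + φ(X)`. -/
  θ_eq : ∀ x ∈ W, ∀ v : Tan (E := E) x, P.θ x v = Λ.τ x (P'.θ x v) + Λ.φ x v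
  /-- `i_X (B' - B) = β(X) + (θ, θ(X)) - (θ', θ'(X)) - 2 φ⋆ τ (θ'(X))`. -/
  B_eq : ∀ x ∈ W, ∀ u v : Tan (E := E) x,
    P'.B x ![u, v] - P.B x ![u, v] =
      Λ.β x u v + 𝔮.form (P.θ x v) (P.θ x u) - 𝔮.form (P'.θ x v) (P'.θ x u)
        - 2 * 𝔮.form (Λ.τ x (P'.θ x u)) (Λ.φ x v)
  /-- `cs₃(θ') - cs₃(θ) = d(B' - B)`. -/
  cs3_eq : ∀ x ∈ W, ∀ X Y Z : ∀ y : M, Tan (E := E) y,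
    VFSmoothAt X x → VFSmoothAt Y x → VFSmoothAt Z x →
    cs3 𝔮 P'.θ X Y Z x - cs3 𝔮 P.θ X Y Z x = dTwo (fun y => P'.B y - P.B y) X Y Z x

variable (E) in
/-- A transitive Courant data for the open cover `U`: local connection data `(θ_i, B_i)` on `U_i`,
and 1-morphisms `Λ_ij` from `(θ_j, B_j)` to `(θ_i, B_i)` on `U_ij` with `Λ_ij Λ_jk = Λ_ik`. -/
structure CourantData {ι : Type uI} (U : ι → Opens M) where
  obj : ∀ i, ConnData E 𝔤 (U i)
  aut : ∀ i j, StdAut E 𝔮 (U i ⊓ U j)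
  isMor : ∀ i j, (aut i j).IsMor (obj j) (obj i)
  cocycle : ∀ i j k, ∀ x ∈ U i ⊓ U j ⊓ U k, ∀ e : StdFib E 𝔤 x,
    (aut i j).act x ((aut j k).act x e) = (aut i k).act x e

variable {𝔮} in
/-- A 1-morphism of transitive Courant data from `D'` to `D`: 1-morphisms `Λ_i` from `(θ'_i, B'_i)`
to `(θ_i, B_i)` on `U_i` with `Λ_ij Λ_j = Λ_i Λ'_ij` on `U_ij`. -/
structure CourantData.Hom {ι : Type uI} {U : ι → Opens M} (D' D : CourantData E 𝔮 U) where
  aut : ∀ i, StdAut E 𝔮 (U i)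
  isMor : ∀ i, (aut i).IsMor (D'.obj i) (D.obj i)
  comm : ∀ i j, ∀ x ∈ U i ⊓ U j, ∀ e : StdFib E 𝔤 x,
    (D.aut i j).act x ((aut j).act x e) = (aut i).act x ((D'.aut i j).act x e)

variable {𝔮} in
/-- A Courant algebroid with connection glued from the transitive Courant data `D`.

It consists of a Courant algebroid `A` on a vector bundle `C` with isomorphisms `Ψ_i` from `C|_{U_i}`
to the standard transitive Courant algebroid over `U_i` such that `Ψ_i = Λ_ij Ψ_j` on `U_ij`; the
bundle of quadratic Lie algebras `𝒢 = ker ρ / (ker ρ)^⊥`, glued from the bundles `U_i × 𝔤` by the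
`τ_ij`; and a connection `(s, σ)` given over `U_i` by
`s(X) = X + θ_i(X) - (θ_i, θ_i(X)) - i_X B_i` and `σ(a) = a - 2 (θ_i, a)`. -/
structure Glued {ι : Type uI} {U : ι → Opens M} (D : CourantData E 𝔮 U) where
  C : VB.{uE, uM, max uE uG, max uE uG} E M (E × 𝔤 × (E →L[ℝ] ℝ))
  A : CourantAlgebroid C
  /-- The isomorphism `Ψ_i`; only its values over `U_i` matter. -/
  chart : ι → ∀ x : M, C.Fib x →ₗ[ℝ] StdFib E 𝔤 x
  chart_bijective : ∀ i, ∀ x ∈ U i, Function.Bijective (chart i x)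
  chart_smooth_iff : ∀ i, ∀ x ∈ U i, ∀ e : ∀ y, C.Fib y,
    StdSmoothAt (fun y => chart i y (e y)) x ↔ C.SmoothAt e x
  chart_transition : ∀ i j, ∀ x ∈ U i ⊓ U j, ∀ e,
    chart i x e = (D.aut i j).act x (chart j x e)
  chart_anchor : ∀ i, ∀ x ∈ U i, ∀ e, A.anchor x e = (chart i x e).1
  chart_pairing : ∀ i, ∀ x ∈ U i, ∀ u v,
    A.pairing x u v = stdPairing 𝔮 x (chart i x u) (chart i x v)
  chart_bracket : ∀ i, ∀ x ∈ U i, ∀ e₁ e₂ : C.Sec,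
    IsStdBracketAt 𝔮 (fun y => chart i y (e₁ y)) (fun y => chart i y (e₂ y)) x
      (chart i x (A.bracket e₁ e₂ x))
  𝒢 : VB.{uE, uM, uG, uG} E M 𝔤
  L : A.AdjointBundle 𝒢
  /-- The isomorphism from `𝒢|_{U_i}` to `U_i × 𝔤`; only its values over `U_i` matter. -/
  gchart : ι → ∀ x : M, 𝒢.Fib x →ₗ[ℝ] 𝔤
  gchart_bijective : ∀ i, ∀ x ∈ U i, Function.Bijective (gchart i x)
  gchart_smooth_iff : ∀ i, ∀ x ∈ U i, ∀ a : ∀ y, 𝒢.Fib y,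
    FnSmoothAt (E := E) (fun y => gchart i y (a y)) x ↔ 𝒢.SmoothAt a x
  gchart_transition : ∀ i j, ∀ x ∈ U i ⊓ U j, ∀ a,
    gchart i x a = (D.aut i j).τ x (gchart j x a)
  gchart_bracket : ∀ i, ∀ x ∈ U i, ∀ a b,
    gchart i x (L.bracket x a b) = 𝔮.bracket (gchart i x a) (gchart i x b)
  gchart_metric : ∀ i, ∀ x ∈ U i, ∀ a b,
    L.metric x a b = 𝔮.form (gchart i x a) (gchart i x b)
  gchart_proj : ∀ i, ∀ x ∈ U i, ∀ e : A.Ker x,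
    gchart i x (L.proj x e) = (chart i x (e : C.Fib x)).2.1
  conn : CourantAlgebroid.Connection L
  chart_s : ∀ i, ∀ x ∈ U i, ∀ v : Tan (E := E) x,
    (chart i x (conn.s x v)).1 = v ∧
    (chart i x (conn.s x v)).2.1 = (D.obj i).θ x v ∧
    ∀ z : Tan (E := E) x, (chart i x (conn.s x v)).2.2 z =
      - 𝔮.form ((D.obj i).θ x z) ((D.obj i).θ x v) - (D.obj i).B x ![v, z]
  chart_σ : ∀ i, ∀ x ∈ U i, ∀ a,
    (chart i x (conn.σ x a : C.Fib x)).1 = 0 ∧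
    (chart i x (conn.σ x a : C.Fib x)).2.1 = gchart i x a ∧
    ∀ z : Tan (E := E) x, (chart i x (conn.σ x a : C.Fib x)).2.2 z =
      - 2 * 𝔮.form ((D.obj i).θ x z) (gchart i x a)

/-! ### The split form `TM ⊕ 𝒢 ⊕ T*M` -/

/-- The smooth vector bundle `TM ⊕ 𝒢 ⊕ T*M`. -/
@[reducible]
def splitBundle (𝒢 : VB.{uE, uM, uG, w} E M 𝔤) :
    VB.{uE, uM, max uE uG, max uE w} E M (E × 𝔤 × (E →L[ℝ] ℝ)) where
  Fib := (fun x : M => TangentSpace 𝓘(ℝ, E) x) ×ᵇ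
    (𝒢.Fib ×ᵇ fun x : M => TangentSpace 𝓘(ℝ, E) x →L[ℝ] Bundle.Trivial M ℝ x)

variable {𝔮} in
/-- `A'` is the Courant algebroid `TM ⊕ 𝒢 ⊕ T*M` determined by the connection `∇` on `𝒢`, the 2-form
`R` with values in `𝒢` and the 3-form `H`: its anchor is the projection to `TM`, its pairing is
`½(ξ(Y) + η(X)) + (a, b)` and its bracket of `X + a + ξ` and `Y + b + η` is
`[X, Y] + ∇_X b - ∇_Y a + [a, b] + R(X, Y)`
`+ L_X η - i_Y dξ + P(a, b) - 2 Q(X, b) + 2 Q(Y, a) + H(X, Y)`, where `P(a, b)(Z) = 2 (b, ∇_Z a)` and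
`Q(X, a)(Z) = (a, R(X, Z))`.  The 1-form part is evaluated on arbitrary vector fields `Z`. -/
structure IsSplitCourant {F : Type uF} [NormedAddCommGroup F] [NormedSpace ℝ F]
    {C : VB.{uE, uM, uF, w'} E M F} {A : CourantAlgebroid C} {𝒢 : VB.{uE, uM, uG, w} E M 𝔤}
    (L : A.AdjointBundle 𝒢)
    (cov : CovariantDerivative 𝓘(ℝ, E) 𝔤 𝒢.Fib)
    (R : ∀ x : M, Tan (E := E) x [⋀^Fin 2]→ₗ[ℝ] 𝒢.Fib x)
    (H : ∀ x : M, Tan (E := E) x [⋀^Fin 3]→ₗ[ℝ] ℝ)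
    (A' : CourantAlgebroid (splitBundle 𝒢)) : Prop where
  anchor_eq : ∀ x e, A'.anchor x e = e.1
  pairing_eq : ∀ x u v, A'.pairing x u v =
    (1 / 2 : ℝ) * (u.2.2 v.1 + v.2.2 u.1) + L.metric x u.2.1 v.2.1
  bracket_tan : ∀ (e₁ e₂ : (splitBundle 𝒢).Sec) (x : M),
    (A'.bracket e₁ e₂ x).1 = lie (fun y => (e₁ y).1) (fun y => (e₂ y).1) x
  bracket_adj : ∀ (e₁ e₂ : (splitBundle 𝒢).Sec) (x : M),
    (A'.bracket e₁ e₂ x).2.1 =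
      cov (fun y => (e₂ y).2.1) x (e₁ x).1 - cov (fun y => (e₁ y).2.1) x (e₂ x).1
        + L.bracket x (e₁ x).2.1 (e₂ x).2.1 + R x ![(e₁ x).1, (e₂ x).1]
  bracket_cotan : ∀ (e₁ e₂ : (splitBundle 𝒢).Sec) (x : M) (Z : ∀ y : M, Tan (E := E) y),
    VFSmoothAt Z x →
    (A'.bracket e₁ e₂ x).2.2 (Z x) =
      lieDer (fun y => (e₁ y).1) (fun y => (e₂ y).2.2) Z x
        - dOne (F := ℝ) (fun y => (e₁ y).2.2) (fun y => (e₂ y).1) Z x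
        + 2 * L.metric x (e₂ x).2.1 (cov (fun y => (e₁ y).2.1) x (Z x))
        - 2 * L.metric x (e₂ x).2.1 (R x ![(e₁ x).1, Z x])
        + 2 * L.metric x (e₁ x).2.1 (R x ![(e₂ x).1, Z x])
        + H x ![(e₁ x).1, (e₂ x).1, Z x]

end Standard

end Bundles

end TCA

end

open Bundle TopologicalSpace
open scoped Manifold ContDiff

noncomputable section

namespace TCA

universe uE uM uF uG uI w w'

section Calculus

set_option linter.unusedSectionVars false

open Filter Topology

variable {E : Type uE} [NormedAddCommGroup E] [NormedSpace ℝ E]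
  {M : Type uM} [TopologicalSpace M] [ChartedSpace E M]
  {F : Type uF} [NormedAddCommGroup F] [NormedSpace ℝ F]
  {F' : Type*} [NormedAddCommGroup F'] [NormedSpace ℝ F']
  {F'' : Type*} [NormedAddCommGroup F''] [NormedSpace ℝ F'']

/-! ### Derivatives of vector-valued functions -/

section Functions

variable {f g : M → F} {x : M}

lemma FnSmoothAt.mdiff (hf : FnSmoothAt (E := E) f x) :
    MDifferentiableAt 𝓘(ℝ, E) 𝓘(ℝ, F) f x :=
  ContMDiffAt.mdifferentiableAt hf (by simp)

lemma fnSmoothAt_const (c : F) : FnSmoothAt (E := E) (fun _ : M => c) x := contMDiffAt_const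

lemma FnSmoothAt.fadd (hf : FnSmoothAt (E := E) f x) (hg : FnSmoothAt (E := E) g x) :
    FnSmoothAt (E := E) (fun y => f y + g y) x := ContMDiffAt.add hf hg

lemma FnSmoothAt.fsub (hf : FnSmoothAt (E := E) f x) (hg : FnSmoothAt (E := E) g x) :
    FnSmoothAt (E := E) (fun y => f y - g y) x := ContMDiffAt.sub hf hg

lemma FnSmoothAt.fneg (hf : FnSmoothAt (E := E) f x) :
    FnSmoothAt (E := E) (fun y => - f y) x := ContMDiffAt.neg hf

lemma FnSmoothAt.fsmul {c : M → ℝ} (hc : FnSmoothAt (E := E) c x)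
    (hf : FnSmoothAt (E := E) f x) : FnSmoothAt (E := E) (fun y => c y • f y) x :=
  ContMDiffAt.smul hc hf

lemma FnSmoothAt.fmul {c d : M → ℝ} (hc : FnSmoothAt (E := E) c x)
    (hd : FnSmoothAt (E := E) d x) : FnSmoothAt (E := E) (fun y => c y * d y) x :=
  FnSmoothAt.fsmul hc hd

lemma FnSmoothAt.fsum {ι : Type*} {s : Finset ι} {f : ι → M → F}
    (hf : ∀ i ∈ s, FnSmoothAt (E := E) (f i) x) :
    FnSmoothAt (E := E) (fun y => ∑ i ∈ s, f i y) x := by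
  classical
  induction s using Finset.induction_on with
  | empty => simpa using fnSmoothAt_const (0 : F)
  | insert a s ha ih =>
    simp only [Finset.sum_insert ha]
    exact (hf a (by simp)).fadd (ih fun i hi => hf i (by simp [hi]))

lemma FnSmoothAt.clm (L : F →L[ℝ] F') (hf : FnSmoothAt (E := E) f x) :
    FnSmoothAt (E := E) (fun y => L (f y)) x :=
  (fnSmoothAt_const (E := E) (x := x) L).clm_apply hf

lemma FnSmoothAt.bilin (B : F →L[ℝ] F' →L[ℝ] F'') {g : M → F'} (hf : FnSmoothAt (E := E) f x)
    (hg : FnSmoothAt (E := E) g x) : FnSmoothAt (E := E) (fun y => B (f y) (g y)) x :=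
  (FnSmoothAt.clm B hf).clm_apply hg

lemma FnSmoothAt.congr (hf : FnSmoothAt (E := E) f x) (h : ∀ᶠ y in 𝓝 x, g y = f y) :
    FnSmoothAt (E := E) g x := ContMDiffAt.congr_of_eventuallyEq hf h

lemma dd_congr (h : ∀ᶠ y in 𝓝 x, f y = g y) (v : Tan (E := E) x) : dd f x v = dd g x v := by
  have h' : f =ᶠ[𝓝 x] g := h
  simp only [dd, mvfderiv, h'.mfderiv_eq]
  rfl

lemma dd_const (c : F) (v : Tan (E := E) x) : dd (fun _ : M => c) x v = 0 := by
  simp [dd, mvfderiv_const]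

lemma dd_add (hf : MDifferentiableAt 𝓘(ℝ, E) 𝓘(ℝ, F) f x)
    (hg : MDifferentiableAt 𝓘(ℝ, E) 𝓘(ℝ, F) g x) (v : Tan (E := E) x) :
    dd (fun y => f y + g y) x v = dd f x v + dd g x v := by
  simp [dd, mvfderiv_fun_add hf hg]

lemma dd_sub (hf : MDifferentiableAt 𝓘(ℝ, E) 𝓘(ℝ, F) f x)
    (hg : MDifferentiableAt 𝓘(ℝ, E) 𝓘(ℝ, F) g x) (v : Tan (E := E) x) :
    dd (fun y => f y - g y) x v = dd f x v - dd g x v := by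
  simp [dd, mvfderiv_fun_sub hf hg]

lemma dd_neg (v : Tan (E := E) x) : dd (fun y => - f y) x v = - dd f x v := by
  simp [dd, mvfderiv_fun_neg]

lemma dd_smul {c : M → ℝ} (hc : MDifferentiableAt 𝓘(ℝ, E) 𝓘(ℝ, ℝ) c x)
    (hf : MDifferentiableAt 𝓘(ℝ, E) 𝓘(ℝ, F) f x) (v : Tan (E := E) x) :
    dd (fun y => c y • f y) x v = c x • dd f x v + dd c x v • f x := by
  simp [dd, mvfderiv_fun_smul hc hf]

lemma dd_eq_of_hasMFDerivAt {f' : Tan (E := E) x →L[ℝ] F}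
    (hf : HasMFDerivAt 𝓘(ℝ, E) 𝓘(ℝ, F) f x f') (v : Tan (E := E) x) : dd f x v = f' v := by
  simp only [dd, mvfderiv, hf.mfderiv]
  rfl

lemma dd_bilin (B : F →L[ℝ] F' →L[ℝ] F'') {g : M → F'}
    (hf : MDifferentiableAt 𝓘(ℝ, E) 𝓘(ℝ, F) f x)
    (hg : MDifferentiableAt 𝓘(ℝ, E) 𝓘(ℝ, F') g x) (v : Tan (E := E) x) :
    dd (fun y => B (f y) (g y)) x v = B (dd f x v) (g x) + B (f x) (dd g x v) := by
  have h1 := hf.hasMFDerivAt.2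
  have h2 := hg.hasMFDerivAt.2
  have h3 := B.hasFDerivWithinAt_of_bilinear h1 h2
  refine (dd_eq_of_hasMFDerivAt (x := x) (f := fun y => B (f y) (g y)) ⟨?_, h3⟩ v).trans ?_
  · exact (B.continuous.continuousAt.comp hf.continuousAt).clm_apply hg.continuousAt
  · simp [ContinuousLinearMap.precompL, ContinuousLinearMap.precompR, writtenInExtChartAt, dd,
      mvfderiv]
    rw [add_comm]
    rfl

lemma dd_clm (L : F →L[ℝ] F') (hf : MDifferentiableAt 𝓘(ℝ, E) 𝓘(ℝ, F) f x)
    (v : Tan (E := E) x) : dd (fun y => L (f y)) x v = L (dd f x v) := by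
  have h := dd_bilin (ContinuousLinearMap.apply ℝ F' : F →L[ℝ] (F →L[ℝ] F') →L[ℝ] F') hf
    (mdifferentiableAt_const (c := L)) v
  simpa [dd_const] using h

lemma dd_mul {c d : M → ℝ} (hc : MDifferentiableAt 𝓘(ℝ, E) 𝓘(ℝ, ℝ) c x)
    (hd : MDifferentiableAt 𝓘(ℝ, E) 𝓘(ℝ, ℝ) d x) (v : Tan (E := E) x) :
    dd (fun y => c y * d y) x v = c x * dd d x v + dd c x v * d x :=
  dd_smul hc hd v

lemma dd_const_mul (r : ℝ) {c : M → ℝ} (hc : MDifferentiableAt 𝓘(ℝ, E) 𝓘(ℝ, ℝ) c x)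
    (v : Tan (E := E) x) : dd (fun y => r * c y) x v = r * dd c x v := by
  rw [dd_mul mdifferentiableAt_const hc, dd_const]; ring

lemma dd_const_smul (r : ℝ) (hf : MDifferentiableAt 𝓘(ℝ, E) 𝓘(ℝ, F) f x)
    (v : Tan (E := E) x) : dd (fun y => r • f y) x v = r • dd f x v := by
  rw [dd_smul mdifferentiableAt_const hf, dd_const]; simp

end Functions

/-! ### Smooth vector fields -/

variable [IsManifold 𝓘(ℝ, E) ∞ M] {x : M} {X Y Z : ∀ y : M, Tan (E := E) y}

lemma VFSmoothAt.mdiff (hX : VFSmoothAt X x) :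
    MDifferentiableAt 𝓘(ℝ, E) (𝓘(ℝ, E).prod 𝓘(ℝ, E))
      (fun y => (TotalSpace.mk' E y (X y) : TangentBundle 𝓘(ℝ, E) M)) x :=
  ContMDiffAt.mdifferentiableAt hX (by simp)

lemma VFSmoothAt.fadd (hX : VFSmoothAt X x) (hY : VFSmoothAt Y x) :
    VFSmoothAt (fun y => X y + Y y) x := ContMDiffAt.add_section hX hY

lemma VFSmoothAt.fneg (hX : VFSmoothAt X x) :
    VFSmoothAt (fun y => - X y) x := ContMDiffAt.neg_section hX

lemma VFSmoothAt.fsmul {c : M → ℝ} (hc : FnSmoothAt (E := E) c x) (hX : VFSmoothAt X x) :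
    VFSmoothAt (fun y => c y • X y) x := ContMDiffAt.smul_section hc hX

lemma vfSmoothAt_zero : VFSmoothAt (fun y : M => (0 : Tan (E := E) y)) x :=
  contMDiffAt_zeroSection _ _

lemma VFSmoothAt.congr (hX : VFSmoothAt X x) (h : ∀ᶠ y in 𝓝 x, Y y = X y) : VFSmoothAt Y x :=
  ContMDiffAt.congr_of_eventuallyEq hX (h.mono fun y hy => by simp [hy])

lemma dd_smooth {f : M → F} (hf : FnSmoothAt (E := E) f x) (hX : VFSmoothAt X x) :
    FnSmoothAt (E := E) (fun y => dd f y (X y)) x := by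
  have h := ContMDiffAt.clm_apply_of_inCoordinates (b₁ := id) (b₂ := f)
    (ϕ := fun y => mfderiv 𝓘(ℝ, E) 𝓘(ℝ, F) f y) (v := X) (m₀ := x) (n := ∞)
    (F₁ := E) (F₂ := F) (E₁ := (TangentSpace 𝓘(ℝ, E) : M → Type _))
    (E₂ := (TangentSpace 𝓘(ℝ, F) : F → Type _))
    (ContMDiffAt.mfderiv_const (m := ∞) hf (by simp)) hX hf
  rw [contMDiffAt_totalSpace] at h
  refine h.2.congr_of_eventuallyEq (Eventually.of_forall fun y => ?_)
  simp [dd, mvfderiv]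
  rfl

/-! ### Local frames -/

/-- Every vector is the value of a vector field that is smooth near its base point. -/
lemma exists_vf (x : M) (v : Tan (E := E) x) :
    ∃ X : ∀ y : M, Tan (E := E) y, (∀ᶠ y in 𝓝 x, VFSmoothAt X y) ∧ X x = v := by
  obtain ⟨s, hs, h⟩ := FiberBundle.exists_contMDiffOn_extend (k := ∞) 𝓘(ℝ, E) E
    (V := (TangentSpace 𝓘(ℝ, E) : M → Type _)) v
  refine ⟨FiberBundle.extend E v, ?_, FiberBundle.extend_apply_self (F := E) v⟩
  filter_upwards [eventually_mem_nhds_iff.2 hs] with y hy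
  exact h.contMDiffAt hy

lemma exists_frame [FiniteDimensional ℝ F] {V : M → Type*} [TopologicalSpace (TotalSpace F V)]
    [∀ x, AddCommGroup (V x)] [∀ x, Module ℝ (V x)] [∀ x : M, TopologicalSpace (V x)]
    [FiberBundle F V] [VectorBundle ℝ F V] [ContMDiffVectorBundle ∞ F V 𝓘(ℝ, E)] (x : M) :
    ∃ (n : ℕ) (s : Fin n → ∀ y, V y) (l : Fin n → ∀ y, V y →ₗ[ℝ] ℝ),
      (∀ k, ∀ᶠ y in 𝓝 x, ContMDiffAt 𝓘(ℝ, E) (𝓘(ℝ, E).prod 𝓘(ℝ, F)) ∞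
        (fun y => TotalSpace.mk' F y (s k y)) y) ∧
      (∀ e : ∀ y, V y, ContMDiffAt 𝓘(ℝ, E) (𝓘(ℝ, E).prod 𝓘(ℝ, F)) ∞
        (fun y => TotalSpace.mk' F y (e y)) x → ∀ k, FnSmoothAt (E := E) (fun y => l k y (e y)) x) ∧
      (∀ e : ∀ y, V y, MDifferentiableAt 𝓘(ℝ, E) (𝓘(ℝ, E).prod 𝓘(ℝ, F))
        (fun y => TotalSpace.mk' F y (e y)) x →
          ∀ k, MDifferentiableAt 𝓘(ℝ, E) 𝓘(ℝ, ℝ) (fun y => l k y (e y)) x) ∧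
      ∀ᶠ y in 𝓝 x, ∀ v : V y, v = ∑ k, l k y v • s k y := by
  have : ContMDiffVectorBundle 1 F V 𝓘(ℝ, E) := ContMDiffVectorBundle.of_le (n := ∞) (by simp)
  let t := trivializationAt F V x
  have hx : x ∈ t.baseSet := FiberBundle.mem_baseSet_trivializationAt F V x
  let b := Module.finBasis ℝ F
  refine ⟨_, t.localFrame b, t.localFrameCoeff 𝓘(ℝ, E) b, fun k => ?_, fun e he k => ?_,
    fun e he k => ?_, ?_⟩
  · filter_upwards [t.open_baseSet.mem_nhds hx] with y hy
    exact contMDiffAt_localFrame_of_mem ∞ t b k hy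
  · exact contMDiffAt_localFrameCoeff (e := t) b hx he k
  · exact mdifferentiableAt_localFrameCoeff (e := t) b hx he k
  · filter_upwards [t.open_baseSet.mem_nhds hx] with y hy v
    classical
    have h := t.eq_sum_localFrameCoeff_smul (I := 𝓘(ℝ, E)) (b := b)
      (s := Function.update (fun y => (0 : V y)) y v) hy
    simpa using h

/-- A pointwise linear operation that is smooth on the fields smooth near `x` is smooth on all
fields smooth at `x`. -/
lemma smooth_of_smooth_near [FiniteDimensional ℝ E] {α : ∀ y : M, Tan (E := E) y → F}
    (hadd : ∀ y u v, α y (u + v) = α y u + α y v)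
    (hsmul : ∀ y (c : ℝ) v, α y (c • v) = c • α y v)
    (h : ∀ X : ∀ y : M, Tan (E := E) y, (∀ᶠ y in 𝓝 x, VFSmoothAt X y) →
      FnSmoothAt (E := E) (fun y => α y (X y)) x) (hX : VFSmoothAt X x) :
    FnSmoothAt (E := E) (fun y => α y (X y)) x := by
  obtain ⟨n, s, l, hs, hl, -, hsum⟩ :=
    exists_frame (E := E) (F := E) (V := (TangentSpace 𝓘(ℝ, E) : M → Type _)) x
  let α' : ∀ y : M, Tan (E := E) y →ₗ[ℝ] F := fun y =>
    { toFun := α y, map_add' := hadd y, map_smul' := hsmul y }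
  have key : FnSmoothAt (E := E) (fun y => ∑ k, l k y (X y) • α y (s k y)) x :=
    FnSmoothAt.fsum fun k _ => (hl X hX k).fsmul (h _ (hs k))
  refine key.congr (hsum.mono fun y hy => ?_)
  change α' y (X y) = ∑ k, l k y (X y) • α' y (s k y)
  conv_lhs => rw [hy (X y)]
  rw [map_sum]
  simp

/-- An additive operation on vector fields that is linear over the smooth functions depends only on
the value at the point. -/
lemma tensorial_pointwise [FiniteDimensional ℝ E] {A : Type*} [AddCommGroup A] [Module ℝ A]
    {Φ : (∀ y : M, Tan (E := E) y) → A}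
    (hadd : ∀ X Y, VFSmoothAt X x → VFSmoothAt Y x → Φ (fun y => X y + Y y) = Φ X + Φ Y)
    (hsmul : ∀ (c : M → ℝ) X, FnSmoothAt (E := E) c x → VFSmoothAt X x →
      Φ (fun y => c y • X y) = c x • Φ X)
    (hX : VFSmoothAt X x) (hY : VFSmoothAt Y x) (h : X x = Y x) : Φ X = Φ Y := by
  have hloc : ∀ {X Y : ∀ y : M, Tan (E := E) y}, VFSmoothAt X x → VFSmoothAt Y x →
      (∀ᶠ y in 𝓝 x, X y = Y y) → Φ X = Φ Y := by
    classical
    intro X Y hX hY hXY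
    let ψ : M → ℝ := fun y => if X y = Y y then 1 else 0
    have hψ : FnSmoothAt (E := E) ψ x :=
      (fnSmoothAt_const (1 : ℝ)).congr (hXY.mono fun y hy => by simp [ψ, hy])
    have hψx : ψ x = 1 := by simp [ψ, hXY.self_of_nhds]
    have h1 := hsmul ψ X hψ hX
    have h2 := hsmul ψ Y hψ hY
    have h3 : (fun y => ψ y • X y) = fun y => ψ y • Y y := by
      funext y
      by_cases hy : X y = Y y <;> simp [ψ, hy]
    rw [hψx, one_smul] at h1 h2
    rw [← h1, h3, h2]
  obtain ⟨n, s, l, hs, hl, -, hsum⟩ :=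
    exists_frame (E := E) (F := E) (V := (TangentSpace 𝓘(ℝ, E) : M → Type _)) x
  have hs' : ∀ k, VFSmoothAt (s k) x := fun k => (hs k).self_of_nhds
  have hsumsm : ∀ {X : ∀ y : M, Tan (E := E) y}, VFSmoothAt X x → ∀ t : Finset (Fin n),
      VFSmoothAt (fun y => ∑ k ∈ t, l k y (X y) • s k y) x ∧
      Φ (fun y => ∑ k ∈ t, l k y (X y) • s k y) = ∑ k ∈ t, l k x (X x) • Φ (s k) := by
    intro X hX t
    classical
    induction t using Finset.induction_on with
    | empty =>
      refine ⟨by simpa using vfSmoothAt_zero, ?_⟩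
      have := hsmul (fun _ => (0 : ℝ)) (fun y => 0) (fnSmoothAt_const _) vfSmoothAt_zero
      simpa using this
    | insert a t ha ih =>
      have h1 := VFSmoothAt.fsmul (hl X hX a) (hs' a)
      simp only [Finset.sum_insert ha]
      refine ⟨h1.fadd ih.1, ?_⟩
      rw [hadd _ _ h1 ih.1, ih.2, hsmul _ _ (hl X hX a) (hs' a)]
  have hexp : ∀ {X : ∀ y : M, Tan (E := E) y}, VFSmoothAt X x →
      Φ X = ∑ k, l k x (X x) • Φ (s k) := fun {X} hX =>
    (hloc hX (hsumsm hX _).1 (hsum.mono fun y hy => hy (X y))).trans (hsumsm hX _).2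
  rw [hexp hX, hexp hY, h]

/-! ### The Lie bracket of vector fields -/

lemma lie_congr {X' Y' : ∀ y : M, Tan (E := E) y} (hX : ∀ᶠ y in 𝓝 x, X y = X' y)
    (hY : ∀ᶠ y in 𝓝 x, Y y = Y' y) : lie X Y x = lie X' Y' x :=
  Filter.EventuallyEq.mlieBracket_vectorField_eq hX hY

lemma lie_swap (X Y : ∀ y : M, Tan (E := E) y) (x : M) : lie X Y x = - lie Y X x :=
  VectorField.mlieBracket_swap_apply

lemma lie_self (X : ∀ y : M, Tan (E := E) y) (x : M) : lie X X x = 0 := by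
  have h := lie_swap X X x
  have h2 : (2 : ℝ) • lie X X x = 0 := by
    rw [two_smul]
    nth_rewrite 1 [h]
    simp
  exact (smul_eq_zero.1 h2).resolve_left two_ne_zero

variable [CompleteSpace E]

scoped instance isManifold_minSmoothness_two : IsManifold 𝓘(ℝ, E) (minSmoothness ℝ 2) M :=
  IsManifold.of_le (n := ∞) (by
    simp only [minSmoothness_of_isRCLikeNormedField]
    exact ENat.LEInfty.out)

lemma lie_smooth (hX : VFSmoothAt X x) (hY : VFSmoothAt Y x) : VFSmoothAt (lie X Y) x :=
  have : IsManifold 𝓘(ℝ, E) (∞ + 1) M := ‹IsManifold 𝓘(ℝ, E) ∞ M›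
  ContMDiffAt.mlieBracket_vectorField (n := ⊤) (m := ⊤) hX hY (by simp)

lemma lie_add_left (hX : VFSmoothAt X x) (hY : VFSmoothAt Y x) :
    lie (fun y => X y + Y y) Z x = lie X Z x + lie Y Z x :=
  VectorField.mlieBracket_add_left hX.mdiff hY.mdiff

lemma lie_add_right (hX : VFSmoothAt X x) (hY : VFSmoothAt Y x) :
    lie Z (fun y => X y + Y y) x = lie Z X x + lie Z Y x :=
  VectorField.mlieBracket_add_right hX.mdiff hY.mdiff

lemma lie_smul_right {c : M → ℝ} (hc : FnSmoothAt (E := E) c x) (hY : VFSmoothAt Y x) :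
    lie X (fun y => c y • Y y) x = dd c x (X x) • Y x + c x • lie X Y x :=
  VectorField.mlieBracket_smul_right hc.mdiff hY.mdiff

lemma lie_smul_left {c : M → ℝ} (hc : FnSmoothAt (E := E) c x) (hX : VFSmoothAt X x) :
    lie (fun y => c y • X y) Y x = - dd c x (Y x) • X x + c x • lie X Y x :=
  VectorField.mlieBracket_smul_left hc.mdiff hX.mdiff

lemma lie_jacobi (hX : VFSmoothAt X x) (hY : VFSmoothAt Y x) (hZ : VFSmoothAt Z x) :
    lie X (lie Y Z) x = lie (lie X Y) Z x + lie Y (lie X Z) x := by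
  have h2 : minSmoothness ℝ 2 ≤ ∞ := by
    simp only [minSmoothness_of_isRCLikeNormedField]
    exact ENat.LEInfty.out
  have h3 : minSmoothness ℝ 3 ≤ ∞ := by
    simp only [minSmoothness_of_isRCLikeNormedField]
    exact ENat.LEInfty.out
  have : IsManifold 𝓘(ℝ, E) (minSmoothness ℝ 3) M := IsManifold.of_le (n := ∞) h3
  exact VectorField.leibniz_identity_mlieBracket_apply (ContMDiffAt.of_le hX h2)
    (ContMDiffAt.of_le hY h2) (ContMDiffAt.of_le hZ h2)

lemma FnSmoothAt.eventually_mdiff {f : M → F} (hf : FnSmoothAt (E := E) f x) :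
    ∀ᶠ y in 𝓝 x, MDifferentiableAt 𝓘(ℝ, E) 𝓘(ℝ, F) f y := by
  have h1 : ContMDiffAt 𝓘(ℝ, E) 𝓘(ℝ, F) 1 f x := ContMDiffAt.of_le hf ENat.LEInfty.out
  have : IsManifold 𝓘(ℝ, E) 1 M := IsManifold.of_le (n := ∞) ENat.LEInfty.out
  exact ((contMDiffAt_iff_contMDiffAt_nhds (by simp)).1 h1).mono fun y hy => hy.mdifferentiableAt one_ne_zero

lemma dd_lie_real {f : M → ℝ} (hf : FnSmoothAt (E := E) f x) (hX : VFSmoothAt X x)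
    (hY : VFSmoothAt Y x) :
    dd f x (lie X Y x) =
      dd (fun y => dd f y (Y y)) x (X x) - dd (fun y => dd f y (X y)) x (Y x) := by
  by_cases h0 : ∀ v : Tan (E := E) x, v = 0
  · rw [h0 (lie X Y x), h0 (X x), h0 (Y x)]
    simp
  push Not at h0
  obtain ⟨v, hv⟩ := h0
  obtain ⟨Z, hZ, hZx⟩ := exists_vf x v
  have hZ' : VFSmoothAt Z x := hZ.self_of_nhds
  have hfZ : VFSmoothAt (fun y => f y • Z y) x := VFSmoothAt.fsmul hf hZ'
  have hJ := lie_jacobi hX hY hfZ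
  have hJ0 := lie_jacobi hX hY hZ'
  have hexp : ∀ W : ∀ y : M, Tan (E := E) y, ∀ᶠ y in 𝓝 x,
      lie W (fun y => f y • Z y) y = dd f y (W y) • Z y + f y • lie W Z y := fun W => by
    filter_upwards [hf.eventually_mdiff, hZ] with y h1 h2
    exact VectorField.mlieBracket_smul_right h1 h2.mdiff
  have hsm : ∀ {W W' : ∀ y : M, Tan (E := E) y}, VFSmoothAt W x → VFSmoothAt W' x →
      lie W' (lie W (fun y => f y • Z y)) x =
        dd (fun y => dd f y (W y)) x (W' x) • Z x + dd f x (W x) • lie W' Z x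
          + (dd f x (W' x) • lie W Z x + f x • lie W' (lie W Z) x) := fun {W W'} hW hW' => by
    rw [lie_congr (Eventually.of_forall fun y => rfl) (hexp W),
      lie_add_right (VFSmoothAt.fsmul (dd_smooth hf hW) hZ') (VFSmoothAt.fsmul hf (lie_smooth hW hZ')),
      lie_smul_right (dd_smooth hf hW) hZ', lie_smul_right hf (lie_smooth hW hZ')]
  rw [hsm hY hX, hsm hX hY, lie_smul_right hf hZ', hJ0] at hJ
  have h3 : (dd f x (lie X Y x) - (dd (fun y => dd f y (Y y)) x (X x)
      - dd (fun y => dd f y (X y)) x (Y x))) • Z x = 0 := by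
    rw [smul_add] at hJ
    linear_combination (norm := module) (-1 : ℝ) • hJ
  rw [hZx] at h3
  exact sub_eq_zero.1 ((smul_eq_zero.1 h3).resolve_right hv)

/-- `[X, Y](f) = X(Y(f)) - Y(X(f))`. -/
lemma dd_lie {f : M → F} (hf : FnSmoothAt (E := E) f x) (hX : VFSmoothAt X x)
    (hY : VFSmoothAt Y x) :
    dd f x (lie X Y x) =
      dd (fun y => dd f y (Y y)) x (X x) - dd (fun y => dd f y (X y)) x (Y x) := by
  rw [SeparatingDual.eq_iff_forall_dual_eq (R := ℝ)]
  intro g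
  have hev : ∀ W : ∀ y : M, Tan (E := E) y, ∀ᶠ y in 𝓝 x,
      dd (fun z => g (f z)) y (W y) = g (dd f y (W y)) := fun W =>
    hf.eventually_mdiff.mono fun y hy => dd_clm g hy _
  have h := dd_lie_real (FnSmoothAt.clm g hf) hX hY
  rw [dd_clm g hf.mdiff, dd_congr (hev Y), dd_congr (hev X), dd_clm g (dd_smooth hf hY).mdiff,
    dd_clm g (dd_smooth hf hX).mdiff] at h
  rw [h, map_sub]

scoped instance finiteDimensional_tan [FiniteDimensional ℝ E] (x : M) :
    FiniteDimensional ℝ (Tan (E := E) x) := inferInstanceAs (FiniteDimensional ℝ E)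

scoped instance t2Space_tan (x : M) : T2Space (Tan (E := E) x) := inferInstanceAs (T2Space E)

/-- A tensorial operation on vector fields is given by a linear map on the tangent space. -/
lemma exists_clm_of_tensorial [FiniteDimensional ℝ E] {Φ : (∀ y : M, Tan (E := E) y) → F}
    (hadd : ∀ X Y, VFSmoothAt X x → VFSmoothAt Y x → Φ (fun y => X y + Y y) = Φ X + Φ Y)
    (hsmul : ∀ (c : M → ℝ) X, FnSmoothAt (E := E) c x → VFSmoothAt X x →
      Φ (fun y => c y • X y) = c x • Φ X) :
    ∃ L : Tan (E := E) x →L[ℝ] F, ∀ X, VFSmoothAt X x → L (X x) = Φ X := by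
  choose W hW hWx using fun v : Tan (E := E) x => exists_vf x v
  have hW' : ∀ v, VFSmoothAt (W v) x := fun v => (hW v).self_of_nhds
  refine ⟨LinearMap.toContinuousLinearMap
    { toFun := fun v => Φ (W v), map_add' := fun u v => ?_, map_smul' := fun c v => ?_ },
    fun X hX => ?_⟩
  · rw [← hadd _ _ (hW' u) (hW' v)]
    exact tensorial_pointwise hadd hsmul (hW' _) ((hW' u).fadd (hW' v)) (by simp [hWx])
  · rw [RingHom.id_apply, ← hsmul (fun _ => c) _ (fnSmoothAt_const c) (hW' v)]
    exact tensorial_pointwise hadd hsmul (hW' _) (VFSmoothAt.fsmul (fnSmoothAt_const c) (hW' v))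
      (by simp [hWx])
  · exact tensorial_pointwise hadd hsmul (hW' _) hX (hWx _)

end Calculus

section StandardBracket

set_option linter.unusedSectionVars false

open Filter Topology

variable {E : Type uE} [NormedAddCommGroup E] [NormedSpace ℝ E] [FiniteDimensional ℝ E]
  [CompleteSpace E]
  {M : Type uM} [TopologicalSpace M] [ChartedSpace E M] [IsManifold 𝓘(ℝ, E) ∞ M]
  {𝔤 : Type uG} [NormedAddCommGroup 𝔤] [NormedSpace ℝ 𝔤] {𝔮 : QuadraticLieAlgebra 𝔤}
  {x : M}

/-! ### Existence, uniqueness and smoothness of the standard bracket -/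

lemma QuadraticLieAlgebra.bracket_swap (𝔮 : QuadraticLieAlgebra 𝔤) (a b : 𝔤) :
    𝔮.bracket a b = - 𝔮.bracket b a := by
  have h := 𝔮.bracket_self (a + b)
  simp only [map_add, add_apply, 𝔮.bracket_self, zero_add, add_zero] at h
  exact eq_neg_of_add_eq_zero_right h

lemma lieDer_add {X : ∀ y : M, Tan (E := E) y} {η : ∀ y : M, Cotan (E := E) y}
    {Z W : ∀ y : M, Tan (E := E) y}
    (hη : ∀ Z : ∀ y : M, Tan (E := E) y, VFSmoothAt Z x → FnSmoothAt (E := E) (fun y => η y (Z y)) x)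
    (hZ : VFSmoothAt Z x) (hW : VFSmoothAt W x) :
    lieDer X η (fun y => Z y + W y) x = lieDer X η Z x + lieDer X η W x := by
  simp only [lieDer, map_add, lie_add_right hZ hW]
  rw [dd_add (hη Z hZ).mdiff (hη W hW).mdiff]
  ring

lemma lieDer_smul {X : ∀ y : M, Tan (E := E) y} {η : ∀ y : M, Cotan (E := E) y}
    {Z : ∀ y : M, Tan (E := E) y} {c : M → ℝ}
    (hη : ∀ Z : ∀ y : M, Tan (E := E) y, VFSmoothAt Z x → FnSmoothAt (E := E) (fun y => η y (Z y)) x)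
    (hc : FnSmoothAt (E := E) c x) (hZ : VFSmoothAt Z x) :
    lieDer X η (fun y => c y • Z y) x = c x * lieDer X η Z x := by
  simp only [lieDer, map_smul, smul_eq_mul, lie_smul_right hc hZ, map_add]
  rw [dd_mul hc.mdiff (hη Z hZ).mdiff]
  ring

lemma dOne_add_right {F : Type*} [NormedAddCommGroup F] [NormedSpace ℝ F]
    {θ : ∀ y : M, Tan (E := E) y →L[ℝ] F} {Y Z W : ∀ y : M, Tan (E := E) y}
    (hθ : ∀ Z : ∀ y : M, Tan (E := E) y, VFSmoothAt Z x → FnSmoothAt (E := E) (fun y => θ y (Z y)) x)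
    (hZ : VFSmoothAt Z x) (hW : VFSmoothAt W x) :
    dOne θ Y (fun y => Z y + W y) x = dOne θ Y Z x + dOne θ Y W x := by
  simp only [dOne, map_add, lie_add_right hZ hW]
  rw [dd_add (hθ Z hZ).mdiff (hθ W hW).mdiff]
  abel

lemma dOne_smul_right {F : Type*} [NormedAddCommGroup F] [NormedSpace ℝ F]
    {θ : ∀ y : M, Tan (E := E) y →L[ℝ] F} {Y Z : ∀ y : M, Tan (E := E) y} {c : M → ℝ}
    (hθ : ∀ Z : ∀ y : M, Tan (E := E) y, VFSmoothAt Z x → FnSmoothAt (E := E) (fun y => θ y (Z y)) x)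
    (hc : FnSmoothAt (E := E) c x) (hZ : VFSmoothAt Z x) :
    dOne θ Y (fun y => c y • Z y) x = c x • dOne θ Y Z x := by
  simp only [dOne, map_smul, lie_smul_right hc hZ, map_add]
  rw [dd_smul hc.mdiff (hθ Z hZ).mdiff]
  module

lemma dOne_swap {F : Type*} [NormedAddCommGroup F] [NormedSpace ℝ F]
    (θ : ∀ y : M, Tan (E := E) y →L[ℝ] F) (Y Z : ∀ y : M, Tan (E := E) y) (x : M) :
    dOne θ Y Z x = - dOne θ Z Y x := by
  simp only [dOne, lie_swap Y Z x, map_neg]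
  abel

variable {e₁ e₂ e₁' e₂' : ∀ y : M, StdFib E 𝔤 y}

lemma exists_isStdBracketAt (h₁ : StdSmoothAt e₁ x) (h₂ : StdSmoothAt e₂ x) :
    ∃ u : StdFib E 𝔤 x, IsStdBracketAt 𝔮 e₁ e₂ x u := by
  obtain ⟨L, hL⟩ := exists_clm_of_tensorial (x := x) (F := ℝ)
    (Φ := fun Z => lieDer (fun y => (e₁ y).1) (fun y => (e₂ y).2.2) Z x
        - dOne (F := ℝ) (fun y => (e₁ y).2.2) (fun y => (e₂ y).1) Z x
        + 2 * 𝔮.form (e₂ x).2.1 (dd (fun y => (e₁ y).2.1) x (Z x)))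
    (fun Z W hZ hW => by
      rw [lieDer_add h₂.2.2 hZ hW, dOne_add_right h₁.2.2 hZ hW]
      simp only [map_add]
      ring)
    (fun c Z hc hZ => by
      rw [lieDer_smul h₂.2.2 hc hZ, dOne_smul_right h₁.2.2 hc hZ]
      simp only [map_smul, smul_eq_mul]
      ring)
  exact ⟨⟨_, _, L⟩, rfl, rfl, hL⟩

lemma cotan_ext {α β : Cotan (E := E) x}
    (h : ∀ Z : ∀ y : M, Tan (E := E) y, VFSmoothAt Z x → α (Z x) = β (Z x)) : α = β := by
  ext v
  obtain ⟨Z, hZ, rfl⟩ := exists_vf x v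
  exact h Z hZ.self_of_nhds

lemma IsStdBracketAt.unique {u v : StdFib E 𝔤 x} (hu : IsStdBracketAt 𝔮 e₁ e₂ x u)
    (hv : IsStdBracketAt 𝔮 e₁ e₂ x v) : u = v := by
  refine Prod.ext (hu.1.trans hv.1.symm) (Prod.ext (hu.2.1.trans hv.2.1.symm) ?_)
  exact cotan_ext fun Z hZ => (hu.2.2 Z hZ).trans (hv.2.2 Z hZ).symm

lemma IsStdBracketAt.congr {u : StdFib E 𝔤 x} (hu : IsStdBracketAt 𝔮 e₁ e₂ x u)
    (h₁ : ∀ᶠ y in 𝓝 x, e₁' y = e₁ y) (h₂ : ∀ᶠ y in 𝓝 x, e₂' y = e₂ y) :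
    IsStdBracketAt 𝔮 e₁' e₂' x u := by
  have h1 := h₁.self_of_nhds
  have h2 := h₂.self_of_nhds
  have hl : ∀ Z : ∀ y : M, Tan (E := E) y, lie (fun y => (e₁' y).1) Z x = lie (fun y => (e₁ y).1) Z x := fun Z =>
    lie_congr (h₁.mono fun y hy => by rw [hy]) (Eventually.of_forall fun y => rfl)
  have hl' : ∀ Z : ∀ y : M, Tan (E := E) y, lie (fun y => (e₂' y).1) Z x = lie (fun y => (e₂ y).1) Z x := fun Z =>
    lie_congr (h₂.mono fun y hy => by rw [hy]) (Eventually.of_forall fun y => rfl)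
  have hd1 : ∀ v : Tan (E := E) x, dd (fun y => (e₁' y).2.1) x v = dd (fun y => (e₁ y).2.1) x v :=
    dd_congr (h₁.mono fun y hy => by rw [hy])
  have hd2 : ∀ v : Tan (E := E) x, dd (fun y => (e₂' y).2.1) x v = dd (fun y => (e₂ y).2.1) x v :=
    dd_congr (h₂.mono fun y hy => by rw [hy])
  refine ⟨?_, ?_, fun Z hZ => ?_⟩
  · rw [hu.1, hl, lie_congr (Y := fun y => (e₂ y).1) (Y' := fun y => (e₂' y).1)
      (Eventually.of_forall fun y => rfl) (h₂.mono fun y hy => by rw [hy])]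
  · rw [hu.2.1, hd1, hd2, h1, h2]
  · rw [hu.2.2 Z hZ]
    simp only [lieDer, dOne]
    rw [hl, hl', hd1, h1, h2,
      dd_congr (E := E) (f := fun y => (e₂' y).2.2 (Z y)) (h₂.mono fun y hy => by rw [hy]),
      dd_congr (E := E) (f := fun y => (e₁' y).2.2 (Z y)) (h₁.mono fun y hy => by rw [hy]),
      dd_congr (E := E) (f := fun y => (e₁' y).2.2 (e₂' y).1)
        ((h₁.and h₂).mono fun y hy => by rw [hy.1, hy.2])]

lemma StdSmoothAt.congr (h : StdSmoothAt e₁ x) (h₁ : ∀ᶠ y in 𝓝 x, e₁' y = e₁ y) :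
    StdSmoothAt e₁' x :=
  ⟨h.1.congr (h₁.mono fun y hy => by rw [hy]),
    FnSmoothAt.congr h.2.1 (h₁.mono fun y hy => by rw [hy]),
    fun Z hZ => FnSmoothAt.congr (h.2.2 Z hZ) (h₁.mono fun y hy => by rw [hy])⟩

lemma stdSmoothAt_congr (h₁ : ∀ᶠ y in 𝓝 x, e₁' y = e₁ y) :
    StdSmoothAt e₁' x ↔ StdSmoothAt e₁ x :=
  ⟨fun h => h.congr (h₁.mono fun _ hy => hy.symm), fun h => h.congr h₁⟩

lemma dOne_smooth {F : Type*} [NormedAddCommGroup F] [NormedSpace ℝ F]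
    {θ : ∀ y : M, Tan (E := E) y →L[ℝ] F} {Y Z : ∀ y : M, Tan (E := E) y}
    (hθ : ∀ Z : ∀ y : M, Tan (E := E) y, VFSmoothAt Z x → FnSmoothAt (E := E) (fun y => θ y (Z y)) x)
    (hY : VFSmoothAt Y x) (hZ : VFSmoothAt Z x) :
    FnSmoothAt (E := E) (fun y => dOne θ Y Z y) x :=
  ((dd_smooth (hθ Z hZ) hY).fsub (dd_smooth (hθ Y hY) hZ)).fsub (hθ _ (lie_smooth hY hZ))

lemma lieDer_smooth {η : ∀ y : M, Cotan (E := E) y} {Y Z : ∀ y : M, Tan (E := E) y}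
    (hη : ∀ Z : ∀ y : M, Tan (E := E) y, VFSmoothAt Z x → FnSmoothAt (E := E) (fun y => η y (Z y)) x)
    (hY : VFSmoothAt Y x) (hZ : VFSmoothAt Z x) :
    FnSmoothAt (E := E) (fun y => lieDer Y η Z y) x :=
  (dd_smooth (hη Z hZ) hY).fsub (hη _ (lie_smooth hY hZ))

lemma IsStdBracketAt.smooth {u : ∀ y : M, StdFib E 𝔤 y} (h₁ : StdSmoothAt e₁ x)
    (h₂ : StdSmoothAt e₂ x) (hu : ∀ᶠ y in 𝓝 x, IsStdBracketAt 𝔮 e₁ e₂ y (u y)) :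
    StdSmoothAt u x := by
  refine ⟨(lie_smooth h₁.1 h₂.1).congr (hu.mono fun y hy => hy.1), ?_, fun Z hZ => ?_⟩
  · refine FnSmoothAt.congr (((dd_smooth h₂.2.1 h₁.1).fsub (dd_smooth h₁.2.1 h₂.1)).fadd
      (FnSmoothAt.bilin 𝔮.bracket h₁.2.1 h₂.2.1)) (hu.mono fun y hy => hy.2.1)
  · refine smooth_of_smooth_near (α := fun y v => (u y).2.2 v) (fun y u v => map_add _ u v)
      (fun y c v => map_smul _ c v) (fun Z hZ => ?_) hZ
    have hZ' := hZ.self_of_nhds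
    refine FnSmoothAt.congr (((lieDer_smooth h₂.2.2 h₁.1 hZ').fsub
      (dOne_smooth h₁.2.2 h₂.1 hZ')).fadd (FnSmoothAt.fmul (fnSmoothAt_const 2)
        (FnSmoothAt.bilin 𝔮.form h₂.2.1 (dd_smooth h₁.2.1 hZ')))) ?_
    filter_upwards [hu, hZ] with y hy hZy
    exact hy.2.2 Z hZy

/-! ### Bilinearity of the standard bracket -/

variable {e₃ : ∀ y : M, StdFib E 𝔤 y} {u v : StdFib E 𝔤 x}

lemma IsStdBracketAt.add_left (h₁ : StdSmoothAt e₁ x) (h₂ : StdSmoothAt e₂ x)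
    (h₃ : StdSmoothAt e₃ x) (hu : IsStdBracketAt 𝔮 e₁ e₃ x u) (hv : IsStdBracketAt 𝔮 e₂ e₃ x v) :
    IsStdBracketAt 𝔮 (fun y => e₁ y + e₂ y) e₃ x (u + v) := by
  have ha := dd_add (E := E) (FnSmoothAt.mdiff h₁.2.1) (FnSmoothAt.mdiff h₂.2.1)
  refine ⟨?_, ?_, fun Z hZ => ?_⟩
  · simp only [Prod.fst_add, hu.1, hv.1]
    rw [lie_add_left h₁.1 h₂.1]
  · simp only [Prod.fst_add, Prod.snd_add, hu.2.1, hv.2.1, map_add, add_apply, ha]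
    abel
  · simp only [Prod.fst_add, Prod.snd_add, hu.2.2 Z hZ, hv.2.2 Z hZ, map_add, add_apply, ha,
      lieDer, dOne, lie_add_left h₁.1 h₂.1]
    rw [dd_add (h₁.2.2 Z hZ).mdiff (h₂.2.2 Z hZ).mdiff,
      dd_add (h₁.2.2 _ h₃.1).mdiff (h₂.2.2 _ h₃.1).mdiff]
    ring

lemma IsStdBracketAt.smul_left (c : ℝ) (h₁ : StdSmoothAt e₁ x)
    (h₃ : StdSmoothAt e₃ x) (hu : IsStdBracketAt 𝔮 e₁ e₃ x u) :
    IsStdBracketAt 𝔮 (fun y => c • e₁ y) e₃ x (c • u) := by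
  have ha := dd_const_smul (E := E) c (FnSmoothAt.mdiff h₁.2.1)
  have hl : ∀ Z, lie (fun y => c • (e₁ y).1) Z x = c • lie (fun y => (e₁ y).1) Z x := fun Z => by
    rw [lie_smul_left (fnSmoothAt_const c) h₁.1, dd_const]
    simp
  refine ⟨?_, ?_, fun Z hZ => ?_⟩
  · simp only [Prod.smul_fst, hu.1, hl]
  · simp only [Prod.smul_fst, Prod.smul_snd, hu.2.1, map_smul, smul_apply, ha]
    module
  · simp only [Prod.smul_fst, Prod.smul_snd, hu.2.2 Z hZ, map_smul, smul_apply, ha,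
      lieDer, dOne, hl]
    rw [dd_const_smul c (h₁.2.2 Z hZ).mdiff, dd_const_smul c (h₁.2.2 _ h₃.1).mdiff]
    simp only [smul_eq_mul]
    ring

lemma IsStdBracketAt.add_right (h₁ : StdSmoothAt e₁ x) (h₂ : StdSmoothAt e₂ x)
    (h₃ : StdSmoothAt e₃ x) (hu : IsStdBracketAt 𝔮 e₃ e₁ x u) (hv : IsStdBracketAt 𝔮 e₃ e₂ x v) :
    IsStdBracketAt 𝔮 e₃ (fun y => e₁ y + e₂ y) x (u + v) := by
  have ha := dd_add (E := E) (FnSmoothAt.mdiff h₁.2.1) (FnSmoothAt.mdiff h₂.2.1)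
  refine ⟨?_, ?_, fun Z hZ => ?_⟩
  · simp only [Prod.fst_add, hu.1, hv.1]
    rw [lie_add_right h₁.1 h₂.1]
  · simp only [Prod.fst_add, Prod.snd_add, hu.2.1, hv.2.1, map_add, ha]
    abel
  · simp only [Prod.fst_add, Prod.snd_add, hu.2.2 Z hZ, hv.2.2 Z hZ, map_add, add_apply,
      lieDer, dOne, lie_add_left h₁.1 h₂.1]
    rw [dd_add (h₁.2.2 Z hZ).mdiff (h₂.2.2 Z hZ).mdiff,
      dd_add (h₃.2.2 _ h₁.1).mdiff (h₃.2.2 _ h₂.1).mdiff]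
    ring

lemma IsStdBracketAt.smul_right (c : ℝ) (h₁ : StdSmoothAt e₁ x)
    (h₃ : StdSmoothAt e₃ x) (hu : IsStdBracketAt 𝔮 e₃ e₁ x u) :
    IsStdBracketAt 𝔮 e₃ (fun y => c • e₁ y) x (c • u) := by
  have ha := dd_const_smul (E := E) c (FnSmoothAt.mdiff h₁.2.1)
  have hl : ∀ Z, lie (fun y => c • (e₁ y).1) Z x = c • lie (fun y => (e₁ y).1) Z x := fun Z => by
    rw [lie_smul_left (fnSmoothAt_const c) h₁.1, dd_const]
    simp
  have hr : ∀ Z, lie Z (fun y => c • (e₁ y).1) x = c • lie Z (fun y => (e₁ y).1) x := fun Z => by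
    rw [lie_smul_right (fnSmoothAt_const c) h₁.1, dd_const]
    simp
  refine ⟨?_, ?_, fun Z hZ => ?_⟩
  · simp only [Prod.smul_fst, hu.1, hr]
  · simp only [Prod.smul_fst, Prod.smul_snd, hu.2.1, map_smul, ha]
    module
  · simp only [Prod.smul_fst, Prod.smul_snd, hu.2.2 Z hZ, map_smul, smul_apply,
      lieDer, dOne, hl]
    rw [dd_const_smul c (h₁.2.2 Z hZ).mdiff, dd_const_smul c (h₃.2.2 _ h₁.1).mdiff]
    simp only [smul_eq_mul]
    ring

/-! ### The metric axioms for the standard bracket -/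

lemma stdPairing_smooth (h₁ : StdSmoothAt e₁ x) (h₂ : StdSmoothAt e₂ x) :
    FnSmoothAt (E := E) (fun y => stdPairing 𝔮 y (e₁ y) (e₂ y)) x :=
  (FnSmoothAt.fmul (fnSmoothAt_const _) ((h₁.2.2 _ h₂.1).fadd (h₂.2.2 _ h₁.1))).fadd
    (FnSmoothAt.bilin 𝔮.form h₁.2.1 h₂.2.1)

lemma dd_stdPairing (h₁ : StdSmoothAt e₁ x) (h₂ : StdSmoothAt e₂ x) (v : Tan (E := E) x) :
    dd (fun y => stdPairing 𝔮 y (e₁ y) (e₂ y)) x v =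
      (1 / 2 : ℝ) * (dd (fun y => (e₁ y).2.2 (e₂ y).1) x v + dd (fun y => (e₂ y).2.2 (e₁ y).1) x v)
        + (𝔮.form (dd (fun y => (e₁ y).2.1) x v) (e₂ x).2.1
          + 𝔮.form (e₁ x).2.1 (dd (fun y => (e₂ y).2.1) x v)) := by
  have h3 := FnSmoothAt.bilin 𝔮.form h₁.2.1 h₂.2.1
  have h4 := (h₁.2.2 _ h₂.1).fadd (h₂.2.2 _ h₁.1)
  simp only [stdPairing]
  rw [dd_add (FnSmoothAt.fmul (fnSmoothAt_const _) h4).mdiff h3.mdiff, dd_const_mul _ h4.mdiff,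
    dd_add (h₁.2.2 _ h₂.1).mdiff (h₂.2.2 _ h₁.1).mdiff,
    dd_bilin 𝔮.form (FnSmoothAt.mdiff h₁.2.1) (FnSmoothAt.mdiff h₂.2.1)]

lemma IsStdBracketAt.pairing_self (h₁ : StdSmoothAt e₁ x) (h₂ : StdSmoothAt e₂ x)
    (hu : IsStdBracketAt 𝔮 e₁ e₁ x u) :
    stdPairing 𝔮 x u (e₂ x) =
      (1 / 2 : ℝ) * dd (fun y => stdPairing 𝔮 y (e₁ y) (e₁ y)) x (e₂ x).1 := by
  rw [dd_stdPairing h₁ h₁, stdPairing, hu.2.2 _ h₂.1, hu.1, hu.2.1, lie_self, lieDer, dOne,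
    𝔮.bracket_self, 𝔮.form_symm (dd _ _ _)]
  simp only [map_zero, sub_self, zero_apply, add_zero]
  ring

lemma IsStdBracketAt.anchor_pairing (h₂ : StdSmoothAt e₂ x)
    (h₃ : StdSmoothAt e₃ x) (hu : IsStdBracketAt 𝔮 e₁ e₂ x u) (hv : IsStdBracketAt 𝔮 e₁ e₃ x v) :
    dd (fun y => stdPairing 𝔮 y (e₂ y) (e₃ y)) x (e₁ x).1 =
      stdPairing 𝔮 x u (e₃ x) + stdPairing 𝔮 x (e₂ x) v := by
  have hl := lie_swap (fun y => (e₃ y).1) (fun y => (e₂ y).1) x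
  have hi := 𝔮.form_invariant (e₁ x).2.1 (e₂ x).2.1 (e₃ x).2.1
  have hi' := 𝔮.form_invariant (e₂ x).2.1 (e₁ x).2.1 (e₃ x).2.1
  rw [𝔮.bracket_swap (e₂ x).2.1] at hi'
  rw [dd_stdPairing h₂ h₃, stdPairing, stdPairing, hu.2.2 _ h₃.1, hv.2.2 _ h₂.1, hu.1, hv.1,
    hu.2.1, hv.2.1, lieDer, dOne, lieDer, dOne, hl]
  have hs := 𝔮.form_symm (dd (fun y => (e₁ y).2.1) x (e₂ x).1) (e₃ x).2.1
  simp only [map_add, map_sub, map_neg, add_apply, sub_apply, neg_apply] at hi' ⊢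
  linear_combination hs + hi'

end StandardBracket

/-! ### The Leibniz identity -/

section AbstractLeibniz

variable {V A G : Type*} [LieRing V] [AddCommGroup A] [LieRingModule V A] [AddCommGroup G]
  [LieRingModule V G]

/-- The adjoint part of the standard bracket over a Lie algebra of derivations. -/
def adjPart (br : G →+ G →+ G) (X : V) (a : G) (Y : V) (b : G) : G :=
  ⁅X, b⁆ - ⁅Y, a⁆ + br a b

/-- The 1-form part of the standard bracket over a Lie algebra of derivations. -/
def cotPart (B : G →+ G →+ A) (X : V) (a : G) (ξ : V → A) (Y : V) (b : G) (η : V → A) (W : V) : A :=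
  ⁅X, η W⁆ - η ⁅X, W⁆ - (⁅Y, ξ W⁆ - ⁅W, ξ Y⁆ - ξ ⁅Y, W⁆) + (2 : ℕ) • B b ⁅W, a⁆

lemma adjPart_leibniz {br : G →+ G →+ G} (hskew : ∀ a b, br a b = - br b a)
    (hjac : ∀ a b c, br a (br b c) = br (br a b) c + br b (br a c))
    (hder : ∀ (X : V) a b, ⁅X, br a b⁆ = br ⁅X, a⁆ b + br a ⁅X, b⁆)
    (X Y Z : V) (a b c : G) :
    adjPart br X a ⁅Y, Z⁆ (adjPart br Y b Z c) =
      adjPart br ⁅X, Y⁆ (adjPart br X a Y b) Z c + adjPart br Y b ⁅X, Z⁆ (adjPart br X a Z c) := by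
  simp only [adjPart, lie_add, lie_sub, lie_lie, map_add, map_sub, AddMonoidHom.add_apply,
    AddMonoidHom.sub_apply, hder, hjac a b c, hskew ⁅Z, a⁆ b]
  abel

lemma cotPart_leibniz {br : G →+ G →+ G} {B : G →+ G →+ A} (hskew : ∀ a b, br a b = - br b a)
    (hder : ∀ (X : V) a b, ⁅X, br a b⁆ = br ⁅X, a⁆ b + br a ⁅X, b⁆)
    (hB : ∀ (X : V) a b, ⁅X, B a b⁆ = B ⁅X, a⁆ b + B a ⁅X, b⁆)
    (hsymm : ∀ a b, B a b = B b a) (hinv : ∀ a b c, B (br a b) c = B a (br b c))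
    (X Y Z : V) (a b c : G) (ξ η ζ : V →+ A) (W : V) :
    cotPart B X a ξ ⁅Y, Z⁆ (adjPart br Y b Z c) (cotPart B Y b η Z c ζ) W =
      cotPart B ⁅X, Y⁆ (adjPart br X a Y b) (cotPart B X a ξ Y b η) Z c ζ W
        + cotPart B Y b η ⁅X, Z⁆ (adjPart br X a Z c) (cotPart B X a ξ Z c ζ) W := by
  have h1 : B (br b c) ⁅W, a⁆ = B c (br ⁅W, a⁆ b) := by
    rw [hskew b c, map_neg, AddMonoidHom.neg_apply, hinv, hskew ⁅W, a⁆ b, map_neg]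
  have h2 : B (br a c) ⁅W, b⁆ = - B c (br a ⁅W, b⁆) := by
    rw [hskew a c, map_neg, AddMonoidHom.neg_apply, hinv]
  simp only [cotPart, adjPart, lie_add, lie_sub, lie_lie, lie_nsmul, map_add, map_sub,
    AddMonoidHom.add_apply, AddMonoidHom.sub_apply, hder, hB, h1, h2, hsymm ⁅Z, a⁆ ⁅W, b⁆, smul_add,
    smul_sub, smul_neg]
  abel

end AbstractLeibniz

section Leibniz

set_option linter.unusedSectionVars false

open Filter Topology

variable {E : Type uE} [NormedAddCommGroup E] [NormedSpace ℝ E]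
  {M : Type uM} [TopologicalSpace M] [ChartedSpace E M] [IsManifold 𝓘(ℝ, E) ∞ M]
  {F : Type uF} [NormedAddCommGroup F] [NormedSpace ℝ F]
  {𝔤 : Type uG} [NormedAddCommGroup 𝔤] [NormedSpace ℝ 𝔤] {𝔮 : QuadraticLieAlgebra 𝔤}
  [FiniteDimensional ℝ E] {x : M}

/-- Extension by zero from the open set `U`. -/
def cut (U : Opens M) {A : M → Type*} [∀ y, Zero (A y)] (e : ∀ y, A y) (y : M) : A y :=
  open Classical in if y ∈ U then e y else 0

lemma cut_of_mem {U : Opens M} {A : M → Type*} [∀ y, Zero (A y)] (e : ∀ y, A y) {y : M}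
    (hy : y ∈ U) : cut U e y = e y := if_pos hy

lemma cut_of_notMem {U : Opens M} {A : M → Type*} [∀ y, Zero (A y)] (e : ∀ y, A y) {y : M}
    (hy : y ∉ U) : cut U e y = 0 := if_neg hy

lemma cut_eventuallyEq {U : Opens M} {A : M → Type*} [∀ y, Zero (A y)] (e : ∀ y, A y) {y : M}
    (hy : y ∈ U) : ∀ᶠ z in 𝓝 y, cut U e z = e z :=
  (U.isOpen.mem_nhds hy |> eventually_mem_set.2).mono fun _ hz => cut_of_mem e hz

/-- Vector fields that are smooth on `U` and vanish elsewhere. -/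
def VFOn (U : Opens M) : AddSubgroup (∀ y : M, Tan (E := E) y) where
  carrier := {X | (∀ y ∈ U, VFSmoothAt X y) ∧ ∀ y ∉ U, X y = 0}
  add_mem' hX hY := ⟨fun y hy => (hX.1 y hy).fadd (hY.1 y hy), fun y hy => by
    simp [hX.2 y hy, hY.2 y hy]⟩
  zero_mem' := ⟨fun _ _ => vfSmoothAt_zero, fun _ _ => rfl⟩
  neg_mem' hX := ⟨fun y hy => (hX.1 y hy).fneg, fun y hy => by simp [hX.2 y hy]⟩

variable (E F) in
/-- Functions that are smooth on `U` and vanish elsewhere. -/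
def FnOn (U : Opens M) : AddSubgroup (M → F) where
  carrier := {f | (∀ y ∈ U, FnSmoothAt (E := E) f y) ∧ ∀ y ∉ U, f y = 0}
  add_mem' hX hY := ⟨fun y hy => (hX.1 y hy).fadd (hY.1 y hy), fun y hy => by
    simp [hX.2 y hy, hY.2 y hy]⟩
  zero_mem' := ⟨fun _ _ => fnSmoothAt_const 0, fun _ _ => rfl⟩
  neg_mem' hX := ⟨fun y hy => (hX.1 y hy).fneg, fun y hy => by simp [hX.2 y hy]⟩

variable {U : Opens M}

/-- The restriction of a vector field to `U`. -/
def VFOn.mk (X : ∀ y : M, Tan (E := E) y) (hX : ∀ y ∈ U, VFSmoothAt X y) : VFOn (E := E) U :=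
  ⟨cut U X, fun y hy => (hX y hy).congr (cut_eventuallyEq X hy), fun _ hy => cut_of_notMem X hy⟩

/-- The restriction of a function to `U`. -/
def FnOn.mk (f : M → F) (hf : ∀ y ∈ U, FnSmoothAt (E := E) f y) : FnOn E F U :=
  ⟨cut U f, fun y hy => (hf y hy).congr (cut_eventuallyEq f hy), fun _ hy => cut_of_notMem f hy⟩

lemma VFOn.mk_apply {X : ∀ y : M, Tan (E := E) y} {hX : ∀ y ∈ U, VFSmoothAt X y} {y : M}
    (hy : y ∈ U) : (VFOn.mk X hX).1 y = X y := cut_of_mem X hy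

lemma FnOn.mk_apply {f : M → F} {hf : ∀ y ∈ U, FnSmoothAt (E := E) f y} {y : M}
    (hy : y ∈ U) : (FnOn.mk f hf).1 y = f y := cut_of_mem f hy

lemma VFOn.ext' {X Y : VFOn (E := E) U} (h : ∀ y ∈ U, X.1 y = Y.1 y) : X = Y := by
  refine Subtype.ext (funext fun y => ?_)
  by_cases hy : y ∈ U
  · exact h y hy
  · rw [X.2.2 y hy, Y.2.2 y hy]

lemma FnOn.ext' {f g : FnOn E F U} (h : ∀ y ∈ U, f.1 y = g.1 y) : f = g := by
  refine Subtype.ext (funext fun y => ?_)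
  by_cases hy : y ∈ U
  · exact h y hy
  · rw [f.2.2 y hy, g.2.2 y hy]

variable [CompleteSpace E]

instance : Bracket (VFOn (E := E) U) (VFOn (E := E) U) :=
  ⟨fun X Y => VFOn.mk (lie X.1 Y.1) fun _ hy => lie_smooth (X.2.1 _ hy) (Y.2.1 _ hy)⟩

instance : Bracket (VFOn (E := E) U) (FnOn E F U) :=
  ⟨fun X f => ⟨fun y => dd f.1 y (X.1 y), fun _ hy => dd_smooth (f.2.1 _ hy) (X.2.1 _ hy),
    fun y hy => (congrArg (mvfderiv 𝓘(ℝ, E) f.1 y) (X.2.2 y hy)).trans (map_zero _)⟩⟩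

lemma VFOn.lie_apply (X Y : VFOn (E := E) U) {y : M} (hy : y ∈ U) :
    (⁅X, Y⁆ : VFOn (E := E) U).1 y = lie X.1 Y.1 y := VFOn.mk_apply hy

lemma VFOn.lie_eventuallyEq (X Y : VFOn (E := E) U) {y : M} (hy : y ∈ U) :
    ∀ᶠ z in 𝓝 y, (⁅X, Y⁆ : VFOn (E := E) U).1 z = lie X.1 Y.1 z := cut_eventuallyEq _ hy

instance : LieRing (VFOn (E := E) U) where
  add_lie X Y Z := VFOn.ext' fun y hy => by
    rw [VFOn.lie_apply _ _ hy]
    refine (lie_add_left (X.2.1 _ hy) (Y.2.1 _ hy)).trans ?_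
    rw [← VFOn.lie_apply _ _ hy, ← VFOn.lie_apply _ _ hy]
    rfl
  lie_add X Y Z := VFOn.ext' fun y hy => by
    rw [VFOn.lie_apply _ _ hy]
    refine (lie_add_right (Y.2.1 _ hy) (Z.2.1 _ hy)).trans ?_
    rw [← VFOn.lie_apply _ _ hy, ← VFOn.lie_apply _ _ hy]
    rfl
  lie_self X := VFOn.ext' fun y hy => by
    rw [VFOn.lie_apply _ _ hy, lie_self]
    rfl
  leibniz_lie X Y Z := VFOn.ext' fun y hy => by
    have hr : ∀ {X : ∀ y : M, Tan (E := E) y}, ∀ᶠ z in 𝓝 y, X z = X z :=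
      Eventually.of_forall fun _ => rfl
    rw [VFOn.lie_apply _ _ hy, lie_congr hr (VFOn.lie_eventuallyEq Y Z hy),
      lie_jacobi (X.2.1 _ hy) (Y.2.1 _ hy) (Z.2.1 _ hy),
      lie_congr hr ((VFOn.lie_eventuallyEq X Z hy).mono fun _ h => h.symm),
      lie_congr ((VFOn.lie_eventuallyEq X Y hy).mono fun _ h => h.symm) hr,
      ← VFOn.lie_apply _ _ hy, ← VFOn.lie_apply _ _ hy]
    rfl

instance : LieRingModule (VFOn (E := E) U) (FnOn E F U) where
  add_lie X Y f := FnOn.ext' fun y hy => map_add (mvfderiv 𝓘(ℝ, E) f.1 y) _ _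
  lie_add X f g := FnOn.ext' fun y hy => dd_add (f.2.1 _ hy).mdiff (g.2.1 _ hy).mdiff _
  leibniz_lie X Y f := FnOn.ext' fun y hy => by
    change dd (fun z => dd f.1 z (Y.1 z)) y (X.1 y) = dd f.1 y ((⁅X, Y⁆ : VFOn (E := E) U).1 y)
      + dd (fun z => dd f.1 z (X.1 z)) y (Y.1 y)
    rw [VFOn.lie_apply _ _ hy, dd_lie (f.2.1 _ hy) (X.2.1 _ hy) (Y.2.1 _ hy)]
    abel

/-- A bilinear map, applied to functions on `U`. -/
def FnOn.bilin {F' F'' : Type*} [NormedAddCommGroup F'] [NormedSpace ℝ F'] [NormedAddCommGroup F'']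
    [NormedSpace ℝ F''] (B : F →L[ℝ] F' →L[ℝ] F'') :
    FnOn E F U →+ FnOn E F' U →+ FnOn E F'' U :=
  AddMonoidHom.mk' (fun f => AddMonoidHom.mk' (fun g =>
    ⟨fun y => B (f.1 y) (g.1 y), fun _ hy => FnSmoothAt.bilin B (f.2.1 _ hy) (g.2.1 _ hy),
      fun y hy => (congrArg (fun a => B a (g.1 y)) (f.2.2 y hy)).trans (by simp)⟩)
    fun g g' => Subtype.ext (funext fun y => map_add (B (f.1 y)) _ _))
    fun f f' => AddMonoidHom.ext fun g => Subtype.ext (funext fun y => by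
      change B (f.1 y + f'.1 y) (g.1 y) = _
      rw [map_add]; rfl)

lemma FnOn.lie_bilin {F' F'' : Type*} [NormedAddCommGroup F'] [NormedSpace ℝ F']
    [NormedAddCommGroup F''] [NormedSpace ℝ F''] (B : F →L[ℝ] F' →L[ℝ] F'')
    (X : VFOn (E := E) U) (f : FnOn E F U) (g : FnOn E F' U) :
    ⁅X, FnOn.bilin B f g⁆ = FnOn.bilin B ⁅X, f⁆ g + FnOn.bilin B f ⁅X, g⁆ :=
  FnOn.ext' fun _ hy => dd_bilin B (f.2.1 _ hy).mdiff (g.2.1 _ hy).mdiff _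

variable {e e₁ e₂ e₃ : ∀ y : M, StdFib E 𝔤 y}

/-- The tangent part of a section, on `U`. -/
def tanOn (h : ∀ y ∈ U, StdSmoothAt e y) : VFOn (E := E) U :=
  VFOn.mk (fun y => (e y).1) fun y hy => (h y hy).1

/-- The adjoint part of a section, on `U`. -/
def adjOn (h : ∀ y ∈ U, StdSmoothAt e y) : FnOn E 𝔤 U :=
  FnOn.mk (fun y => (e y).2.1) fun y hy => (h y hy).2.1

/-- The 1-form part of a section, on `U`. -/
def cotOn (h : ∀ y ∈ U, StdSmoothAt e y) : VFOn (E := E) U →+ FnOn E ℝ U :=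
  AddMonoidHom.mk' (fun W => ⟨fun y => (e y).2.2 (W.1 y), fun y hy => (h y hy).2.2 _ (W.2.1 _ hy),
    fun y hy => (congrArg (e y).2.2 (W.2.2 y hy)).trans (map_zero _)⟩)
    fun _ _ => Subtype.ext (funext fun y => map_add (e y).2.2 _ _)

lemma tanOn_apply (h : ∀ y ∈ U, StdSmoothAt e y) {y : M} (hy : y ∈ U) :
    (tanOn h).1 y = (e y).1 := VFOn.mk_apply hy

lemma adjOn_apply (h : ∀ y ∈ U, StdSmoothAt e y) {y : M} (hy : y ∈ U) :
    (adjOn h).1 y = (e y).2.1 := FnOn.mk_apply hy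

lemma IsStdBracketAt.fst_eq (h₁ : ∀ y ∈ U, StdSmoothAt e₁ y)
    (h₂ : ∀ y ∈ U, StdSmoothAt e₂ y) {y : M} (hy : y ∈ U) {u : StdFib E 𝔤 y}
    (hu : IsStdBracketAt 𝔮 e₁ e₂ y u) : u.1 = (⁅tanOn h₁, tanOn h₂⁆ : VFOn (E := E) U).1 y := by
  rw [VFOn.lie_apply _ _ hy, hu.1]
  exact lie_congr ((cut_eventuallyEq _ hy).mono fun _ h => h.symm)
    ((cut_eventuallyEq _ hy).mono fun _ h => h.symm)

lemma IsStdBracketAt.adj_eq (h₁ : ∀ y ∈ U, StdSmoothAt e₁ y)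
    (h₂ : ∀ y ∈ U, StdSmoothAt e₂ y) {y : M} (hy : y ∈ U) {u : StdFib E 𝔤 y}
    (hu : IsStdBracketAt 𝔮 e₁ e₂ y u) :
    u.2.1 = (adjPart (FnOn.bilin 𝔮.bracket) (tanOn h₁) (adjOn h₁) (tanOn h₂) (adjOn h₂)).1 y := by
  change _ = dd (adjOn h₂).1 y ((tanOn h₁).1 y) - dd (adjOn h₁).1 y ((tanOn h₂).1 y)
    + 𝔮.bracket ((adjOn h₁).1 y) ((adjOn h₂).1 y)
  rw [hu.2.1, tanOn_apply h₁ hy, tanOn_apply h₂ hy, adjOn_apply h₁ hy, adjOn_apply h₂ hy,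
    dd_congr (f := (adjOn h₁).1) (cut_eventuallyEq _ hy),
    dd_congr (f := (adjOn h₂).1) (cut_eventuallyEq _ hy)]

lemma IsStdBracketAt.cot_eq (h₁ : ∀ y ∈ U, StdSmoothAt e₁ y)
    (h₂ : ∀ y ∈ U, StdSmoothAt e₂ y) {y : M} (hy : y ∈ U) {u : StdFib E 𝔤 y}
    (hu : IsStdBracketAt 𝔮 e₁ e₂ y u) (W : VFOn (E := E) U) :
    u.2.2 (W.1 y) = (cotPart (FnOn.bilin 𝔮.form) (tanOn h₁) (adjOn h₁) (cotOn h₁)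
      (tanOn h₂) (adjOn h₂) (cotOn h₂) W).1 y := by
  have hr : ∀ {X : ∀ y : M, Tan (E := E) y}, ∀ᶠ z in 𝓝 y, X z = X z :=
    Eventually.of_forall fun _ => rfl
  change _ = dd (cotOn h₂ W).1 y ((tanOn h₁).1 y)
    - (e₂ y).2.2 ((⁅tanOn h₁, W⁆ : VFOn (E := E) U).1 y)
    - (dd (cotOn h₁ W).1 y ((tanOn h₂).1 y) - dd (cotOn h₁ (tanOn h₂)).1 y (W.1 y)
      - (e₁ y).2.2 ((⁅tanOn h₂, W⁆ : VFOn (E := E) U).1 y))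
    + ((2 : ℕ) • FnOn.bilin 𝔮.form (adjOn h₂) ⁅W, adjOn h₁⁆).1 y
  rw [two_smul, VFOn.lie_apply _ _ hy, VFOn.lie_apply _ _ hy, hu.2.2 _ (W.2.1 _ hy), lieDer, dOne]
  change _ = _ - _ - _ + (𝔮.form ((adjOn h₂).1 y) (dd (adjOn h₁).1 y (W.1 y))
    + 𝔮.form ((adjOn h₂).1 y) (dd (adjOn h₁).1 y (W.1 y)))
  rw [tanOn_apply h₁ hy, tanOn_apply h₂ hy, adjOn_apply h₂ hy,
    dd_congr (f := (adjOn h₁).1) (cut_eventuallyEq _ hy),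
    lie_congr (X := (tanOn h₁).1) (cut_eventuallyEq _ hy) hr,
    lie_congr (X := (tanOn h₂).1) (cut_eventuallyEq _ hy) hr,
    dd_congr (f := (cotOn h₁ (tanOn h₂)).1) (g := fun z => (e₁ z).2.2 (e₂ z).1)
      ((cut_eventuallyEq _ hy).mono fun z hz => congrArg (e₁ z).2.2 hz), two_mul]
  rfl

lemma tanOn_eq
    {u : ∀ y : M, StdFib E 𝔤 y} (h₁ : ∀ y ∈ U, StdSmoothAt e₁ y)
    (h₂ : ∀ y ∈ U, StdSmoothAt e₂ y) (h : ∀ y ∈ U, StdSmoothAt u y)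
    (hu : ∀ y ∈ U, IsStdBracketAt 𝔮 e₁ e₂ y (u y)) :
    tanOn h = ⁅tanOn h₁, tanOn h₂⁆ :=
  VFOn.ext' fun y hy => (tanOn_apply h hy).trans ((hu y hy).fst_eq h₁ h₂ hy)

lemma adjOn_eq
    {u : ∀ y : M, StdFib E 𝔤 y} (h₁ : ∀ y ∈ U, StdSmoothAt e₁ y)
    (h₂ : ∀ y ∈ U, StdSmoothAt e₂ y) (h : ∀ y ∈ U, StdSmoothAt u y)
    (hu : ∀ y ∈ U, IsStdBracketAt 𝔮 e₁ e₂ y (u y)) :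
    adjOn h =
    adjPart (FnOn.bilin 𝔮.bracket) (tanOn h₁) (adjOn h₁) (tanOn h₂) (adjOn h₂) :=
  FnOn.ext' fun y hy => (adjOn_apply h hy).trans ((hu y hy).adj_eq h₁ h₂ hy)

lemma cotOn_eq
    {u : ∀ y : M, StdFib E 𝔤 y} (h₁ : ∀ y ∈ U, StdSmoothAt e₁ y)
    (h₂ : ∀ y ∈ U, StdSmoothAt e₂ y) (h : ∀ y ∈ U, StdSmoothAt u y)
    (hu : ∀ y ∈ U, IsStdBracketAt 𝔮 e₁ e₂ y (u y)) :
    (cotOn h : VFOn (E := E) U → FnOn E ℝ U) =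
    cotPart (FnOn.bilin 𝔮.form) (tanOn h₁) (adjOn h₁) (cotOn h₁) (tanOn h₂) (adjOn h₂)
      (cotOn h₂) :=
  funext fun W => FnOn.ext' fun y hy => (hu y hy).cot_eq h₁ h₂ hy W

lemma IsStdBracketAt.leibniz {u₁₂ u₁₃ u₂₃ : ∀ y : M, StdFib E 𝔤 y} {a b c : StdFib E 𝔤 x}
    (hx : x ∈ U) (h₁ : ∀ y ∈ U, StdSmoothAt e₁ y) (h₂ : ∀ y ∈ U, StdSmoothAt e₂ y)
    (h₃ : ∀ y ∈ U, StdSmoothAt e₃ y) (h₁₂ : ∀ y ∈ U, StdSmoothAt u₁₂ y)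
    (h₁₃ : ∀ y ∈ U, StdSmoothAt u₁₃ y) (h₂₃ : ∀ y ∈ U, StdSmoothAt u₂₃ y)
    (hu₁₂ : ∀ y ∈ U, IsStdBracketAt 𝔮 e₁ e₂ y (u₁₂ y))
    (hu₁₃ : ∀ y ∈ U, IsStdBracketAt 𝔮 e₁ e₃ y (u₁₃ y))
    (hu₂₃ : ∀ y ∈ U, IsStdBracketAt 𝔮 e₂ e₃ y (u₂₃ y))
    (ha : IsStdBracketAt 𝔮 e₁ u₂₃ x a) (hb : IsStdBracketAt 𝔮 u₁₂ e₃ x b)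
    (hc : IsStdBracketAt 𝔮 e₂ u₁₃ x c) : a = b + c := by
  have hder : ∀ (V : Opens M) (X : VFOn (E := E) V) (f g : FnOn E 𝔤 V),
      ⁅X, FnOn.bilin 𝔮.bracket f g⁆ = FnOn.bilin 𝔮.bracket ⁅X, f⁆ g + FnOn.bilin 𝔮.bracket f ⁅X, g⁆ :=
    fun V X f g => FnOn.lie_bilin 𝔮.bracket X f g
  have hskew : ∀ (V : Opens M) (f g : FnOn E 𝔤 V),
      FnOn.bilin 𝔮.bracket f g = - FnOn.bilin 𝔮.bracket g f := fun V f g =>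
    FnOn.ext' fun y _ => 𝔮.bracket_swap _ _
  refine Prod.ext ?_ (Prod.ext ?_ (cotan_ext fun Z hZ => ?_))
  · rw [Prod.fst_add, ha.fst_eq h₁ h₂₃ hx, hb.fst_eq h₁₂ h₃ hx, hc.fst_eq h₂ h₁₃ hx,
      tanOn_eq h₁ h₂ h₁₂ hu₁₂, tanOn_eq h₂ h₃ h₂₃ hu₂₃, tanOn_eq h₁ h₃ h₁₃ hu₁₃, leibniz_lie]
    rfl
  · rw [Prod.snd_add, Prod.fst_add, ha.adj_eq h₁ h₂₃ hx, hb.adj_eq h₁₂ h₃ hx, hc.adj_eq h₂ h₁₃ hx,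
      tanOn_eq h₁ h₂ h₁₂ hu₁₂, tanOn_eq h₂ h₃ h₂₃ hu₂₃, tanOn_eq h₁ h₃ h₁₃ hu₁₃,
      adjOn_eq h₁ h₂ h₁₂ hu₁₂, adjOn_eq h₂ h₃ h₂₃ hu₂₃, adjOn_eq h₁ h₃ h₁₃ hu₁₃,
      adjPart_leibniz (hskew U) (fun f g k => FnOn.ext' fun y _ => 𝔮.jacobi _ _ _) (hder U)]
    rfl
  · obtain ⟨W, hW, hWx⟩ := exists_vf x (Z x)
    obtain ⟨V, hVsub, hVo, hxV⟩ := mem_nhds_iff.1 (inter_mem hW (U.isOpen.mem_nhds hx))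
    let V' : Opens M := ⟨V, hVo⟩
    have hV : V' ≤ U := fun y hy => (hVsub hy).2
    let W' : VFOn (E := E) V' := VFOn.mk W fun y hy => (hVsub hy).1
    have hW' : W'.1 x = Z x := (VFOn.mk_apply (U := V') hxV).trans hWx
    have r : ∀ {e : ∀ y : M, StdFib E 𝔤 y}, (∀ y ∈ U, StdSmoothAt e y) → ∀ y ∈ V', StdSmoothAt e y :=
      fun h y hy => h y (hV hy)
    have r₁₂ := fun y (hy : y ∈ V') => hu₁₂ y (hV hy)
    have r₁₃ := fun y (hy : y ∈ V') => hu₁₃ y (hV hy)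
    have r₂₃ := fun y (hy : y ∈ V') => hu₂₃ y (hV hy)
    rw [← hW', Prod.snd_add, Prod.snd_add, add_apply, ha.cot_eq (r h₁) (r h₂₃) hxV,
      hb.cot_eq (r h₁₂) (r h₃) hxV, hc.cot_eq (r h₂) (r h₁₃) hxV,
      tanOn_eq (r h₁) (r h₂) (r h₁₂) r₁₂, tanOn_eq (r h₂) (r h₃) (r h₂₃) r₂₃,
      tanOn_eq (r h₁) (r h₃) (r h₁₃) r₁₃, adjOn_eq (r h₁) (r h₂) (r h₁₂) r₁₂,
      adjOn_eq (r h₂) (r h₃) (r h₂₃) r₂₃, adjOn_eq (r h₁) (r h₃) (r h₁₃) r₁₃,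
      cotOn_eq (r h₁) (r h₂) (r h₁₂) r₁₂, cotOn_eq (r h₂) (r h₃) (r h₂₃) r₂₃,
      cotOn_eq (r h₁) (r h₃) (r h₁₃) r₁₃,
      cotPart_leibniz (hskew V') (hder V') (fun X f g => FnOn.lie_bilin 𝔮.form X f g)
        (fun f g => FnOn.ext' fun y _ => 𝔮.form_symm _ _)
        (fun f g k => FnOn.ext' fun y _ => 𝔮.form_invariant _ _ _)]
    rfl

end Leibniz

section Automorphisms

set_option linter.unusedSectionVars false

open Filter Topology

variable {E : Type uE} [NormedAddCommGroup E] [NormedSpace ℝ E] [FiniteDimensional ℝ E]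
  [CompleteSpace E]
  {M : Type uM} [TopologicalSpace M] [ChartedSpace E M] [IsManifold 𝓘(ℝ, E) ∞ M]
  {𝔤 : Type uG} [NormedAddCommGroup 𝔤] [NormedSpace ℝ 𝔤] {𝔮 : QuadraticLieAlgebra 𝔤}
  {x : M} {W : Opens M}

/-! ### Automorphisms of the standard transitive Courant algebroid -/

namespace StdAut

variable (Λ : StdAut E 𝔮 W)

lemma act_fst (x : M) (e : StdFib E 𝔤 x) : (Λ.act x e).1 = e.1 := rfl

lemma act_adj (x : M) (e : StdFib E 𝔤 x) : (Λ.act x e).2.1 = Λ.φ x e.1 + Λ.τ x e.2.1 := rfl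

lemma act_cot (x : M) (e : StdFib E 𝔤 x) (z : Tan (E := E) x) :
    (Λ.act x e).2.2 z = Λ.β x e.1 z - 2 * 𝔮.form (Λ.τ x e.2.1) (Λ.φ x z) + e.2.2 z := by
  simp [act]

/-- The action on the fibre as a linear map. -/
def actₗ (x : M) : StdFib E 𝔤 x →ₗ[ℝ] StdFib E 𝔤 x where
  toFun := Λ.act x
  map_add' u v := by
    refine Prod.ext rfl (Prod.ext ?_ (ContinuousLinearMap.ext fun z => ?_))
    · simp only [act_adj, Prod.fst_add, Prod.snd_add, map_add]
      abel
    · simp only [act_cot, Prod.fst_add, Prod.snd_add, map_add, add_apply]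
      ring
  map_smul' c u := by
    refine Prod.ext rfl (Prod.ext ?_ (ContinuousLinearMap.ext fun z => ?_))
    · simp only [act_adj, Prod.smul_fst, Prod.smul_snd, map_smul, RingHom.id_apply]
      module
    · simp only [act_cot, Prod.smul_fst, Prod.smul_snd, map_smul, smul_apply, RingHom.id_apply,
        smul_eq_mul]
      ring

lemma act_injective {x : M} (hx : x ∈ W) : Function.Injective (Λ.act x) := by
  intro u v h
  have h1 : u.1 = v.1 := congrArg (fun e => e.1) h
  have h2 : u.2.1 = v.2.1 := by
    have := congrArg (fun e => e.2.1) h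
    simp only [act_adj, h1, add_right_inj] at this
    exact (Λ.τ_bijective x hx).1 this
  refine Prod.ext h1 (Prod.ext h2 (ContinuousLinearMap.ext fun z => ?_))
  have := congrArg (fun e => e.2.2 z) h
  simpa only [act_cot, h1, h2, add_right_inj] using this

lemma act_surjective {x : M} (hx : x ∈ W) : Function.Surjective (Λ.act x) := by
  intro v
  obtain ⟨a, ha⟩ := (Λ.τ_bijective x hx).2 (v.2.1 - Λ.φ x v.1)
  refine ⟨(v.1, a, v.2.2 - (Λ.β x v.1 - (2 : ℝ) • (𝔮.form (Λ.τ x a)).comp (Λ.φ x))), ?_⟩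
  refine Prod.ext rfl (Prod.ext ?_ ?_)
  · simp [act, ha]
  · simp [act]

lemma act_bijective {x : M} (hx : x ∈ W) : Function.Bijective (Λ.act x) :=
  ⟨Λ.act_injective hx, Λ.act_surjective hx⟩

lemma act_pairing {x : M} (hx : x ∈ W) (u v : StdFib E 𝔤 x) :
    stdPairing 𝔮 x (Λ.act x u) (Λ.act x v) = stdPairing 𝔮 x u v := by
  have h1 := Λ.β_symm x hx u.1 v.1
  have h2 := Λ.τ_form x hx u.2.1 v.2.1
  have h3 := 𝔮.form_symm (Λ.φ x u.1) (Λ.τ x v.2.1)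
  simp only [stdPairing, act_cot, act_fst, act_adj, map_add, add_apply]
  linear_combination h1 + h2 + h3

variable {Λ}

lemma stdSmoothAt_act (hx : x ∈ W) {e : ∀ y : M, StdFib E 𝔤 y} (he : StdSmoothAt e x) :
    StdSmoothAt (fun y => Λ.act y (e y)) x := by
  have hτ : FnSmoothAt (E := E) (fun y => Λ.τ y (e y).2.1) x :=
    ContMDiffAt.clm_apply (Λ.τ_smooth x hx) he.2.1
  refine ⟨he.1, (Λ.φ_smooth x hx _ he.1).fadd hτ, fun Z hZ => ?_⟩
  simp only [act_cot]
  exact ((Λ.β_smooth x hx _ _ he.1 hZ).fsub (FnSmoothAt.fmul (fnSmoothAt_const 2)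
    (FnSmoothAt.bilin 𝔮.form hτ (Λ.φ_smooth x hx Z hZ)))).fadd (he.2.2 Z hZ)

lemma smooth_of_τ_smooth [FiniteDimensional ℝ 𝔤] (hx : x ∈ W) {a : M → 𝔤}
    (h : FnSmoothAt (E := E) (fun y => Λ.τ y (a y)) x) : FnSmoothAt (E := E) a x := by
  have : CompleteSpace 𝔤 := FiniteDimensional.complete ℝ 𝔤
  let τe : 𝔤 ≃L[ℝ] 𝔤 := (LinearEquiv.ofBijective (Λ.τ x : 𝔤 →ₗ[ℝ] 𝔤)
    (Λ.τ_bijective x hx)).toContinuousLinearEquiv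
  have hτe : (τe : 𝔤 →L[ℝ] 𝔤) = Λ.τ x := by ext a; rfl
  have hinv : FnSmoothAt (E := E) (fun y => ContinuousLinearMap.inverse (Λ.τ y)) x := by
    have h1 : ContDiffAt ℝ ∞ (ContinuousLinearMap.inverse : (𝔤 →L[ℝ] 𝔤) → _) (Λ.τ x) :=
      hτe ▸ contDiffAt_map_inverse τe
    exact h1.contMDiffAt.comp x (Λ.τ_smooth x hx)
  refine FnSmoothAt.congr (ContMDiffAt.clm_apply hinv h) ?_
  filter_upwards [W.isOpen.mem_nhds hx] with y hy
  let τy : 𝔤 ≃L[ℝ] 𝔤 := (LinearEquiv.ofBijective (Λ.τ y : 𝔤 →ₗ[ℝ] 𝔤)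
    (Λ.τ_bijective y hy)).toContinuousLinearEquiv
  have hτy : Λ.τ y = (τy : 𝔤 →L[ℝ] 𝔤) := by ext a; rfl
  rw [hτy, ContinuousLinearMap.inverse_equiv]
  simp

lemma stdSmoothAt_act_iff [FiniteDimensional ℝ 𝔤] (hx : x ∈ W) {e : ∀ y : M, StdFib E 𝔤 y} :
    StdSmoothAt (fun y => Λ.act y (e y)) x ↔ StdSmoothAt e x := by
  refine ⟨fun h => ?_, stdSmoothAt_act hx⟩
  have h1 : VFSmoothAt (fun y => (e y).1) x := h.1
  have hτ : FnSmoothAt (E := E) (fun y => Λ.τ y (e y).2.1) x :=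
    FnSmoothAt.congr (FnSmoothAt.fsub h.2.1 (Λ.φ_smooth x hx _ h1))
      (Eventually.of_forall fun y => by simp [act_adj])
  refine ⟨h1, smooth_of_τ_smooth hx hτ, fun Z hZ => ?_⟩
  refine FnSmoothAt.congr ((h.2.2 Z hZ).fsub ((Λ.β_smooth x hx _ _ h1 hZ).fsub
    (FnSmoothAt.fmul (fnSmoothAt_const 2)
      (FnSmoothAt.bilin 𝔮.form hτ (Λ.φ_smooth x hx Z hZ))))) (Eventually.of_forall fun y => ?_)
  simp [act_cot]

/-- Automorphisms preserve the standard bracket. -/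
lemma isStdBracketAt_act (hx : x ∈ W) {e₁ e₂ : ∀ y : M, StdFib E 𝔤 y} (h₁ : StdSmoothAt e₁ x)
    (h₂ : StdSmoothAt e₂ x) {u : StdFib E 𝔤 x} (hu : IsStdBracketAt 𝔮 e₁ e₂ x u) :
    IsStdBracketAt 𝔮 (fun y => Λ.act y (e₁ y)) (fun y => Λ.act y (e₂ y)) x (Λ.act x u) := by
  have hτ₁ : FnSmoothAt (E := E) (fun y => Λ.τ y (e₁ y).2.1) x :=
    ContMDiffAt.clm_apply (Λ.τ_smooth x hx) h₁.2.1
  have hτ₂ : FnSmoothAt (E := E) (fun y => Λ.τ y (e₂ y).2.1) x :=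
    ContMDiffAt.clm_apply (Λ.τ_smooth x hx) h₂.2.1
  have hφ := Λ.φ_smooth x hx
  have d₁ : ∀ v, dd (fun y => Λ.τ y (e₁ y).2.1) x v
      = Λ.τ x (dd (fun y => (e₁ y).2.1) x v) - 𝔮.bracket (Λ.φ x v) (Λ.τ x (e₁ x).2.1) :=
    fun v => by
      have h := Λ.τ_deriv x hx _ h₁.2.1 v
      rw [sub_sub, sub_eq_zero] at h
      rw [h]; abel
  have d₂ : ∀ v, dd (fun y => Λ.τ y (e₂ y).2.1) x v
      = Λ.τ x (dd (fun y => (e₂ y).2.1) x v) - 𝔮.bracket (Λ.φ x v) (Λ.τ x (e₂ x).2.1) :=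
    fun v => by
      have h := Λ.τ_deriv x hx _ h₂.2.1 v
      rw [sub_sub, sub_eq_zero] at h
      rw [h]; abel
  have D₁ : ∀ v, dd (fun y => Λ.φ y (e₁ y).1 + Λ.τ y (e₁ y).2.1) x v
      = dd (fun y => Λ.φ y (e₁ y).1) x v + dd (fun y => Λ.τ y (e₁ y).2.1) x v :=
    dd_add (hφ _ h₁.1).mdiff hτ₁.mdiff
  have D₂ : ∀ v, dd (fun y => Λ.φ y (e₂ y).1 + Λ.τ y (e₂ y).2.1) x v
      = dd (fun y => Λ.φ y (e₂ y).1) x v + dd (fun y => Λ.τ y (e₂ y).2.1) x v :=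
    dd_add (hφ _ h₂.1).mdiff hτ₂.mdiff
  refine ⟨hu.1, ?_, fun Z hZ => ?_⟩
  · simp only [act_adj, act_fst, D₁, D₂, d₁, d₂, hu.1, hu.2.1, map_add, map_sub, Λ.τ_bracket x hx,
      add_apply]
    have hfl := Λ.φ_flat x hx _ _ h₁.1 h₂.1
    rw [dOne] at hfl
    have hsk := 𝔮.bracket_swap (Λ.τ x (e₁ x).2.1) (Λ.φ x (e₂ x).1)
    linear_combination (norm := module) -hfl - hsk
  · have hT := fun (a : ∀ y : M, StdFib E 𝔤 y) (ha : FnSmoothAt (E := E) (fun y => Λ.τ y (a y).2.1) x)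
        (ha₁ : StdSmoothAt a x) (Y : ∀ y : M, Tan (E := E) y) (hY : VFSmoothAt Y x)
        (v : Tan (E := E) x) =>
      (show dd (fun y => (Λ.act y (a y)).2.2 (Y y)) x v =
          dd (fun y => Λ.β y (a y).1 (Y y)) x v
            - 2 * (𝔮.form (dd (fun y => Λ.τ y (a y).2.1) x v) (Λ.φ x (Y x))
              + 𝔮.form (Λ.τ x (a x).2.1) (dd (fun y => Λ.φ y (Y y)) x v))
            + dd (fun y => (a y).2.2 (Y y)) x v by
        have hB := FnSmoothAt.bilin 𝔮.form ha (hφ Y hY)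
        have hβ := Λ.β_smooth x hx _ _ ha₁.1 hY
        have hB2 := FnSmoothAt.fmul (fnSmoothAt_const (E := E) (x := x) (2 : ℝ)) hB
        simp only [act_cot]
        rw [dd_add (hβ.fsub hB2).mdiff (ha₁.2.2 Y hY).mdiff, dd_sub hβ.mdiff hB2.mdiff,
          dd_const_mul _ hB.mdiff, dd_bilin 𝔮.form ha.mdiff (hφ Y hY).mdiff])
    have hβ := Λ.β_deriv x hx _ _ Z h₁.1 h₂.1 hZ
    have hfl₁ := congrArg (𝔮.form (Λ.τ x (e₂ x).2.1)) (Λ.φ_flat x hx _ _ h₁.1 hZ)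
    have hfl₂ := congrArg (𝔮.form (Λ.τ x (e₁ x).2.1)) (Λ.φ_flat x hx _ _ h₂.1 hZ)
    have hf := Λ.τ_form x hx (e₂ x).2.1 (dd (fun y => (e₁ y).2.1) x (Z x))
    have i₁ := 𝔮.form_invariant (Λ.τ x (e₂ x).2.1) (Λ.φ x (e₁ x).1) (Λ.φ x (Z x))
    have i₂ := 𝔮.form_invariant (Λ.τ x (e₁ x).2.1) (Λ.φ x (e₂ x).1) (Λ.φ x (Z x))
    have i₃ := 𝔮.form_invariant (Λ.φ x (Z x)) (Λ.τ x (e₁ x).2.1) (Λ.τ x (e₂ x).2.1)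
    rw [𝔮.bracket_swap (Λ.τ x _) (Λ.φ x _)] at i₁ i₂
    have s₁ := 𝔮.form_symm (Λ.τ x (e₂ x).2.1) (𝔮.bracket (Λ.φ x (Z x)) (Λ.τ x (e₁ x).2.1))
    have s₂ := 𝔮.form_symm (Λ.φ x (Z x)) (𝔮.bracket (Λ.τ x (e₁ x).2.1) (Λ.τ x (e₂ x).2.1))
    have s₃ := 𝔮.form_symm (Λ.φ x (e₂ x).1) (dd (fun y => Λ.τ y (e₁ y).2.1) x (Z x))
    simp only [lieDer, dOne] at hβ hfl₁ hfl₂ ⊢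
    rw [act_cot, hu.2.2 Z hZ, hu.1, hu.2.1, hT e₁ hτ₁ h₁ Z hZ, hT e₂ hτ₂ h₂ Z hZ]
    simp only [act_fst]
    rw [hT e₁ hτ₁ h₁ _ h₂.1]
    simp only [act_cot, act_adj, D₁, lieDer, dOne, d₁, d₂, map_add, map_sub, Λ.τ_bracket x hx, add_apply,
      sub_apply, neg_apply, map_neg, map_zero] at hfl₁ hfl₂ i₁ i₂ i₃ s₁ s₂ s₃ hf hβ ⊢
    linear_combination -hβ - 2 * hf + 2 * hfl₁ - 2 * hfl₂ + 2 * i₁ - 2 * i₂ - 2 * s₃ + 2 * (s₁ + i₃ + s₂)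

end StdAut

end Automorphisms

section Gluing

set_option linter.unusedSectionVars false

open Filter Topology

variable {E : Type uE} [NormedAddCommGroup E] [NormedSpace ℝ E] [FiniteDimensional ℝ E]
  [CompleteSpace E]
  {M : Type uM} [TopologicalSpace M] [ChartedSpace E M] [IsManifold 𝓘(ℝ, E) ∞ M]
  {𝔤 : Type uG} [NormedAddCommGroup 𝔤] [NormedSpace ℝ 𝔤] {𝔮 : QuadraticLieAlgebra 𝔤}
  {ι : Type uI} {U : ι → Opens M}
  {F : Type uF} [NormedAddCommGroup F] [NormedSpace ℝ F] {C : VB.{uE, uM, uF, w} E M F} {x : M}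

/-! ### Gluing Courant algebroids from charts -/

lemma eventually_mem_opens {V : Opens M} (hx : x ∈ V) : ∀ᶠ y in 𝓝 x, y ∈ V :=
  V.isOpen.mem_nhds hx

lemma VB.Sec.smoothAt (e : C.Sec) (x : M) : C.SmoothAt e x := e.contMDiff x

lemma stdPairing_symm (x : M) (u v : StdFib E 𝔤 x) : stdPairing 𝔮 x u v = stdPairing 𝔮 x v u := by
  rw [stdPairing, stdPairing, 𝔮.form_symm, add_comm (u.2.2 _)]

variable (𝔮) in
/-- The standard pairing as a bilinear map. -/
def stdPairingₗ (x : M) : StdFib E 𝔤 x →ₗ[ℝ] StdFib E 𝔤 x →ₗ[ℝ] ℝ :=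
  LinearMap.mk₂ ℝ (stdPairing 𝔮 x)
    (fun u u' v => by
      simp only [stdPairing, Prod.fst_add, Prod.snd_add, add_apply, map_add]; ring)
    (fun c u v => by
      simp only [stdPairing, Prod.smul_fst, Prod.smul_snd, smul_apply, map_smul, smul_eq_mul]; ring)
    (fun u v v' => by
      simp only [stdPairing, Prod.fst_add, Prod.snd_add, add_apply, map_add]; ring)
    (fun c u v => by
      simp only [stdPairing, Prod.smul_fst, Prod.smul_snd, smul_apply, map_smul, smul_eq_mul]; ring)

lemma stdPairing_nondegenerate {x : M} {u : StdFib E 𝔤 x} (h : ∀ v, stdPairing 𝔮 x u v = 0) :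
    u = 0 := by
  have h1 : ∀ (ξ : Cotan (E := E) x), ξ u.1 = 0 := fun ξ => by
    simpa [stdPairing] using h (0, 0, ξ)
  refine Prod.ext ?_ (Prod.ext (𝔮.form_nondegenerate _ fun b => ?_)
    (ContinuousLinearMap.ext fun z => ?_))
  · have : ∀ f : StrongDual ℝ E, f u.1 = 0 := h1
    exact (SeparatingDual.eq_zero_iff_forall_dual_eq_zero (R := ℝ) (V := E) u.1).2 this
  · simpa [stdPairing] using h (0, b, 0)
  · simpa [stdPairing] using h (z, 0, 0)

/-- An atlas of charts of the vector bundle `C` over the cover `U` with transition functions given by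
the Courant data `D`. -/
structure StdAtlas (D : CourantData E 𝔮 U) (C : VB.{uE, uM, uF, w} E M F) where
  cover : ∀ x : M, ∃ i, x ∈ U i
  chart : ι → ∀ x : M, C.Fib x →ₗ[ℝ] StdFib E 𝔤 x
  bijective : ∀ i, ∀ x ∈ U i, Function.Bijective (chart i x)
  smooth_iff : ∀ i, ∀ x ∈ U i, ∀ e : ∀ y, C.Fib y,
    StdSmoothAt (fun y => chart i y (e y)) x ↔ C.SmoothAt e x
  transition : ∀ i j, ∀ x ∈ U i ⊓ U j, ∀ e, chart i x e = (D.aut i j).act x (chart j x e)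

namespace StdAtlas

variable {D : CourantData E 𝔮 U} (T : StdAtlas D C)

lemma smooth {i : ι} {x : M} (hx : x ∈ U i) (e : C.Sec) :
    StdSmoothAt (fun y => T.chart i y (e y)) x := (T.smooth_iff i x hx _).2 (e.smoothAt x)

/-- The section `b` is the bracket of `e₁` and `e₂` in all charts. -/
def IsBracketAt (e₁ e₂ : C.Sec) (x : M) (b : C.Fib x) : Prop :=
  ∀ i, x ∈ U i → IsStdBracketAt 𝔮 (fun y => T.chart i y (e₁ y)) (fun y => T.chart i y (e₂ y)) x
    (T.chart i x b)

variable {T} in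
lemma IsBracketAt.unique {e₁ e₂ : C.Sec} {x : M} {b b' : C.Fib x} (h : T.IsBracketAt e₁ e₂ x b)
    (h' : T.IsBracketAt e₁ e₂ x b') : b = b' := by
  obtain ⟨i, hi⟩ := T.cover x
  exact (T.bijective i x hi).1 ((h i hi).unique (h' i hi))

lemma exists_isBracketAt (e₁ e₂ : C.Sec) (x : M) : ∃ b, T.IsBracketAt e₁ e₂ x b := by
  obtain ⟨i, hi⟩ := T.cover x
  obtain ⟨u, hu⟩ := exists_isStdBracketAt (𝔮 := 𝔮) (T.smooth hi e₁) (T.smooth hi e₂)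
  obtain ⟨b, rfl⟩ := (T.bijective i x hi).2 u
  refine ⟨b, fun j hj => ?_⟩
  have hji : x ∈ U j ⊓ U i := ⟨hj, hi⟩
  have h := StdAut.isStdBracketAt_act (Λ := D.aut j i) hji (T.smooth hi e₁) (T.smooth hi e₂) hu
  rw [← T.transition j i x hji] at h
  have hn : ∀ e : C.Sec, ∀ᶠ y in 𝓝 x, T.chart j y (e y) = (D.aut j i).act y (T.chart i y (e y)) :=
    fun e => (eventually_mem_opens hji).mono fun y hy => T.transition j i y hy _
  exact h.congr (hn e₁) (hn e₂)

lemma exists_bracket (e₁ e₂ : C.Sec) : ∃ b : C.Sec, ∀ x, T.IsBracketAt e₁ e₂ x (b x) := by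
  choose b hb using T.exists_isBracketAt e₁ e₂
  refine ⟨⟨b, fun x => ?_⟩, hb⟩
  obtain ⟨i, hi⟩ := T.cover x
  exact (T.smooth_iff i x hi b).1 (IsStdBracketAt.smooth (T.smooth hi e₁) (T.smooth hi e₂)
    ((eventually_mem_opens hi).mono fun y hy => hb y i hy))

/-- The glued bracket. -/
def bracket : C.Sec →ₗ[ℝ] C.Sec →ₗ[ℝ] C.Sec :=
  LinearMap.mk₂ ℝ (fun e₁ e₂ => (T.exists_bracket e₁ e₂).choose)
    (fun e₁ e₂ e₃ => ContMDiffSection.ext fun x => by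
      refine IsBracketAt.unique ((T.exists_bracket _ _).choose_spec x) (fun i hi => ?_)
      simpa using IsStdBracketAt.add_left (T.smooth hi e₁) (T.smooth hi e₂) (T.smooth hi e₃)
        ((T.exists_bracket e₁ e₃).choose_spec x i hi) ((T.exists_bracket e₂ e₃).choose_spec x i hi))
    (fun c e₁ e₂ => ContMDiffSection.ext fun x => by
      refine IsBracketAt.unique ((T.exists_bracket _ _).choose_spec x) (fun i hi => ?_)
      simpa using IsStdBracketAt.smul_left c (T.smooth hi e₁) (T.smooth hi e₂)
        ((T.exists_bracket e₁ e₂).choose_spec x i hi))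
    (fun e₁ e₂ e₃ => ContMDiffSection.ext fun x => by
      refine IsBracketAt.unique ((T.exists_bracket _ _).choose_spec x) (fun i hi => ?_)
      simpa using IsStdBracketAt.add_right (T.smooth hi e₂) (T.smooth hi e₃) (T.smooth hi e₁)
        ((T.exists_bracket e₁ e₂).choose_spec x i hi) ((T.exists_bracket e₁ e₃).choose_spec x i hi))
    (fun c e₁ e₂ => ContMDiffSection.ext fun x => by
      refine IsBracketAt.unique ((T.exists_bracket _ _).choose_spec x) (fun i hi => ?_)
      simpa using IsStdBracketAt.smul_right c (T.smooth hi e₂) (T.smooth hi e₁)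
        ((T.exists_bracket e₁ e₂).choose_spec x i hi))

lemma isBracketAt_bracket (e₁ e₂ : C.Sec) (x : M) : T.IsBracketAt e₁ e₂ x (T.bracket e₁ e₂ x) :=
  (T.exists_bracket e₁ e₂).choose_spec x

/-- A chart around each point. -/
def idx (x : M) : ι := (T.cover x).choose

lemma mem_idx (x : M) : x ∈ U (T.idx x) := (T.cover x).choose_spec

/-- The glued anchor. -/
def anchor (x : M) : C.Fib x →ₗ[ℝ] Tan (E := E) x :=
  LinearMap.fst ℝ _ _ ∘ₗ T.chart (T.idx x) x

lemma anchor_eq {i : ι} {x : M} (hx : x ∈ U i) (e : C.Fib x) : T.anchor x e = (T.chart i x e).1 := by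
  change (T.chart (T.idx x) x e).1 = _
  rw [T.transition (T.idx x) i x ⟨T.mem_idx x, hx⟩]
  rfl

/-- The glued pairing. -/
def pairing (x : M) : C.Fib x →ₗ[ℝ] C.Fib x →ₗ[ℝ] ℝ :=
  (stdPairingₗ 𝔮 x).compl₁₂ (T.chart (T.idx x) x) (T.chart (T.idx x) x)

lemma pairing_eq {i : ι} {x : M} (hx : x ∈ U i) (u v : C.Fib x) :
    T.pairing x u v = stdPairing 𝔮 x (T.chart i x u) (T.chart i x v) := by
  change stdPairing 𝔮 x (T.chart (T.idx x) x u) (T.chart (T.idx x) x v) = _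
  rw [T.transition (T.idx x) i x ⟨T.mem_idx x, hx⟩ u, T.transition (T.idx x) i x ⟨T.mem_idx x, hx⟩ v,
    (D.aut (T.idx x) i).act_pairing ⟨T.mem_idx x, hx⟩]

lemma dd_pairing {i : ι} {x : M} (hx : x ∈ U i) (e₁ e₂ : C.Sec) (v : Tan (E := E) x) :
    dd (fun y => T.pairing y (e₁ y) (e₂ y)) x v =
      dd (fun y => stdPairing 𝔮 y (T.chart i y (e₁ y)) (T.chart i y (e₂ y))) x v :=
  dd_congr ((eventually_mem_opens hx).mono fun _ hy => T.pairing_eq hy _ _) v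

lemma anchor_pairing (e₁ e₂ e₃ : C.Sec) (x : M) :
    dd (fun y => T.pairing y (e₂ y) (e₃ y)) x (T.anchor x (e₁ x)) =
      T.pairing x (T.bracket e₁ e₂ x) (e₃ x) + T.pairing x (e₂ x) (T.bracket e₁ e₃ x) := by
  have hx := T.mem_idx x
  have h := IsStdBracketAt.anchor_pairing (T.smooth hx e₂) (T.smooth hx e₃)
    (T.isBracketAt_bracket e₁ e₂ x _ hx) (T.isBracketAt_bracket e₁ e₃ x _ hx)
  rw [T.dd_pairing hx e₂ e₃, T.pairing_eq hx, T.pairing_eq hx, T.anchor_eq hx]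
  exact h

/-- The Courant algebroid glued from an atlas. -/
def courantAlgebroid : CourantAlgebroid C where
  anchor := T.anchor
  pairing := T.pairing
  bracket := T.bracket
  anchor_smooth e x := by
    refine (T.smooth (T.mem_idx x) e).1.congr ?_
    exact (eventually_mem_opens (T.mem_idx x)).mono fun y hy => T.anchor_eq hy _
  pairing_smooth e₁ e₂ x := by
    refine (stdPairing_smooth (𝔮 := 𝔮) (T.smooth (T.mem_idx x) e₁)
      (T.smooth (T.mem_idx x) e₂)).congr ?_
    exact (eventually_mem_opens (T.mem_idx x)).mono fun y hy => T.pairing_eq hy _ _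
  pairing_symm x u v := by
    rw [T.pairing_eq (T.mem_idx x), T.pairing_eq (T.mem_idx x), stdPairing_symm]
  pairing_nondegenerate x u h := by
    refine (T.bijective _ x (T.mem_idx x)).1 ?_
    rw [map_zero]
    refine stdPairing_nondegenerate (𝔮 := 𝔮) fun v => ?_
    obtain ⟨v, rfl⟩ := (T.bijective _ x (T.mem_idx x)).2 v
    rw [← T.pairing_eq (T.mem_idx x), h]
  leibniz e₁ e₂ e₃ := ContMDiffSection.ext fun x => by
    have hx := T.mem_idx x
    refine (T.bijective _ x hx).1 ?_
    rw [ContMDiffSection.coe_add, Pi.add_apply, map_add]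
    have hs : ∀ e : C.Sec, ∀ y ∈ U (T.idx x), StdSmoothAt (fun y => T.chart (T.idx x) y (e y)) y :=
      fun e y hy => T.smooth hy e
    have hb := fun (e₁ e₂ : C.Sec) (y : M) (hy : y ∈ U (T.idx x)) =>
      T.isBracketAt_bracket e₁ e₂ y (T.idx x) hy
    exact IsStdBracketAt.leibniz hx (hs e₁) (hs e₂) (hs e₃) (hs (T.bracket e₁ e₂))
      (hs (T.bracket e₁ e₃)) (hs (T.bracket e₂ e₃)) (hb _ _) (hb _ _) (hb _ _)
      (hb _ _ x hx) (hb _ _ x hx) (hb _ _ x hx)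
  pairing_bracket_self e₁ e₂ x := by
    have hx := T.mem_idx x
    rw [T.pairing_eq hx, T.dd_pairing hx e₁ e₁, T.anchor_eq hx]
    exact IsStdBracketAt.pairing_self (e₁ := fun y => T.chart _ y (e₁ y)) (T.smooth hx e₁) (T.smooth hx e₂)
      (T.isBracketAt_bracket e₁ e₁ x _ hx)
  anchor_pairing := T.anchor_pairing

end StdAtlas

end Gluing

section Sections

set_option linter.unusedSectionVars false

open Filter Topology

variable {E : Type uE} [NormedAddCommGroup E] [NormedSpace ℝ E]
  {M : Type uM} [TopologicalSpace M] [ChartedSpace E M] [IsManifold 𝓘(ℝ, E) ∞ M]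
  {F₁ : Type*} [NormedAddCommGroup F₁] [NormedSpace ℝ F₁]
  {F₂ : Type*} [NormedAddCommGroup F₂] [NormedSpace ℝ F₂]
  {V₁ : M → Type*} [TopologicalSpace (TotalSpace F₁ V₁)]
  [∀ x, AddCommGroup (V₁ x)] [∀ x, Module ℝ (V₁ x)] [∀ x : M, TopologicalSpace (V₁ x)]
  [FiberBundle F₁ V₁] [VectorBundle ℝ F₁ V₁] [ContMDiffVectorBundle ∞ F₁ V₁ 𝓘(ℝ, E)]
  {V₂ : M → Type*} [TopologicalSpace (TotalSpace F₂ V₂)]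
  [∀ x, AddCommGroup (V₂ x)] [∀ x, Module ℝ (V₂ x)] [∀ x : M, TopologicalSpace (V₂ x)]
  [FiberBundle F₂ V₂] [VectorBundle ℝ F₂ V₂] [ContMDiffVectorBundle ∞ F₂ V₂ 𝓘(ℝ, E)] {x : M}

/-! ### Smooth sections of sums and of bundles of linear maps -/

lemma contMDiffAt_section_prod {e : ∀ y, (V₁ ×ᵇ V₂) y} :
    ContMDiffAt 𝓘(ℝ, E) (𝓘(ℝ, E).prod 𝓘(ℝ, F₁ × F₂)) ∞
        (fun y => TotalSpace.mk' (F₁ × F₂) (E := V₁ ×ᵇ V₂) y (e y)) x ↔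
      ContMDiffAt 𝓘(ℝ, E) (𝓘(ℝ, E).prod 𝓘(ℝ, F₁)) ∞ (fun y => TotalSpace.mk' F₁ y (e y).1) x ∧
      ContMDiffAt 𝓘(ℝ, E) (𝓘(ℝ, E).prod 𝓘(ℝ, F₂)) ∞ (fun y => TotalSpace.mk' F₂ y (e y).2) x := by
  rw [contMDiffAt_section, contMDiffAt_section, contMDiffAt_section]
  exact contMDiffAt_prod_module_iff _

lemma fnSmoothAt_clm_of_apply [FiniteDimensional ℝ F₁] {L : M → F₁ →L[ℝ] F₂}
    (h : ∀ v, FnSmoothAt (E := E) (fun y => L y v) x) : FnSmoothAt (E := E) L x := by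
  let b := Module.finBasis ℝ F₁
  have key : FnSmoothAt (E := E) (fun y => ∑ k,
      ContinuousLinearMap.smulRightL ℝ F₁ F₂ (LinearMap.toContinuousLinearMap (b.coord k))
        (L y (b k))) x :=
    FnSmoothAt.fsum fun k _ => FnSmoothAt.clm _ (h (b k))
  refine key.congr (Eventually.of_forall fun y => ContinuousLinearMap.ext fun v => ?_)
  calc L y v = L y (∑ k, b.repr v k • b k) := by rw [b.sum_repr]
    _ = ∑ k, b.repr v k • L y (b k) := by simp only [map_sum, map_smul]
    _ = _ := by simp

lemma contMDiffAt_section_hom [FiniteDimensional ℝ F₁] [∀ x, IsTopologicalAddGroup (V₂ x)]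
    [∀ x, ContinuousSMul ℝ (V₂ x)] {e : ∀ y, V₁ y →L[ℝ] V₂ y}
    (h : ∀ s : ∀ y, V₁ y, (∀ᶠ y in 𝓝 x, ContMDiffAt 𝓘(ℝ, E) (𝓘(ℝ, E).prod 𝓘(ℝ, F₁)) ∞
        (fun y => TotalSpace.mk' F₁ y (s y)) y) →
      ContMDiffAt 𝓘(ℝ, E) (𝓘(ℝ, E).prod 𝓘(ℝ, F₂)) ∞ (fun y => TotalSpace.mk' F₂ y (e y (s y))) x) :
    ContMDiffAt 𝓘(ℝ, E) (𝓘(ℝ, E).prod 𝓘(ℝ, F₁ →L[ℝ] F₂)) ∞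
      (fun y => TotalSpace.mk' (F₁ →L[ℝ] F₂) (E := fun y => V₁ y →L[ℝ] V₂ y) y (e y)) x := by
  rw [contMDiffAt_hom_bundle]
  refine ⟨contMDiffAt_id, ?_⟩
  refine fnSmoothAt_clm_of_apply fun v => ?_
  let t := trivializationAt F₁ V₁ x
  let t' := trivializationAt F₂ V₂ x
  have hx : x ∈ t.baseSet := FiberBundle.mem_baseSet_trivializationAt F₁ V₁ x
  have hx' : x ∈ t'.baseSet := FiberBundle.mem_baseSet_trivializationAt F₂ V₂ x
  have hs : ∀ᶠ y in 𝓝 x, ContMDiffAt 𝓘(ℝ, E) (𝓘(ℝ, E).prod 𝓘(ℝ, F₁)) ∞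
      (fun y => TotalSpace.mk' F₁ y (t.symm y v)) y := by
    filter_upwards [t.open_baseSet.mem_nhds hx] with y hy
    rw [t.contMDiffAt_section_iff hy]
    refine (contMDiffAt_const (c := v)).congr_of_eventuallyEq ?_
    filter_upwards [t.open_baseSet.mem_nhds hy] with z hz
    simp [t.apply_mk_symm hz]
  have key := h _ hs
  rw [contMDiffAt_section] at key
  refine key.congr_of_eventuallyEq ?_
  filter_upwards [t.open_baseSet.mem_nhds hx, t'.open_baseSet.mem_nhds hx'] with y hy hy'
  rw [ContinuousLinearMap.inCoordinates_eq hy hy']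
  rfl

lemma contMDiffAt_section_trivial {f : M → F₁} :
    ContMDiffAt 𝓘(ℝ, E) (𝓘(ℝ, E).prod 𝓘(ℝ, F₁)) ∞
      (fun y => TotalSpace.mk' F₁ (E := Bundle.Trivial M F₁) y (f y)) x ↔ FnSmoothAt (E := E) f x := by
  rw [contMDiffAt_section]
  rfl

/-- A section of `TM ⊕ 𝒢 ⊕ T*M` is smooth if its components are. -/
lemma splitBundle_smoothAt_iff [FiniteDimensional ℝ E] {𝔤 : Type uG} [NormedAddCommGroup 𝔤]
    [NormedSpace ℝ 𝔤] {𝒢 : VB.{uE, uM, uG, w} E M 𝔤} {e : ∀ y, (splitBundle 𝒢).Fib y} :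
    (splitBundle 𝒢).SmoothAt e x ↔ VFSmoothAt (fun y => (e y).1) x ∧
      𝒢.SmoothAt (fun y => (e y).2.1) x ∧ ∀ Z : ∀ y : M, Tan (E := E) y, VFSmoothAt Z x →
        FnSmoothAt (E := E) (fun y => (e y).2.2 (Z y)) x := by
  refine contMDiffAt_section_prod.trans (and_congr_right' (contMDiffAt_section_prod.trans
    (and_congr_right' ⟨fun h Z hZ => ?_, fun h => ?_⟩)))
  · exact contMDiffAt_section_trivial.1 (ContMDiffAt.clm_bundle_apply h hZ)
  · exact contMDiffAt_section_hom (V₂ := Bundle.Trivial M ℝ)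
      fun s hs => contMDiffAt_section_trivial.2 (h s hs.self_of_nhds)

end Sections

section AdjointBundle

set_option linter.unusedSectionVars false

open Filter Topology

variable {E : Type uE} [NormedAddCommGroup E] [NormedSpace ℝ E] [FiniteDimensional ℝ E]
  [CompleteSpace E]
  {M : Type uM} [TopologicalSpace M] [ChartedSpace E M] [IsManifold 𝓘(ℝ, E) ∞ M]
  {𝔤 : Type uG} [NormedAddCommGroup 𝔤] [NormedSpace ℝ 𝔤] {𝔮 : QuadraticLieAlgebra 𝔤}
  {ι : Type uI} {U : ι → Opens M} {x : M}

/-! ### The bundle of quadratic Lie algebras of Courant data -/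

namespace CourantData

variable (D : CourantData E 𝔮 U)

lemma τ_comp {i j k : ι} (hx : x ∈ U i ⊓ U j ⊓ U k) (a : 𝔤) :
    (D.aut i j).τ x ((D.aut j k).τ x a) = (D.aut i k).τ x a := by
  have := congrArg (fun e => e.2.1) (D.cocycle i j k x hx (0, a, 0))
  simpa [StdAut.act] using this

lemma τ_self {i : ι} (hx : x ∈ U i) (a : 𝔤) : (D.aut i i).τ x a = a :=
  ((D.aut i i).τ_bijective x ⟨hx, hx⟩).1 (D.τ_comp ⟨⟨hx, hx⟩, hx⟩ a)

variable (hU : ∀ x : M, ∃ i, x ∈ U i)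

/-- The cocycle `τ_ij` as a vector bundle core. -/
def core : VectorBundleCore ℝ M 𝔤 ι where
  baseSet i := U i
  isOpen_baseSet i := (U i).isOpen
  indexAt x := (hU x).choose
  mem_baseSet_at x := (hU x).choose_spec
  coordChange i j x := (D.aut j i).τ x
  coordChange_self _ _ hx v := D.τ_self hx v
  continuousOn_coordChange i j _ hx :=
    ((D.aut j i).τ_smooth _ ⟨hx.2, hx.1⟩).continuousAt.continuousWithinAt
  coordChange_comp _ _ _ _ hx v := D.τ_comp ⟨⟨hx.2, hx.1.2⟩, hx.1.1⟩ v

instance isContMDiff_core : (D.core hU).IsContMDiff 𝓘(ℝ, E) ∞ where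
  contMDiffOn_coordChange i j _ hx := ((D.aut j i).τ_smooth _ ⟨hx.2, hx.1⟩).contMDiffWithinAt

/-- The bundle of quadratic Lie algebras glued by the `τ_ij`. -/
def adBundle : VB.{uE, uM, uG, uG} E M 𝔤 where
  Fib := (D.core hU).Fiber

/-- The trivialisations of the bundle of quadratic Lie algebras. -/
def gchart (i : ι) (x : M) : (D.adBundle hU).Fib x →ₗ[ℝ] 𝔤 :=
  ((D.core hU).coordChange ((D.core hU).indexAt x) i x : 𝔤 →ₗ[ℝ] 𝔤)

lemma gchart_bijective {i : ι} (hx : x ∈ U i) : Function.Bijective (D.gchart hU i x) :=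
  (D.aut i (hU x).choose).τ_bijective x ⟨hx, (hU x).choose_spec⟩

lemma gchart_transition {i j : ι} (hx : x ∈ U i ⊓ U j) (a : (D.adBundle hU).Fib x) :
    D.gchart hU i x a = (D.aut i j).τ x (D.gchart hU j x a) :=
  (D.τ_comp ⟨hx, (hU x).choose_spec⟩ a).symm

lemma gchart_smooth_iff {i : ι} (hx : x ∈ U i) (a : ∀ y, (D.adBundle hU).Fib y) :
    FnSmoothAt (E := E) (fun y => D.gchart hU i y (a y)) x ↔ (D.adBundle hU).SmoothAt a x := by
  have : MemTrivializationAtlas ((D.core hU).localTriv i) := ⟨i, rfl⟩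
  exact (((D.core hU).localTriv i).contMDiffAt_section_iff (n := ∞) (IB := 𝓘(ℝ, E))
    (E := (D.core hU).Fiber) (s := a) (x₀ := x) hx).symm

end CourantData

end AdjointBundle

section Twist

set_option linter.unusedSectionVars false

open Filter Topology

/-! ### Alternating maps in two and three variables -/

section Alternating

variable {V W : Type*} [AddCommGroup V] [Module ℝ V] [AddCommGroup W] [Module ℝ W]

lemma alt_two_swap (B : V [⋀^Fin 2]→ₗ[ℝ] W) (u v : V) : B ![u, v] = - B ![v, u] := by
  have h := B.map_swap ![v, u] (i := 0) (j := 1) (by decide)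
  rw [← h]
  congr 1
  ext k
  fin_cases k <;> simp

lemma alt_two_add_left (B : V [⋀^Fin 2]→ₗ[ℝ] W) (u u' v : V) :
    B ![u + u', v] = B ![u, v] + B ![u', v] :=
  B.toMultilinearMap.cons_add ![v] u u'

lemma alt_two_smul_left (B : V [⋀^Fin 2]→ₗ[ℝ] W) (c : ℝ) (u v : V) :
    B ![c • u, v] = c • B ![u, v] :=
  B.toMultilinearMap.cons_smul ![v] c u

lemma alt_two_add_right (B : V [⋀^Fin 2]→ₗ[ℝ] W) (u v v' : V) :
    B ![u, v + v'] = B ![u, v] + B ![u, v'] := by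
  rw [alt_two_swap, alt_two_add_left, alt_two_swap B u v, alt_two_swap B u v', neg_add]

lemma alt_two_smul_right (B : V [⋀^Fin 2]→ₗ[ℝ] W) (c : ℝ) (u v : V) :
    B ![u, c • v] = c • B ![u, v] := by
  rw [alt_two_swap, alt_two_smul_left, alt_two_swap B u v, smul_neg]

/-- A 2-form as a bilinear map. -/
def altTwoBilin (B : V [⋀^Fin 2]→ₗ[ℝ] W) : V →ₗ[ℝ] V →ₗ[ℝ] W :=
  LinearMap.mk₂ ℝ (fun u v => B ![u, v]) (alt_two_add_left B) (alt_two_smul_left B)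
    (alt_two_add_right B) (alt_two_smul_right B)

lemma altTwoBilin_apply (B : V [⋀^Fin 2]→ₗ[ℝ] W) (u v : V) : altTwoBilin B u v = B ![u, v] := rfl

/-- The 2-form given by an alternating bilinear map. -/
def altTwo (f : V →ₗ[ℝ] V →ₗ[ℝ] W) (hf : ∀ u, f u u = 0) : V [⋀^Fin 2]→ₗ[ℝ] W where
  toFun m := f (m 0) (m 1)
  map_update_add' m i x y := by
    fin_cases i <;> simp
  map_update_smul' m i c x := by
    fin_cases i <;> simp
  map_eq_zero_of_eq' m i j h hij := by
    fin_cases i <;> fin_cases j <;> simp_all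

lemma altTwo_apply (f : V →ₗ[ℝ] V →ₗ[ℝ] W) (hf : ∀ u, f u u = 0) (u v : V) :
    altTwo f hf ![u, v] = f u v := rfl

/-- The 3-form given by an alternating trilinear map. -/
def altThree (f : V →ₗ[ℝ] V →ₗ[ℝ] V →ₗ[ℝ] W) (h₁ : ∀ u v, f u u v = 0) (h₂ : ∀ u v, f u v v = 0)
    (h₃ : ∀ u v, f u v u = 0) : V [⋀^Fin 3]→ₗ[ℝ] W where
  toFun m := f (m 0) (m 1) (m 2)
  map_update_add' {inst} m i x y := by
    obtain rfl : inst = instDecidableEqFin 3 := Subsingleton.elim _ _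
    obtain rfl | rfl | rfl : i = 0 ∨ i = 1 ∨ i = 2 := by omega
    all_goals simp [Function.update]
  map_update_smul' {inst} m i c x := by
    obtain rfl : inst = instDecidableEqFin 3 := Subsingleton.elim _ _
    obtain rfl | rfl | rfl : i = 0 ∨ i = 1 ∨ i = 2 := by omega
    all_goals simp [Function.update]
  map_eq_zero_of_eq' m i j h hij := by
    obtain rfl | rfl | rfl : i = 0 ∨ i = 1 ∨ i = 2 := by omega
    all_goals obtain rfl | rfl | rfl : j = 0 ∨ j = 1 ∨ j = 2 := by omega
    all_goals first | exact absurd rfl hij | simp [h, h₁, h₂, h₃]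

lemma altThree_apply (f : V →ₗ[ℝ] V →ₗ[ℝ] V →ₗ[ℝ] W) (h₁ : ∀ u v, f u u v = 0)
    (h₂ : ∀ u v, f u v v = 0) (h₃ : ∀ u v, f u v u = 0) (u v w : V) :
    altThree f h₁ h₂ h₃ ![u, v, w] = f u v w := rfl

end Alternating

variable {E : Type uE} [NormedAddCommGroup E] [NormedSpace ℝ E] [FiniteDimensional ℝ E]
  [CompleteSpace E]
  {M : Type uM} [TopologicalSpace M] [ChartedSpace E M] [IsManifold 𝓘(ℝ, E) ∞ M]
  {𝔤 : Type uG} [NormedAddCommGroup 𝔤] [NormedSpace ℝ 𝔤] {𝔮 : QuadraticLieAlgebra 𝔤}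
  {x : M} {W W₁ W₂ : Opens M}

/-! ### The change of splitting defined by connection data -/

namespace ConnData

variable (P : ConnData E 𝔤 W)

variable (𝔮) in
/-- The 1-form part of the change of splitting. -/
def twistCot (x : M) (e : StdFib E 𝔤 x) : Cotan (E := E) x :=
  e.2.2 - (𝔮.form (P.θ x e.1)).comp (P.θ x) - (2 : ℝ) • (𝔮.form e.2.1).comp (P.θ x)
    - LinearMap.toContinuousLinearMap (altTwoBilin (P.B x) e.1)

lemma twistCot_apply (x : M) (e : StdFib E 𝔤 x) (z : Tan (E := E) x) :
    P.twistCot 𝔮 x e z = e.2.2 z - 𝔮.form (P.θ x e.1) (P.θ x z) - 2 * 𝔮.form e.2.1 (P.θ x z)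
      - P.B x ![e.1, z] := by
  simp [twistCot, altTwoBilin_apply]

variable (𝔮) in
/-- The change of splitting
`X + a + ξ ↦ X + (θ(X) + a) + (ξ - (θ, θ(X)) - i_X B - 2 (θ, a))`. -/
def twist (x : M) : StdFib E 𝔤 x →ₗ[ℝ] StdFib E 𝔤 x where
  toFun e := (e.1, P.θ x e.1 + e.2.1, P.twistCot 𝔮 x e)
  map_add' u v := by
    refine Prod.ext rfl (Prod.ext ?_ (ContinuousLinearMap.ext fun z => ?_))
    · simp only [Prod.fst_add, Prod.snd_add, map_add]
      abel
    · simp only [twistCot_apply, Prod.fst_add, Prod.snd_add, map_add, add_apply,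
        alt_two_add_left]
      ring
  map_smul' c u := by
    refine Prod.ext rfl (Prod.ext ?_ (ContinuousLinearMap.ext fun z => ?_))
    · simp only [Prod.smul_fst, Prod.smul_snd, map_smul, RingHom.id_apply]
      module
    · simp only [twistCot_apply, Prod.smul_fst, Prod.smul_snd, map_smul, smul_apply,
        RingHom.id_apply, smul_eq_mul, alt_two_smul_left]
      ring

lemma twist_fst (x : M) (e : StdFib E 𝔤 x) : (P.twist 𝔮 x e).1 = e.1 := rfl

lemma twist_adj (x : M) (e : StdFib E 𝔤 x) : (P.twist 𝔮 x e).2.1 = P.θ x e.1 + e.2.1 := rfl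

lemma twist_cot (x : M) (e : StdFib E 𝔤 x) (z : Tan (E := E) x) :
    (P.twist 𝔮 x e).2.2 z = e.2.2 z - 𝔮.form (P.θ x e.1) (P.θ x z) - 2 * 𝔮.form e.2.1 (P.θ x z)
      - P.B x ![e.1, z] := P.twistCot_apply x e z

lemma twist_bijective (x : M) : Function.Bijective (P.twist 𝔮 x) := by
  refine ⟨fun u v h => ?_, fun v => ?_⟩
  · have h1 : u.1 = v.1 := congrArg (fun e => e.1) h
    have h2 : u.2.1 = v.2.1 := by
      have := congrArg (fun e => e.2.1) h
      simpa only [twist_adj, h1, add_right_inj] using this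
    refine Prod.ext h1 (Prod.ext h2 (ContinuousLinearMap.ext fun z => ?_))
    have := congrArg (fun e => e.2.2 z) h
    simpa only [twist_cot, h1, h2, sub_left_inj] using this
  · refine ⟨(v.1, v.2.1 - P.θ x v.1,
      v.2.2 - P.twistCot 𝔮 x (v.1, v.2.1 - P.θ x v.1, 0)), ?_⟩
    refine Prod.ext rfl (Prod.ext ?_ (ContinuousLinearMap.ext fun z => ?_))
    · simp [twist_adj]
    · simp [twist_cot, twistCot_apply]
      ring

variable {P}

lemma stdSmoothAt_twist_iff (hx : x ∈ W) {e : ∀ y : M, StdFib E 𝔤 y} :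
    StdSmoothAt (fun y => P.twist 𝔮 y (e y)) x ↔ StdSmoothAt e x := by
  have hθ := P.θ_smooth x hx
  have hc : ∀ {X : ∀ y : M, Tan (E := E) y} {a : M → 𝔤}, VFSmoothAt X x → FnSmoothAt (E := E) a x →
      ∀ Z : ∀ y : M, Tan (E := E) y, VFSmoothAt Z x → FnSmoothAt (E := E)
        (fun y => 𝔮.form (P.θ y (X y)) (P.θ y (Z y)) + 2 * 𝔮.form (a y) (P.θ y (Z y))
          + P.B y ![X y, Z y]) x := fun hX ha Z hZ =>
    ((FnSmoothAt.bilin 𝔮.form (hθ _ hX) (hθ _ hZ)).fadd (FnSmoothAt.fmul (fnSmoothAt_const 2)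
      (FnSmoothAt.bilin 𝔮.form ha (hθ _ hZ)))).fadd (P.B_smooth x hx _ _ hX hZ)
  constructor
  · intro h
    have h1 : VFSmoothAt (fun y => (e y).1) x := h.1
    have h2 : FnSmoothAt (E := E) (fun y => (e y).2.1) x :=
      FnSmoothAt.congr (FnSmoothAt.fsub h.2.1 (hθ _ h1))
        (Eventually.of_forall fun y => by simp [twist_adj])
    refine ⟨h1, h2, fun Z hZ => ?_⟩
    refine FnSmoothAt.congr ((h.2.2 Z hZ).fadd (hc h1 h2 Z hZ)) (Eventually.of_forall fun y => ?_)
    simp only [twist_cot]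
    ring
  · intro h
    refine ⟨h.1, (hθ _ h.1).fadd h.2.1, fun Z hZ => ?_⟩
    refine FnSmoothAt.congr ((h.2.2 Z hZ).fsub (hc h.1 h.2.1 Z hZ))
      (Eventually.of_forall fun y => ?_)
    simp only [twist_cot]
    ring

lemma stdPairing_twist (x : M) (u v : StdFib E 𝔤 x) :
    stdPairing 𝔮 x (P.twist 𝔮 x u) (P.twist 𝔮 x v) = stdPairing 𝔮 x u v := by
  have h1 := alt_two_swap (P.B x) u.1 v.1
  have h2 := 𝔮.form_symm (P.θ x v.1) (P.θ x u.1)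
  have h3 := 𝔮.form_symm (P.θ x u.1) v.2.1
  simp only [stdPairing, twist_cot, twist_fst, twist_adj, map_add, add_apply]
  linear_combination (-1 / 2 : ℝ) * h1 - (1 / 2 : ℝ) * h2 + h3

end ConnData

/-- A 1-morphism intertwines the changes of splitting. -/
lemma StdAut.IsMor.act_twist {Λ : StdAut E 𝔮 W} {P' : ConnData E 𝔤 W₁} {P : ConnData E 𝔤 W₂}
    (h : Λ.IsMor P' P) (hx : x ∈ W) (e : StdFib E 𝔤 x) :
    Λ.act x (P'.twist 𝔮 x e) = P.twist 𝔮 x (e.1, Λ.τ x e.2.1, e.2.2) := by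
  refine Prod.ext rfl (Prod.ext ?_ (ContinuousLinearMap.ext fun z => ?_))
  · rw [StdAut.act_adj, ConnData.twist_adj, ConnData.twist_adj, h.θ_eq x hx, map_add]
    rw [ConnData.twist_fst]
    change _ = (Λ.τ x (P'.θ x e.1) + Λ.φ x e.1) + Λ.τ x e.2.1
    abel
  · have hB := h.B_eq x hx e.1 z
    have h1 := Λ.τ_form x hx e.2.1 (P'.θ x z)
    have h2 := 𝔮.form_symm (P'.θ x z) (P'.θ x e.1)
    have h3 := 𝔮.form_symm (P.θ x z) (P.θ x e.1)
    have h4 := congrArg (𝔮.form (Λ.τ x e.2.1)) (h.θ_eq x hx z)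
    simp only [StdAut.act_cot, ConnData.twist_cot, ConnData.twist_fst, ConnData.twist_adj,
      map_add, add_apply] at h4 ⊢
    linear_combination -hB + 2 * h1 + h2 - h3 + 2 * h4

end Twist

section GluedAlgebroid

set_option linter.unusedSectionVars false

open Filter Topology

variable {E : Type uE} [NormedAddCommGroup E] [NormedSpace ℝ E] [FiniteDimensional ℝ E]
  [CompleteSpace E]
  {M : Type uM} [TopologicalSpace M] [ChartedSpace E M] [IsManifold 𝓘(ℝ, E) ∞ M]
  {𝔤 : Type uG} [NormedAddCommGroup 𝔤] [NormedSpace ℝ 𝔤] {𝔮 : QuadraticLieAlgebra 𝔤}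
  {ι : Type uI} {U : ι → Opens M} {x : M}

/-! ### The glued transitive Courant algebroid -/

lemma dd_zero_right {F : Type*} [NormedAddCommGroup F] [NormedSpace ℝ F] (f : M → F) (x : M) :
    dd f x (0 : Tan (E := E) x) = 0 := map_zero _

variable (𝔮) in
/-- The bracket as a bilinear map. -/
def QuadraticLieAlgebra.bracketₗ : 𝔤 →ₗ[ℝ] 𝔤 →ₗ[ℝ] 𝔤 :=
  LinearMap.mk₂ ℝ (fun a b => 𝔮.bracket a b) (fun a b c => by simp) (fun a b c => by simp)
    (fun a b c => by simp) (fun a b c => by simp)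

variable (𝔮) in
/-- The metric as a bilinear map. -/
def QuadraticLieAlgebra.formₗ : 𝔤 →ₗ[ℝ] 𝔤 →ₗ[ℝ] ℝ :=
  LinearMap.mk₂ ℝ (fun a b => 𝔮.form a b) (fun a b c => by simp) (fun a b c => by simp)
    (fun a b c => by simp) (fun a b c => by simp)

/-- The map on the fibres of `TM ⊕ 𝒢 ⊕ T*M` induced by a linear map on the fibre of `𝒢`. -/
def splitMap {𝒢 : VB.{uE, uM, uG, w} E M 𝔤} {x : M} (g : 𝒢.Fib x →ₗ[ℝ] 𝔤) :
    (splitBundle 𝒢).Fib x →ₗ[ℝ] StdFib E 𝔤 x where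
  toFun e := (e.1, g e.2.1, e.2.2)
  map_add' u v := by
    refine Prod.ext rfl (Prod.ext ?_ rfl)
    exact map_add g _ _
  map_smul' c u := by
    refine Prod.ext rfl (Prod.ext ?_ rfl)
    exact map_smul g _ _

lemma splitMap_apply {𝒢 : VB.{uE, uM, uG, w} E M 𝔤} {x : M} (g : 𝒢.Fib x →ₗ[ℝ] 𝔤)
    (e : (splitBundle 𝒢).Fib x) : splitMap g e = (e.1, g e.2.1, e.2.2) := rfl

lemma splitMap_bijective {𝒢 : VB.{uE, uM, uG, w} E M 𝔤} {x : M} {g : 𝒢.Fib x →ₗ[ℝ] 𝔤}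
    (hg : Function.Bijective g) : Function.Bijective (splitMap g) := by
  refine ⟨fun u v h => ?_, fun v => ?_⟩
  · refine Prod.ext (congrArg (fun e => e.1) h) (Prod.ext (hg.1 (congrArg (fun e => e.2.1) h)) ?_)
    exact congrArg (fun e => e.2.2) h
  · obtain ⟨a, ha⟩ := hg.2 v.2.1
    exact ⟨(v.1, a, v.2.2), Prod.ext rfl (Prod.ext ha rfl)⟩

lemma stdSmoothAt_splitMap_iff {𝒢 : VB.{uE, uM, uG, w} E M 𝔤} {g : ∀ y, 𝒢.Fib y →ₗ[ℝ] 𝔤}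
    (hg : ∀ a : ∀ y, 𝒢.Fib y, FnSmoothAt (E := E) (fun y => g y (a y)) x ↔ 𝒢.SmoothAt a x)
    (e : ∀ y, (splitBundle 𝒢).Fib y) :
    StdSmoothAt (fun y => splitMap (g y) (e y)) x ↔ (splitBundle 𝒢).SmoothAt e x := by
  rw [splitBundle_smoothAt_iff, ← hg]
  rfl

namespace CourantData

variable (D : CourantData E 𝔮 U) (hU : ∀ x : M, ∃ i, x ∈ U i)

/-- The atlas of `TM ⊕ 𝒢 ⊕ T*M` defined by an atlas of `𝒢` and the changes of splitting. -/
def splitAtlas {𝒢 : VB.{uE, uM, uG, w} E M 𝔤} (g : ι → ∀ x : M, 𝒢.Fib x →ₗ[ℝ] 𝔤)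
    (hb : ∀ i, ∀ x ∈ U i, Function.Bijective (g i x))
    (hs : ∀ i, ∀ x ∈ U i, ∀ a : ∀ y, 𝒢.Fib y,
      FnSmoothAt (E := E) (fun y => g i y (a y)) x ↔ 𝒢.SmoothAt a x)
    (ht : ∀ i j, ∀ x ∈ U i ⊓ U j, ∀ a, g i x a = (D.aut i j).τ x (g j x a)) :
    StdAtlas D (splitBundle 𝒢) where
  cover := hU
  chart i x := (D.obj i).twist 𝔮 x ∘ₗ splitMap (g i x)
  bijective i x hx := ((D.obj i).twist_bijective x).comp (splitMap_bijective (hb i x hx))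
  smooth_iff i x hx e := (ConnData.stdSmoothAt_twist_iff (P := D.obj i) hx).trans
    (stdSmoothAt_splitMap_iff (hs i x hx) e)
  transition i j x hx e := by
    rw [LinearMap.comp_apply, LinearMap.comp_apply, (D.isMor i j).act_twist hx, splitMap_apply,
      ht i j x hx]
    rfl

/-- The atlas of the glued Courant algebroid. -/
def atlas : StdAtlas D (splitBundle (D.adBundle hU)) :=
  D.splitAtlas hU (D.gchart hU) (fun _ _ hx => D.gchart_bijective hU hx)
    (fun _ _ hx => D.gchart_smooth_iff hU hx) (fun _ _ _ hx => D.gchart_transition hU hx)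

lemma atlas_chart (i : ι) (x : M) (e : (splitBundle (D.adBundle hU)).Fib x) :
    (D.atlas hU).chart i x e = (D.obj i).twist 𝔮 x (e.1, D.gchart hU i x e.2.1, e.2.2) := rfl

lemma atlas_chart_adj {i : ι} {x : M} {e : (splitBundle (D.adBundle hU)).Fib x} (he : e.1 = 0) :
    ((D.atlas hU).chart i x e).2.1 = D.gchart hU i x e.2.1 := by
  rw [atlas_chart, ConnData.twist_adj, he, map_zero, zero_add]

/-- The glued Courant algebroid. -/
def algebroid : CourantAlgebroid (splitBundle (D.adBundle hU)) := (D.atlas hU).courantAlgebroid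

lemma algebroid_pairing {i : ι} (hx : x ∈ U i) (u v : (splitBundle (D.adBundle hU)).Fib x) :
    (D.algebroid hU).pairing x u v =
      stdPairing 𝔮 x (u.1, D.gchart hU i x u.2.1, u.2.2) (v.1, D.gchart hU i x v.2.1, v.2.2) := by
  refine ((D.atlas hU).pairing_eq hx u v).trans ?_
  rw [atlas_chart, atlas_chart, ConnData.stdPairing_twist]

/-- The bracket on the fibres of the bundle of quadratic Lie algebras. -/
def adBracket (x : M) :
    (D.adBundle hU).Fib x →ₗ[ℝ] (D.adBundle hU).Fib x →ₗ[ℝ] (D.adBundle hU).Fib x :=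
  𝔮.bracketₗ

lemma gchart_adBracket {i : ι} (hx : x ∈ U i) (a b : (D.adBundle hU).Fib x) :
    D.gchart hU i x (D.adBracket hU x a b) =
      𝔮.bracket (D.gchart hU i x a) (D.gchart hU i x b) :=
  (D.aut i (hU x).choose).τ_bracket x ⟨hx, (hU x).choose_spec⟩ a b

/-- The metric on the fibres of the bundle of quadratic Lie algebras. -/
def adMetric (x : M) : (D.adBundle hU).Fib x →ₗ[ℝ] (D.adBundle hU).Fib x →ₗ[ℝ] ℝ :=
  𝔮.formₗ

lemma adMetric_eq {i : ι} (hx : x ∈ U i) (a b : (D.adBundle hU).Fib x) :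
    D.adMetric hU x a b = 𝔮.form (D.gchart hU i x a) (D.gchart hU i x b) :=
  ((D.aut i (hU x).choose).τ_form x ⟨hx, (hU x).choose_spec⟩ a b).symm

lemma algebroid_pairing_ker (u v : (D.algebroid hU).Ker x) :
    (D.algebroid hU).pairing x u v = D.adMetric hU x (u : (splitBundle _).Fib x).2.1
      (v : (splitBundle _).Fib x).2.1 := by
  have hu : (u : (splitBundle (D.adBundle hU)).Fib x).1 = 0 := u.2
  have hv : (v : (splitBundle (D.adBundle hU)).Fib x).1 = 0 := v.2
  obtain ⟨i, hi⟩ := hU x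
  rw [D.algebroid_pairing hU hi, D.adMetric_eq hU hi, stdPairing, hu, hv]
  simp

/-- The middle component of the kernel of the anchor. -/
def adProj (x : M) : (D.algebroid hU).Ker x →ₗ[ℝ] (D.adBundle hU).Fib x :=
  (LinearMap.fst ℝ _ _ ∘ₗ LinearMap.snd ℝ _ _) ∘ₗ ((D.algebroid hU).Ker x).subtype

lemma adProj_apply (e : (D.algebroid hU).Ker x) :
    D.adProj hU x e = (e : (splitBundle (D.adBundle hU)).Fib x).2.1 := rfl

/-- The inclusion of the bundle of quadratic Lie algebras in the kernel of the anchor. -/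
def adIncl (x : M) : (D.adBundle hU).Fib x →ₗ[ℝ] (D.algebroid hU).Ker x :=
  LinearMap.codRestrict _ (LinearMap.inr ℝ _ _ ∘ₗ LinearMap.inl ℝ _ _) fun _ => rfl

/-- The bundle of quadratic Lie algebras as the quotient `ker ρ / (ker ρ)^⊥`. -/
def adjointBundle : (D.algebroid hU).AdjointBundle (D.adBundle hU) where
  proj := D.adProj hU
  bracket := D.adBracket hU
  metric := D.adMetric hU
  proj_smooth e x h := (splitBundle_smoothAt_iff.1 h).2.1
  proj_surjective x a := ⟨D.adIncl hU x a, rfl⟩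
  proj_eq_zero_iff x e := by
    constructor
    · intro h e'
      rw [algebroid_pairing_ker, ← adProj_apply, h, map_zero, LinearMap.zero_apply]
    · intro h
      refine 𝔮.form_nondegenerate _ fun b => ?_
      have := h (D.adIncl hU x b)
      rwa [algebroid_pairing_ker] at this
  proj_bracket e₁ e₂ h₁ h₂ x := by
    obtain ⟨i, hi⟩ := hU x
    have hbr := (D.atlas hU).isBracketAt_bracket e₁ e₂ x i hi
    have h0 : ((D.atlas hU).bracket e₁ e₂ x).1 = 0 := by
      have : (fun y => ((D.atlas hU).chart i y (e₁ y)).1) = fun y => (0 : Tan (E := E) y) :=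
        funext h₁
      refine hbr.1.trans ?_
      rw [this]
      have h2 : (fun y => ((D.atlas hU).chart i y (e₂ y)).1) = fun y => (0 : Tan (E := E) y) :=
        funext h₂
      rw [h2, lie_self]
    refine ⟨h0, (D.gchart_bijective hU hi).1 ?_⟩
    have h := hbr.2.1
    rw [show ((D.atlas hU).chart i x (e₁ x)).1 = 0 from h₁ x,
      show ((D.atlas hU).chart i x (e₂ x)).1 = 0 from h₂ x, dd_zero_right, dd_zero_right, sub_zero, zero_add,
      D.atlas_chart_adj hU h0] at h
    beta_reduce at h
    rw [D.atlas_chart_adj hU (e := e₁ x) (h₁ x), D.atlas_chart_adj hU (e := e₂ x) (h₂ x)] at h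
    exact h.trans (D.gchart_adBracket hU hi _ _).symm
  proj_metric x e₁ e₂ := (D.algebroid_pairing_ker hU e₁ e₂).symm

/-- The connection of the glued Courant algebroid. -/
def connection : CourantAlgebroid.Connection (D.adjointBundle hU) where
  s x := LinearMap.inl ℝ _ _
  σ := D.adIncl hU
  s_smooth X x hX := splitBundle_smoothAt_iff.2
    ⟨hX, contMDiffAt_zeroSection _ _, fun Z _ => fnSmoothAt_const (0 : ℝ)⟩
  σ_smooth a x ha := splitBundle_smoothAt_iff.2
    ⟨vfSmoothAt_zero, ha, fun Z _ => fnSmoothAt_const (0 : ℝ)⟩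
  anchor_s x v := rfl
  isotropic x u v := by
    obtain ⟨i, hi⟩ := hU x
    rw [D.algebroid_pairing hU hi, stdPairing]
    simp
  proj_σ x a := rfl
  orthogonal x v a := by
    obtain ⟨i, hi⟩ := hU x
    rw [D.algebroid_pairing hU hi]
    change stdPairing 𝔮 x (v, D.gchart hU i x 0, 0) (0, D.gchart hU i x a, 0) = 0
    simp [stdPairing]

/-- Courant data glue to a Courant algebroid with connection. -/
def glued : Glued D where
  C := splitBundle (D.adBundle hU)
  A := D.algebroid hU
  chart := (D.atlas hU).chart
  chart_bijective := (D.atlas hU).bijective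
  chart_smooth_iff := (D.atlas hU).smooth_iff
  chart_transition := (D.atlas hU).transition
  chart_anchor i x hx e := rfl
  chart_pairing i x hx u v := (D.atlas hU).pairing_eq hx u v
  chart_bracket i x hx e₁ e₂ := (D.atlas hU).isBracketAt_bracket e₁ e₂ x i hx
  𝒢 := D.adBundle hU
  L := D.adjointBundle hU
  gchart := D.gchart hU
  gchart_bijective i x hx := D.gchart_bijective hU hx
  gchart_smooth_iff i x hx := D.gchart_smooth_iff hU hx
  gchart_transition i j x hx := D.gchart_transition hU hx
  gchart_bracket i x hx := D.gchart_adBracket hU hx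
  gchart_metric i x hx := D.adMetric_eq hU hx
  gchart_proj i x hx e := by
    have he : (e : (splitBundle (D.adBundle hU)).Fib x).1 = 0 := e.2
    rw [atlas_chart, ConnData.twist_adj, he, map_zero, zero_add]
    rfl
  conn := D.connection hU
  chart_s i x hx v := by
    refine ⟨rfl, ?_, fun z => ?_⟩
    · rw [atlas_chart, ConnData.twist_adj]
      simp [connection]
    · rw [atlas_chart, ConnData.twist_cot, 𝔮.form_symm ((D.obj i).θ x z)]
      simp [connection]
  chart_σ i x hx a := by
    refine ⟨rfl, ?_, fun z => ?_⟩
    · change (D.obj i).θ x 0 + D.gchart hU i x a = _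
      rw [map_zero, zero_add]
    · refine ((D.obj i).twist_cot x (0, D.gchart hU i x a, 0) z).trans ?_
      have := alt_two_smul_left ((D.obj i).B x) 0 0 z
      rw [zero_smul, zero_smul] at this
      rw [this, 𝔮.form_symm ((D.obj i).θ x z)]
      simp

lemma glued_isTransitive : (D.glued hU).A.IsTransitive := fun x v =>
  ⟨(D.connection hU).s x v, (D.connection hU).anchor_s x v⟩

end CourantData

end GluedAlgebroid

section Morphisms

set_option linter.unusedSectionVars false

open Filter Topology

variable {E : Type uE} [NormedAddCommGroup E] [NormedSpace ℝ E] [FiniteDimensional ℝ E]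
  [CompleteSpace E]
  {M : Type uM} [TopologicalSpace M] [ChartedSpace E M] [IsManifold 𝓘(ℝ, E) ∞ M]
  {𝔤 : Type uG} [NormedAddCommGroup 𝔤] [NormedSpace ℝ 𝔤] {𝔮 : QuadraticLieAlgebra 𝔤}
  {ι : Type uI} {U : ι → Opens M} {x : M}

/-! ### Gluing 1-morphisms of Courant data -/

namespace Glued

variable {D : CourantData E 𝔮 U} (G : Glued D)

lemma chart_s_eq {i : ι} (hx : x ∈ U i) (v : Tan (E := E) x) :
    G.chart i x (G.conn.s x v) = (D.obj i).twist 𝔮 x (v, 0, 0) := by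
  obtain ⟨h1, h2, h3⟩ := G.chart_s i x hx v
  refine Prod.ext h1 (Prod.ext ?_ (ContinuousLinearMap.ext fun z => ?_))
  · rw [h2, ConnData.twist_adj, add_zero]
  · rw [h3, ConnData.twist_cot, 𝔮.form_symm]
    simp

lemma chart_σ_eq {i : ι} (hx : x ∈ U i) (a : G.𝒢.Fib x) :
    G.chart i x (G.conn.σ x a : G.C.Fib x) = (D.obj i).twist 𝔮 x (0, G.gchart i x a, 0) := by
  obtain ⟨h1, h2, h3⟩ := G.chart_σ i x hx a
  refine Prod.ext h1 (Prod.ext ?_ (ContinuousLinearMap.ext fun z => ?_))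
  · rw [h2, ConnData.twist_adj, map_zero, zero_add]
  · have := alt_two_smul_left ((D.obj i).B x) 0 0 z
    rw [zero_smul, zero_smul] at this
    rw [h3, ConnData.twist_cot, 𝔮.form_symm, this]
    simp

end Glued

namespace CourantData.Hom

variable {D' D : CourantData E 𝔮 U} (Λ : D'.Hom D) (G' : Glued D') (G : Glued D)

lemma chart_eq_of_chart_eq {i j : ι} (hi : x ∈ U i) (hj : x ∈ U j) {e : G'.C.Fib x} {f : G.C.Fib x}
    (h : G.chart j x f = (Λ.aut j).act x (G'.chart j x e)) :
    G.chart i x f = (Λ.aut i).act x (G'.chart i x e) := by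
  rw [G.chart_transition i j x ⟨hi, hj⟩, h, Λ.comm i j x ⟨hi, hj⟩,
    ← G'.chart_transition i j x ⟨hi, hj⟩]

variable (hU : ∀ x : M, ∃ i, x ∈ U i)

/-- The glued map on the fibres. -/
def fibMap (x : M) : G'.C.Fib x ≃ₗ[ℝ] G.C.Fib x :=
  (LinearEquiv.ofBijective _ (G'.chart_bijective _ x (hU x).choose_spec)).trans
    ((LinearEquiv.ofBijective ((Λ.aut (hU x).choose).actₗ x)
      ((Λ.aut _).act_bijective (hU x).choose_spec)).trans
    (LinearEquiv.ofBijective _ (G.chart_bijective _ x (hU x).choose_spec)).symm)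

lemma chart_fibMap {i : ι} (hi : x ∈ U i) (e : G'.C.Fib x) :
    G.chart i x (Λ.fibMap G' G hU x e) = (Λ.aut i).act x (G'.chart i x e) :=
  Λ.chart_eq_of_chart_eq G' G hi (hU x).choose_spec
    (LinearEquiv.apply_symm_apply
      (LinearEquiv.ofBijective _ (G.chart_bijective _ x (hU x).choose_spec)) _)

/-- The glued isomorphism. -/
def iso [FiniteDimensional ℝ 𝔤] : G'.A.Iso G.A where
  map := Λ.fibMap G' G hU
  smooth_iff e x := by
    obtain ⟨i, hi⟩ := hU x
    rw [← G.chart_smooth_iff i x hi, ← G'.chart_smooth_iff i x hi,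
      ← StdAut.stdSmoothAt_act_iff (Λ := Λ.aut i) hi (e := fun y => G'.chart i y (e y))]
    exact stdSmoothAt_congr ((eventually_mem_opens hi).mono fun y hy => Λ.chart_fibMap G' G hU hy _)
  map_anchor x e := by
    obtain ⟨i, hi⟩ := hU x
    rw [G.chart_anchor i x hi, G'.chart_anchor i x hi, Λ.chart_fibMap G' G hU hi, StdAut.act_fst]
  map_pairing x u v := by
    obtain ⟨i, hi⟩ := hU x
    rw [G.chart_pairing i x hi, G'.chart_pairing i x hi, Λ.chart_fibMap G' G hU hi,
      Λ.chart_fibMap G' G hU hi, StdAut.act_pairing _ hi]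
  map_bracket e₁ e₂ e₁' e₂' h₁ h₂ x := by
    obtain ⟨i, hi⟩ := hU x
    refine (G.chart_bijective i x hi).1 ?_
    rw [Λ.chart_fibMap G' G hU hi]
    have hs : ∀ e : G'.C.Sec, StdSmoothAt (fun y => G'.chart i y (e y)) x := fun e =>
      (G'.chart_smooth_iff i x hi _).2 (e.smoothAt x)
    have hn : ∀ (e : G'.C.Sec) (e' : G.C.Sec), (∀ x, e' x = Λ.fibMap G' G hU x (e x)) →
        ∀ᶠ y in 𝓝 x, G.chart i y (e' y) = (Λ.aut i).act y (G'.chart i y (e y)) := fun e e' h =>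
      (eventually_mem_opens hi).mono fun y hy => by rw [h, Λ.chart_fibMap G' G hU hy]
    exact (G.chart_bracket i x hi e₁' e₂').unique
      ((StdAut.isStdBracketAt_act hi (hs e₁) (hs e₂) (G'.chart_bracket i x hi e₁ e₂)).congr
        (hn _ _ h₁) (hn _ _ h₂))

/-- 1-morphisms of Courant data glue to isomorphisms of Courant algebroids with connections. -/
theorem exists_iso [FiniteDimensional ℝ 𝔤] (hU : ∀ x : M, ∃ i, x ∈ U i) :
    ∃ Φ : G'.A.Iso G.A,
        (∀ i, ∀ x ∈ U i, ∀ e, G.chart i x (Φ.map x e) = (Λ.aut i).act x (G'.chart i x e)) ∧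
        (∀ Φ' : G'.A.Iso G.A,
          (∀ i, ∀ x ∈ U i, ∀ e, G.chart i x (Φ'.map x e) = (Λ.aut i).act x (G'.chart i x e)) →
          Φ' = Φ) ∧
        (∀ (x : M) (v : Tan (E := E) x), Φ.map x (G'.conn.s x v) = G.conn.s x v) ∧
        (∀ (x : M) (e' : G'.A.Ker x) (e : G.A.Ker x), (e : G.C.Fib x) = Φ.map x e' →
          Φ.map x (G'.conn.σ x (G'.L.proj x e')) = G.conn.σ x (G.L.proj x e)) := by
  have hΦ : ∀ i, ∀ x ∈ U i, ∀ e,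
      G.chart i x ((Λ.iso G' G hU).map x e) = (Λ.aut i).act x (G'.chart i x e) :=
    fun i x hi e => Λ.chart_fibMap G' G hU hi e
  refine ⟨Λ.iso G' G hU, hΦ, fun Φ' h => ?_, fun x v => ?_, fun x e' e he => ?_⟩
  · refine CourantAlgebroid.Iso.ext (funext fun x => LinearEquiv.ext fun e => ?_)
    obtain ⟨i, hi⟩ := hU x
    exact (G.chart_bijective i x hi).1 ((h i x hi e).trans (hΦ i x hi e).symm)
  · obtain ⟨i, hi⟩ := hU x
    refine (G.chart_bijective i x hi).1 ?_
    rw [hΦ i x hi, G'.chart_s_eq hi, G.chart_s_eq hi, (Λ.isMor i).act_twist hi, map_zero]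
  · obtain ⟨i, hi⟩ := hU x
    refine (G.chart_bijective i x hi).1 ?_
    have h0 : (G'.chart i x (e' : G'.C.Fib x)).1 = 0 := by
      rw [← G'.chart_anchor i x hi]
      exact e'.2
    rw [hΦ i x hi, G'.chart_σ_eq hi, G.chart_σ_eq hi, (Λ.isMor i).act_twist hi, G.gchart_proj i x hi,
      G'.gchart_proj i x hi, he, hΦ i x hi, StdAut.act_adj, h0, map_zero, zero_add]

end CourantData.Hom

end Morphisms

section LocalSplitBracket

set_option linter.unusedSectionVars false

open Filter Topology

variable {E : Type uE} [NormedAddCommGroup E] [NormedSpace ℝ E] [FiniteDimensional ℝ E]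
  [CompleteSpace E]
  {M : Type uM} [TopologicalSpace M] [ChartedSpace E M] [IsManifold 𝓘(ℝ, E) ∞ M]
  {𝔤 : Type uG} [NormedAddCommGroup 𝔤] [NormedSpace ℝ 𝔤] {𝔮 : QuadraticLieAlgebra 𝔤}
  {W : Opens M} {P : ConnData E 𝔤 W} {x : M}

/-! ### The standard bracket after the change of splitting -/

namespace ConnData

lemma dd_twist_adj (hx : x ∈ W) {e : ∀ y : M, StdFib E 𝔤 y} (he : StdSmoothAt e x)
    (v : Tan (E := E) x) :
    dd (fun y => (P.twist 𝔮 y (e y)).2.1) x v =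
      dd (fun y => P.θ y (e y).1) x v + dd (fun y => (e y).2.1) x v :=
  dd_add (FnSmoothAt.mdiff (P.θ_smooth x hx _ he.1)) (FnSmoothAt.mdiff he.2.1) v

lemma dd_twist_cot (hx : x ∈ W) {e : ∀ y : M, StdFib E 𝔤 y} (he : StdSmoothAt e x)
    {Z : ∀ y : M, Tan (E := E) y} (hZ : VFSmoothAt Z x) (v : Tan (E := E) x) :
    dd (fun y => (P.twist 𝔮 y (e y)).2.2 (Z y)) x v =
      dd (fun y => (e y).2.2 (Z y)) x v
        - (𝔮.form (dd (fun y => P.θ y (e y).1) x v) (P.θ x (Z x))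
          + 𝔮.form (P.θ x (e x).1) (dd (fun y => P.θ y (Z y)) x v))
        - 2 * (𝔮.form (dd (fun y => (e y).2.1) x v) (P.θ x (Z x))
          + 𝔮.form (e x).2.1 (dd (fun y => P.θ y (Z y)) x v))
        - dd (fun y => P.B y ![(e y).1, Z y]) x v := by
  have hθ := P.θ_smooth x hx
  have h1 := he.2.2 Z hZ
  have h2 := FnSmoothAt.bilin 𝔮.form (hθ _ he.1) (hθ _ hZ)
  have h3 := FnSmoothAt.bilin 𝔮.form he.2.1 (hθ _ hZ)
  have h3' := FnSmoothAt.fmul (fnSmoothAt_const (E := E) (x := x) (2 : ℝ)) h3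
  have h4 := P.B_smooth x hx _ _ he.1 hZ
  simp only [twist_cot]
  rw [dd_sub ((h1.fsub h2).fsub h3').mdiff h4.mdiff, dd_sub (h1.fsub h2).mdiff h3'.mdiff,
    dd_sub h1.mdiff h2.mdiff, dd_const_mul _ h3.mdiff,
    dd_bilin 𝔮.form (FnSmoothAt.mdiff (hθ _ he.1)) (FnSmoothAt.mdiff (hθ _ hZ)),
    dd_bilin 𝔮.form (FnSmoothAt.mdiff he.2.1) (FnSmoothAt.mdiff (hθ _ hZ))]

variable {e₁ e₂ : ∀ y : M, StdFib E 𝔤 y} {u : StdFib E 𝔤 x}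

lemma adj_of_isStdBracketAt_twist (hx : x ∈ W) (h₁ : StdSmoothAt e₁ x) (h₂ : StdSmoothAt e₂ x)
    (h : IsStdBracketAt 𝔮 (fun y => P.twist 𝔮 y (e₁ y)) (fun y => P.twist 𝔮 y (e₂ y)) x
      (P.twist 𝔮 x u)) :
    u.2.1 = (dd (fun y => (e₂ y).2.1) x (e₁ x).1 + 𝔮.bracket (P.θ x (e₁ x).1) (e₂ x).2.1)
      - (dd (fun y => (e₁ y).2.1) x (e₂ x).1 + 𝔮.bracket (P.θ x (e₂ x).1) (e₁ x).2.1)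
      + 𝔮.bracket (e₁ x).2.1 (e₂ x).2.1
      + (dOne P.θ (fun y => (e₁ y).1) (fun y => (e₂ y).1) x
        + 𝔮.bracket (P.θ x (e₁ x).1) (P.θ x (e₂ x).1)) := by
  have h1 : u.1 = lie (fun y => (e₁ y).1) (fun y => (e₂ y).1) x := h.1
  have h2 := h.2.1
  rw [dd_twist_adj hx h₁, dd_twist_adj hx h₂] at h2
  simp only [twist_adj, twist_fst, h1, map_add, add_apply] at h2
  have h3 := 𝔮.bracket_swap (e₁ x).2.1 (P.θ x (e₂ x).1)
  simp only [dOne]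
  linear_combination (norm := module) h2 + h3

lemma cot_of_isStdBracketAt_twist (hx : x ∈ W) (h₁ : StdSmoothAt e₁ x) (h₂ : StdSmoothAt e₂ x)
    (h : IsStdBracketAt 𝔮 (fun y => P.twist 𝔮 y (e₁ y)) (fun y => P.twist 𝔮 y (e₂ y)) x
      (P.twist 𝔮 x u)) {Z : ∀ y : M, Tan (E := E) y} (hZ : VFSmoothAt Z x) :
    u.2.2 (Z x) = lieDer (fun y => (e₁ y).1) (fun y => (e₂ y).2.2) Z x
      - dOne (F := ℝ) (fun y => (e₁ y).2.2) (fun y => (e₂ y).1) Z x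
      + 2 * 𝔮.form (e₂ x).2.1
        (dd (fun y => (e₁ y).2.1) x (Z x) + 𝔮.bracket (P.θ x (Z x)) (e₁ x).2.1)
      - 2 * 𝔮.form (e₂ x).2.1
        (dOne P.θ (fun y => (e₁ y).1) Z x + 𝔮.bracket (P.θ x (e₁ x).1) (P.θ x (Z x)))
      + 2 * 𝔮.form (e₁ x).2.1
        (dOne P.θ (fun y => (e₂ y).1) Z x + 𝔮.bracket (P.θ x (e₂ x).1) (P.θ x (Z x)))
      + (cs3 𝔮 P.θ (fun y => (e₁ y).1) (fun y => (e₂ y).1) Z x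
        - dTwo P.B (fun y => (e₁ y).1) (fun y => (e₂ y).1) Z x) := by
  have h1 : u.1 = lie (fun y => (e₁ y).1) (fun y => (e₂ y).1) x := h.1
  have h2 := congrArg (fun v => 𝔮.form v (P.θ x (Z x))) (adj_of_isStdBracketAt_twist hx h₁ h₂ h)
  have h3 := h.2.2 Z hZ
  simp only [lieDer, dOne] at h3
  rw [dd_twist_cot hx h₂ hZ, dd_twist_cot hx h₁ hZ] at h3
  simp only [twist_fst] at h3
  rw [dd_twist_cot hx h₁ h₂.1] at h3
  simp only [dd_twist_adj hx h₁] at h3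
  simp only [twist_cot, twist_adj, h1] at h3
  have B₁ := alt_two_swap (P.B x) (e₂ x).1 (lie (fun y => (e₁ y).1) Z x)
  have B₂ := alt_two_swap (P.B x) (e₁ x).1 (lie (fun y => (e₂ y).1) Z x)
  have s₁ := 𝔮.form_symm (P.θ x (Z x)) (dd (fun y => P.θ y (e₂ y).1) x (e₁ x).1)
  have s₂ := 𝔮.form_symm (P.θ x (Z x)) (dd (fun y => P.θ y (e₁ y).1) x (e₂ x).1)
  have s₃ := 𝔮.form_symm (P.θ x (e₂ x).1) (dd (fun y => P.θ y (e₁ y).1) x (Z x))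
  have s₄ := 𝔮.form_symm (P.θ x (e₂ x).1) (dd (fun y => (e₁ y).2.1) x (Z x))
  have s₅ := 𝔮.form_symm (P.θ x (Z x)) (P.θ x (lie (fun y => (e₁ y).1) (fun y => (e₂ y).1) x))
  have i₁ := 𝔮.form_invariant (e₂ x).2.1 (P.θ x (e₁ x).1) (P.θ x (Z x))
  have i₂ := 𝔮.form_invariant (e₁ x).2.1 (P.θ x (e₂ x).1) (P.θ x (Z x))
  rw [𝔮.bracket_swap (e₂ x).2.1] at i₁
  rw [𝔮.bracket_swap (e₁ x).2.1] at i₂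
  have i₃ := 𝔮.form_invariant (e₁ x).2.1 (e₂ x).2.1 (P.θ x (Z x))
  have i₄ := 𝔮.form_symm (e₁ x).2.1 (𝔮.bracket (e₂ x).2.1 (P.θ x (Z x)))
  have i₅ := 𝔮.form_invariant (e₂ x).2.1 (P.θ x (Z x)) (e₁ x).2.1
  have j₁ := 𝔮.form_invariant (P.θ x (e₁ x).1) (P.θ x (e₂ x).1) (P.θ x (Z x))
  have j₂ := 𝔮.form_symm (P.θ x (Z x)) (𝔮.bracket (P.θ x (e₁ x).1) (P.θ x (e₂ x).1))
  have j₃ := 𝔮.form_invariant (P.θ x (e₂ x).1) (P.θ x (Z x)) (P.θ x (e₁ x).1)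
  have j₄ := 𝔮.form_symm (P.θ x (e₁ x).1) (𝔮.bracket (P.θ x (e₂ x).1) (P.θ x (Z x)))
  rw [cs3, dOne_swap P.θ Z]
  simp only [lieDer, dOne, dTwo, map_add, map_sub, map_neg, map_smul, add_apply, sub_apply,
    neg_apply, smul_eq_mul] at h2 h3 i₁ i₂ ⊢
  linarith

end ConnData

end LocalSplitBracket

section Curvature

set_option linter.unusedSectionVars false

open Filter Topology

variable {E : Type uE} [NormedAddCommGroup E] [NormedSpace ℝ E] [FiniteDimensional ℝ E]
  [CompleteSpace E]
  {M : Type uM} [TopologicalSpace M] [ChartedSpace E M] [IsManifold 𝓘(ℝ, E) ∞ M]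
  {F : Type uF} [NormedAddCommGroup F] [NormedSpace ℝ F]
  {𝔤 : Type uG} [NormedAddCommGroup 𝔤] [NormedSpace ℝ 𝔤] {𝔮 : QuadraticLieAlgebra 𝔤}
  {x : M} {W W₁ W₂ : Opens M}

/-! ### Forms from tensorial operations on vector fields -/

lemma eq_zero_of_eq_neg' {a : F} (h : a = -a) : a = 0 := by
  have h2 : (2 : ℝ) • a = 0 := by
    rw [two_smul]
    nth_rewrite 1 [h]
    simp
  exact (smul_eq_zero.1 h2).resolve_left two_ne_zero

lemma exists_alt_two {Φ : (∀ y : M, Tan (E := E) y) → (∀ y : M, Tan (E := E) y) → F}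
    (hswap : ∀ X Y, VFSmoothAt X x → VFSmoothAt Y x → Φ X Y = - Φ Y X)
    (hadd : ∀ X Y Z, VFSmoothAt X x → VFSmoothAt Y x → VFSmoothAt Z x →
      Φ X (fun y => Y y + Z y) = Φ X Y + Φ X Z)
    (hsmul : ∀ (c : M → ℝ) X Y, FnSmoothAt (E := E) c x → VFSmoothAt X x → VFSmoothAt Y x →
      Φ X (fun y => c y • Y y) = c x • Φ X Y) :
    ∃ r : Tan (E := E) x [⋀^Fin 2]→ₗ[ℝ] F, ∀ X Y, VFSmoothAt X x → VFSmoothAt Y x →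
      r ![X x, Y x] = Φ X Y := by
  choose V hV' hVx using fun v : Tan (E := E) x => exists_vf x v
  have hV : ∀ v, VFSmoothAt (V v) x := fun v => (hV' v).self_of_nhds
  have hr : ∀ {X Y Y'}, VFSmoothAt X x → VFSmoothAt Y x → VFSmoothAt Y' x → Y x = Y' x →
      Φ X Y = Φ X Y' := fun {X Y Y'} hX hY hY' h =>
    tensorial_pointwise (Φ := Φ X) (fun Y Z hY hZ => hadd X Y Z hX hY hZ)
      (fun c Y hc hY => hsmul c X Y hc hX hY) hY hY' h
  have hl : ∀ {X X' Y}, VFSmoothAt X x → VFSmoothAt X' x → VFSmoothAt Y x → X x = X' x →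
      Φ X Y = Φ X' Y := fun {X X' Y} hX hX' hY h => by
    rw [hswap X Y hX hY, hswap X' Y hX' hY, hr hY hX hX' h]
  have addr : ∀ u v v', Φ (V u) (V (v + v')) = Φ (V u) (V v) + Φ (V u) (V v') := fun u v v' => by
    rw [← hadd _ _ _ (hV u) (hV v) (hV v')]
    exact hr (hV u) (hV _) ((hV v).fadd (hV v')) (by simp [hVx])
  have smulr : ∀ (c : ℝ) u v, Φ (V u) (V (c • v)) = c • Φ (V u) (V v) := fun c u v => by
    rw [← hsmul (fun _ => c) _ _ (fnSmoothAt_const c) (hV u) (hV v)]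
    exact hr (hV u) (hV _) (VFSmoothAt.fsmul (fnSmoothAt_const c) (hV v)) (by simp [hVx])
  refine ⟨altTwo (LinearMap.mk₂ ℝ (fun u v => Φ (V u) (V v)) (fun u u' v => ?_) (fun c u v => ?_)
    addr smulr) (fun u => eq_zero_of_eq_neg' (hswap _ _ (hV u) (hV u))), fun X Y hX hY => ?_⟩
  · rw [hswap _ _ (hV _) (hV v), addr, hswap _ _ (hV u) (hV v), hswap _ _ (hV u') (hV v), neg_add]
  · rw [hswap _ _ (hV _) (hV v), smulr, hswap _ _ (hV u) (hV v), smul_neg]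
  · rw [altTwo_apply, LinearMap.mk₂_apply, hl (hV _) hX (hV _) (hVx _), hr hX (hV _) hY (hVx _)]

lemma exists_alt_three
    {Φ : (∀ y : M, Tan (E := E) y) → (∀ y : M, Tan (E := E) y) → (∀ y : M, Tan (E := E) y) → F}
    (hswap₁ : ∀ X Y Z, VFSmoothAt X x → VFSmoothAt Y x → VFSmoothAt Z x → Φ X Y Z = - Φ Y X Z)
    (hswap₂ : ∀ X Y Z, VFSmoothAt X x → VFSmoothAt Y x → VFSmoothAt Z x → Φ X Y Z = - Φ X Z Y)
    (hadd : ∀ X Y Z Z', VFSmoothAt X x → VFSmoothAt Y x → VFSmoothAt Z x → VFSmoothAt Z' x →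
      Φ X Y (fun y => Z y + Z' y) = Φ X Y Z + Φ X Y Z')
    (hsmul : ∀ (c : M → ℝ) X Y Z, FnSmoothAt (E := E) c x → VFSmoothAt X x → VFSmoothAt Y x →
      VFSmoothAt Z x → Φ X Y (fun y => c y • Z y) = c x • Φ X Y Z) :
    ∃ r : Tan (E := E) x [⋀^Fin 3]→ₗ[ℝ] F, ∀ X Y Z, VFSmoothAt X x → VFSmoothAt Y x →
      VFSmoothAt Z x → r ![X x, Y x, Z x] = Φ X Y Z := by
  choose V hV' hVx using fun v : Tan (E := E) x => exists_vf x v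
  have hV : ∀ v, VFSmoothAt (V v) x := fun v => (hV' v).self_of_nhds
  choose! r hr using fun X (hX : VFSmoothAt X x) => exists_alt_two (x := x) (Φ := Φ X)
    (fun Y Z hY hZ => hswap₂ X Y Z hX hY hZ) (fun Y Z Z' hY hZ hZ' => hadd X Y Z Z' hX hY hZ hZ')
    (fun c Y Z hc hY hZ => hsmul c X Y Z hc hX hY hZ)
  have hrV : ∀ X, VFSmoothAt X x → ∀ v w, r X ![v, w] = Φ X (V v) (V w) := fun X hX v w => by
    rw [← hr X hX _ _ (hV v) (hV w), hVx, hVx]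
  have hsw : ∀ X Y, VFSmoothAt X x → VFSmoothAt Y x → ∀ w, r X ![Y x, w] = - r Y ![X x, w] :=
    fun X Y hX hY w => by
      have h1 := hr X hX Y (V w) hY (hV w)
      have h2 := hr Y hY X (V w) hX (hV w)
      rw [hVx] at h1 h2
      rw [h1, h2, hswap₁ X Y _ hX hY (hV w)]
  have hsw' : ∀ u v w, r (V u) ![v, w] = - r (V v) ![u, w] := fun u v w => by
    have := hsw (V u) (V v) (hV u) (hV v) w
    rwa [hVx, hVx] at this
  let f : Tan (E := E) x →ₗ[ℝ] Tan (E := E) x →ₗ[ℝ] Tan (E := E) x →ₗ[ℝ] F :=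
    LinearMap.mk₂ ℝ (fun u v => altTwoBilin (r (V u)) v)
      (fun u u' v => by
        ext w
        simp only [LinearMap.add_apply, altTwoBilin_apply]
        rw [hsw', alt_two_add_left, hsw' u, hsw' u', neg_add])
      (fun c u v => by
        ext w
        simp only [LinearMap.smul_apply, altTwoBilin_apply]
        rw [hsw', alt_two_smul_left, hsw' u, smul_neg])
      (fun u v v' => map_add _ _ _) (fun c u v => map_smul _ _ _)
  have hf : ∀ u v w, f u v w = r (V u) ![v, w] := fun _ _ _ => rfl
  refine ⟨altThree f (fun u v => ?_) (fun u v => ?_) (fun u v => ?_), fun X Y Z hX hY hZ => ?_⟩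
  · exact eq_zero_of_eq_neg' (hsw' u u v)
  · exact eq_zero_of_eq_neg' (alt_two_swap (r (V u)) v v)
  · rw [hf, alt_two_swap, eq_zero_of_eq_neg' (hsw' u u v), neg_zero]
  · have h1 := hsw (V (X x)) Y (hV _) hY (Z x)
    have h2 := hsw X Y hX hY (Z x)
    rw [hVx] at h1
    rw [altThree_apply, hf, h1, ← h2, hr X hX Y Z hY hZ]

/-! ### Tensoriality of the Chern-Simons form and of exterior derivatives -/

lemma dTwo_swap₁ (B : ∀ y : M, Tan (E := E) y [⋀^Fin 2]→ₗ[ℝ] ℝ) (X Y Z : ∀ y : M, Tan (E := E) y)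
    (x : M) : dTwo B X Y Z x = - dTwo B Y X Z x := by
  have h1 : (fun y => B y ![X y, Y y]) = fun y => - B y ![Y y, X y] :=
    funext fun y => alt_two_swap _ _ _
  have h2 := alt_two_smul_left (B x) (-1) (lie Y X x) (Z x)
  rw [neg_one_smul, ← lie_swap] at h2
  simp only [dTwo]
  rw [h1, h2, dd_neg]
  simp only [smul_eq_mul]
  ring

lemma dTwo_swap₂ (B : ∀ y : M, Tan (E := E) y [⋀^Fin 2]→ₗ[ℝ] ℝ) (X Y Z : ∀ y : M, Tan (E := E) y)
    (x : M) : dTwo B X Y Z x = - dTwo B X Z Y x := by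
  have h1 : (fun y => B y ![Y y, Z y]) = fun y => - B y ![Z y, Y y] :=
    funext fun y => alt_two_swap _ _ _
  have h2 := alt_two_smul_left (B x) (-1) (lie Z Y x) (X x)
  rw [neg_one_smul, ← lie_swap] at h2
  simp only [dTwo]
  rw [h1, h2, dd_neg]
  simp only [smul_eq_mul]
  ring

section TwoForms

variable {B B' : ∀ y : M, Tan (E := E) y [⋀^Fin 2]→ₗ[ℝ] ℝ} {X Y Z Z' : ∀ y : M, Tan (E := E) y}

lemma dTwo_sub (hB : SmoothTwoForm W B) (hB' : SmoothTwoForm W₁ B') (hx : x ∈ W) (hx' : x ∈ W₁)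
    (hX : VFSmoothAt X x) (hY : VFSmoothAt Y x) (hZ : VFSmoothAt Z x) :
    dTwo (fun y => B y - B' y) X Y Z x = dTwo B X Y Z x - dTwo B' X Y Z x := by
  simp only [dTwo, AlternatingMap.sub_apply]
  rw [dd_sub (hB x hx _ _ hY hZ).mdiff (hB' x hx' _ _ hY hZ).mdiff,
    dd_sub (hB x hx _ _ hX hZ).mdiff (hB' x hx' _ _ hX hZ).mdiff,
    dd_sub (hB x hx _ _ hX hY).mdiff (hB' x hx' _ _ hX hY).mdiff]
  ring

lemma dTwo_add_right (hB : SmoothTwoForm W B) (hx : x ∈ W) (hX : VFSmoothAt X x)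
    (hY : VFSmoothAt Y x) (hZ : VFSmoothAt Z x) (hZ' : VFSmoothAt Z' x) :
    dTwo B X Y (fun y => Z y + Z' y) x = dTwo B X Y Z x + dTwo B X Y Z' x := by
  simp only [dTwo, alt_two_add_right, lie_add_right hZ hZ', alt_two_add_left, map_add]
  rw [dd_add (hB x hx _ _ hY hZ).mdiff (hB x hx _ _ hY hZ').mdiff,
    dd_add (hB x hx _ _ hX hZ).mdiff (hB x hx _ _ hX hZ').mdiff]
  ring

lemma dTwo_smul_right (hB : SmoothTwoForm W B) (hx : x ∈ W) {c : M → ℝ}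
    (hc : FnSmoothAt (E := E) c x) (hX : VFSmoothAt X x)
    (hY : VFSmoothAt Y x) (hZ : VFSmoothAt Z x) :
    dTwo B X Y (fun y => c y • Z y) x = c x * dTwo B X Y Z x := by
  simp only [dTwo, alt_two_smul_right, lie_smul_right hc hZ, alt_two_add_left, alt_two_smul_left,
    map_smul, smul_eq_mul]
  rw [dd_mul hc.mdiff (hB x hx _ _ hY hZ).mdiff, dd_mul hc.mdiff (hB x hx _ _ hX hZ).mdiff,
    alt_two_swap (B x) (Z x) (Y x), alt_two_swap (B x) (Z x) (X x)]
  ring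

lemma dTwo_smooth (hB : SmoothTwoForm W B) (hx : x ∈ W) (hX : VFSmoothAt X x)
    (hY : VFSmoothAt Y x) (hZ : VFSmoothAt Z x) : FnSmoothAt (E := E) (dTwo B X Y Z) x :=
  (((((dd_smooth (hB x hx _ _ hY hZ) hX).fsub (dd_smooth (hB x hx _ _ hX hZ) hY)).fadd
    (dd_smooth (hB x hx _ _ hX hY) hZ)).fsub (hB x hx _ _ (lie_smooth hX hY) hZ)).fadd
    (hB x hx _ _ (lie_smooth hX hZ) hY)).fsub (hB x hx _ _ (lie_smooth hY hZ) hX)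

end TwoForms

section ChernSimons

variable {θ : ∀ y : M, Tan (E := E) y →L[ℝ] 𝔤} {X Y Z Z' : ∀ y : M, Tan (E := E) y}

lemma cs3_swap₁ (θ : ∀ y : M, Tan (E := E) y →L[ℝ] 𝔤) (X Y Z : ∀ y : M, Tan (E := E) y) (x : M) :
    cs3 𝔮 θ X Y Z x = - cs3 𝔮 θ Y X Z x := by
  simp only [cs3]
  rw [dOne_swap θ Y Z, dOne_swap θ Z X, dOne_swap θ X Y, 𝔮.bracket_swap (θ x (Y x)) (θ x (Z x)),
    𝔮.bracket_swap (θ x (Z x)) (θ x (X x)), 𝔮.bracket_swap (θ x (X x)) (θ x (Y x))]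
  simp only [map_neg, smul_neg]
  ring

lemma cs3_swap₂ (θ : ∀ y : M, Tan (E := E) y →L[ℝ] 𝔤) (X Y Z : ∀ y : M, Tan (E := E) y) (x : M) :
    cs3 𝔮 θ X Y Z x = - cs3 𝔮 θ X Z Y x := by
  simp only [cs3]
  rw [dOne_swap θ Y Z, dOne_swap θ Z X, dOne_swap θ X Y, 𝔮.bracket_swap (θ x (Y x)) (θ x (Z x)),
    𝔮.bracket_swap (θ x (Z x)) (θ x (X x)), 𝔮.bracket_swap (θ x (X x)) (θ x (Y x))]
  simp only [map_neg, smul_neg]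
  ring

lemma cs3_add_right (hθ : SmoothOneForm W θ) (hx : x ∈ W) (hZ : VFSmoothAt Z x)
    (hZ' : VFSmoothAt Z' x) :
    cs3 𝔮 θ X Y (fun y => Z y + Z' y) x = cs3 𝔮 θ X Y Z x + cs3 𝔮 θ X Y Z' x := by
  simp only [cs3]
  rw [dOne_add_right (hθ x hx) hZ hZ', dOne_swap θ _ X, dOne_add_right (hθ x hx) hZ hZ',
    dOne_swap θ Z X, dOne_swap θ Z' X]
  simp only [map_add, add_apply, smul_add, map_neg]
  ring

lemma cs3_smul_right (hθ : SmoothOneForm W θ) (hx : x ∈ W) {c : M → ℝ}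
    (hc : FnSmoothAt (E := E) c x) (hZ : VFSmoothAt Z x) :
    cs3 𝔮 θ X Y (fun y => c y • Z y) x = c x * cs3 𝔮 θ X Y Z x := by
  simp only [cs3]
  rw [dOne_smul_right (hθ x hx) hc hZ, dOne_swap θ _ X, dOne_smul_right (hθ x hx) hc hZ,
    dOne_swap θ Z X]
  simp only [map_smul, smul_apply, smul_eq_mul, map_neg]
  ring

lemma cs3_smooth (hθ : SmoothOneForm W θ) (hx : x ∈ W) (hX : VFSmoothAt X x)
    (hY : VFSmoothAt Y x) (hZ : VFSmoothAt Z x) : FnSmoothAt (E := E) (cs3 𝔮 θ X Y Z) x := by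
  have hd : ∀ {X Y Z : ∀ y : M, Tan (E := E) y}, VFSmoothAt X x → VFSmoothAt Y x → VFSmoothAt Z x →
      FnSmoothAt (E := E) (fun y => 𝔮.form (θ y (X y)) (dOne θ Y Z y)) x := fun hX hY hZ =>
    FnSmoothAt.bilin 𝔮.form (hθ x hx _ hX) (dOne_smooth (hθ x hx) hY hZ)
  have hb : ∀ {X Y Z : ∀ y : M, Tan (E := E) y}, VFSmoothAt X x → VFSmoothAt Y x → VFSmoothAt Z x →
      FnSmoothAt (E := E) (fun y => 𝔮.form (θ y (X y))
        ((2 : ℝ) • 𝔮.bracket (θ y (Y y)) (θ y (Z y)))) x := fun hX hY hZ =>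
    FnSmoothAt.bilin 𝔮.form (hθ x hx _ hX) (FnSmoothAt.fsmul (fnSmoothAt_const 2)
      (FnSmoothAt.bilin 𝔮.bracket (hθ x hx _ hY) (hθ x hx _ hZ)))
  exact (((hd hX hY hZ).fadd (hd hY hZ hX)).fadd (hd hZ hX hY)).fadd
    (FnSmoothAt.fmul (fnSmoothAt_const _) (((hb hX hY hZ).fadd (hb hY hZ hX)).fadd (hb hZ hX hY)))

end ChernSimons

/-! ### The curvature of connection data -/

namespace ConnData

variable (P : ConnData E 𝔤 W)

lemma exists_curvature (𝔮 : QuadraticLieAlgebra 𝔤) (hx : x ∈ W) :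
    ∃ r : Tan (E := E) x [⋀^Fin 2]→ₗ[ℝ] 𝔤, ∀ X Y, VFSmoothAt X x → VFSmoothAt Y x →
      r ![X x, Y x] = dOne P.θ X Y x + 𝔮.bracket (P.θ x (X x)) (P.θ x (Y x)) := by
  refine exists_alt_two
    (Φ := fun X Y => dOne P.θ X Y x + 𝔮.bracket (P.θ x (X x)) (P.θ x (Y x)))
    (fun X Y _ _ => ?_) (fun X Y Z _ hY hZ => ?_) (fun c X Y hc _ hY => ?_)
  · rw [dOne_swap, 𝔮.bracket_swap, neg_add]
  · rw [dOne_add_right (P.θ_smooth x hx) hY hZ, map_add, map_add]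
    abel
  · rw [dOne_smul_right (P.θ_smooth x hx) hc hY, map_smul, map_smul, smul_add]

lemma exists_threeForm (𝔮 : QuadraticLieAlgebra 𝔤) (hx : x ∈ W) :
    ∃ r : Tan (E := E) x [⋀^Fin 3]→ₗ[ℝ] ℝ, ∀ X Y Z, VFSmoothAt X x → VFSmoothAt Y x →
      VFSmoothAt Z x → r ![X x, Y x, Z x] = cs3 𝔮 P.θ X Y Z x - dTwo P.B X Y Z x := by
  refine exists_alt_three (Φ := fun X Y Z => cs3 𝔮 P.θ X Y Z x - dTwo P.B X Y Z x)
    (fun X Y Z _ _ _ => ?_) (fun X Y Z _ _ _ => ?_) (fun X Y Z Z' hX hY hZ hZ' => ?_)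
    (fun c X Y Z hc hX hY hZ => ?_)
  · rw [cs3_swap₁, dTwo_swap₁]; ring
  · rw [cs3_swap₂, dTwo_swap₂]; ring
  · rw [cs3_add_right P.θ_smooth hx hZ hZ', dTwo_add_right P.B_smooth hx hX hY hZ hZ']; ring
  · rw [cs3_smul_right P.θ_smooth hx hc hZ, dTwo_smul_right P.B_smooth hx hc hX hY hZ, smul_eq_mul]
    ring

end ConnData

namespace StdAut.IsMor

variable {Λ : StdAut E 𝔮 W} {P' : ConnData E 𝔤 W₁} {P : ConnData E 𝔤 W₂}

lemma curvature_eq (h : Λ.IsMor P' P) (hx : x ∈ W) {X Y : ∀ y : M, Tan (E := E) y}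
    (hX : VFSmoothAt X x) (hY : VFSmoothAt Y x) :
    dOne P.θ X Y x + 𝔮.bracket (P.θ x (X x)) (P.θ x (Y x)) =
      Λ.τ x (dOne P'.θ X Y x + 𝔮.bracket (P'.θ x (X x)) (P'.θ x (Y x))) := by
  have hd : ∀ Z : ∀ y : M, Tan (E := E) y, VFSmoothAt Z x → ∀ v : Tan (E := E) x,
      dd (fun y => P.θ y (Z y)) x v = Λ.τ x (dd (fun y => P'.θ y (Z y)) x v)
        - 𝔮.bracket (Λ.φ x v) (Λ.τ x (P'.θ x (Z x))) + dd (fun y => Λ.φ y (Z y)) x v := by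
    intro Z hZ v
    have h' : FnSmoothAt (E := E) (fun y => P'.θ y (Z y)) x := P'.θ_smooth x (h.le₁ hx) Z hZ
    have hτ : FnSmoothAt (E := E) (fun y => Λ.τ y (P'.θ y (Z y))) x :=
      ContMDiffAt.clm_apply (Λ.τ_smooth x hx) h'
    have h1 := Λ.τ_deriv x hx _ h' v
    rw [dd_congr (g := fun y => Λ.τ y (P'.θ y (Z y)) + Λ.φ y (Z y))
      ((eventually_mem_opens hx).mono fun y hy => h.θ_eq y hy _),
      dd_add hτ.mdiff (FnSmoothAt.mdiff (Λ.φ_smooth x hx Z hZ))]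
    linear_combination (norm := module) -h1
  have hfl := Λ.φ_flat x hx X Y hX hY
  have hsk := 𝔮.bracket_swap (Λ.φ x (Y x)) (Λ.τ x (P'.θ x (X x)))
  simp only [dOne] at hfl ⊢
  rw [hd Y hY, hd X hX, h.θ_eq x hx, h.θ_eq x hx, h.θ_eq x hx]
  simp only [map_add, map_sub, add_apply, Λ.τ_bracket x hx]
  linear_combination (norm := module) hfl + hsk

lemma threeForm_eq (h : Λ.IsMor P' P) (hx : x ∈ W) {X Y Z : ∀ y : M, Tan (E := E) y}
    (hX : VFSmoothAt X x) (hY : VFSmoothAt Y x) (hZ : VFSmoothAt Z x) :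
    cs3 𝔮 P.θ X Y Z x - dTwo P.B X Y Z x = cs3 𝔮 P'.θ X Y Z x - dTwo P'.B X Y Z x := by
  have h1 := h.cs3_eq x hx X Y Z hX hY hZ
  rw [dTwo_sub P'.B_smooth P.B_smooth (h.le₁ hx) (h.le₂ hx) hX hY hZ] at h1
  linear_combination -h1

/-- The local covariant derivatives correspond to each other. -/
lemma cov_eq (h : Λ.IsMor P' P) (hx : x ∈ W) {b : M → 𝔤} (hb : FnSmoothAt (E := E) b x)
    (v : Tan (E := E) x) :
    dd (fun y => Λ.τ y (b y)) x v + 𝔮.bracket (P.θ x v) (Λ.τ x (b x)) =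
      Λ.τ x (dd b x v + 𝔮.bracket (P'.θ x v) (b x)) := by
  have h1 := Λ.τ_deriv x hx b hb v
  rw [h.θ_eq x hx, map_add, map_add, add_apply, Λ.τ_bracket x hx]
  linear_combination (norm := module) -h1

end StdAut.IsMor

end Curvature

section SplitForm

set_option linter.unusedSectionVars false

open Filter Topology

variable {E : Type uE} [NormedAddCommGroup E] [NormedSpace ℝ E] [FiniteDimensional ℝ E]
  [CompleteSpace E]
  {M : Type uM} [TopologicalSpace M] [ChartedSpace E M] [IsManifold 𝓘(ℝ, E) ∞ M]
  {F : Type uF} [NormedAddCommGroup F] [NormedSpace ℝ F]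
  {𝔤 : Type uG} [NormedAddCommGroup 𝔤] [NormedSpace ℝ 𝔤] {𝔮 : QuadraticLieAlgebra 𝔤}
  {ι : Type uI} {U : ι → Opens M} {x : M}

/-! ### Smoothness of forms -/

lemma smooth_two_of_smooth_near {α : ∀ y : M, Tan (E := E) y [⋀^Fin 2]→ₗ[ℝ] F}
    (h : ∀ X Y : ∀ y : M, Tan (E := E) y, (∀ᶠ y in 𝓝 x, VFSmoothAt X y) →
      (∀ᶠ y in 𝓝 x, VFSmoothAt Y y) → FnSmoothAt (E := E) (fun y => α y ![X y, Y y]) x)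
    {X Y : ∀ y : M, Tan (E := E) y} (hX : VFSmoothAt X x) (hY : VFSmoothAt Y x) :
    FnSmoothAt (E := E) (fun y => α y ![X y, Y y]) x :=
  smooth_of_smooth_near (α := fun y v => α y ![v, Y y]) (fun _ _ _ => alt_two_add_left _ _ _ _)
    (fun _ _ _ => alt_two_smul_left _ _ _ _) (fun X hX' =>
      smooth_of_smooth_near (α := fun y v => α y ![X y, v]) (fun _ _ _ => alt_two_add_right _ _ _ _)
        (fun _ _ _ => alt_two_smul_right _ _ _ _) (fun Y hY' => h X Y hX' hY') hY) hX

lemma smooth_three_of_smooth_near {α : ∀ y : M, Tan (E := E) y [⋀^Fin 3]→ₗ[ℝ] F}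
    (h : ∀ X Y Z : ∀ y : M, Tan (E := E) y, (∀ᶠ y in 𝓝 x, VFSmoothAt X y) →
      (∀ᶠ y in 𝓝 x, VFSmoothAt Y y) → (∀ᶠ y in 𝓝 x, VFSmoothAt Z y) →
      FnSmoothAt (E := E) (fun y => α y ![X y, Y y, Z y]) x)
    {X Y Z : ∀ y : M, Tan (E := E) y} (hX : VFSmoothAt X x) (hY : VFSmoothAt Y x)
    (hZ : VFSmoothAt Z x) : FnSmoothAt (E := E) (fun y => α y ![X y, Y y, Z y]) x :=
  smooth_of_smooth_near (α := fun y v => (α y).curryLeft v ![Y y, Z y])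
    (fun y u v => by rw [map_add, AlternatingMap.add_apply])
    (fun y c v => by rw [map_smul, AlternatingMap.smul_apply]) (fun X hX' =>
      smooth_two_of_smooth_near (α := fun y => (α y).curryLeft (X y))
        (fun Y Z hY' hZ' => h X Y Z hX' hY' hZ') hY hZ) hX

/-! ### Isomorphisms defined by an atlas -/

namespace StdAtlas

variable {D : CourantData E 𝔮 U} {C : VB.{uE, uM, uF, w} E M F} (T : StdAtlas D C) (G : Glued D)

/-- The comparison map on the fibres. -/
def fibMap (x : M) : C.Fib x ≃ₗ[ℝ] G.C.Fib x :=
  (LinearEquiv.ofBijective _ (T.bijective _ x (T.mem_idx x))).trans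
    (LinearEquiv.ofBijective _ (G.chart_bijective _ x (T.mem_idx x))).symm

lemma chart_fibMap {i : ι} (hi : x ∈ U i) (e : C.Fib x) :
    G.chart i x (T.fibMap G x e) = T.chart i x e := by
  have hj := T.mem_idx x
  have h : G.chart (T.idx x) x (T.fibMap G x e) = T.chart (T.idx x) x e :=
    LinearEquiv.apply_symm_apply (LinearEquiv.ofBijective _ (G.chart_bijective _ x hj)) _
  rw [G.chart_transition i (T.idx x) x ⟨hi, hj⟩, h, ← T.transition i (T.idx x) x ⟨hi, hj⟩]

/-- The comparison isomorphism from the Courant algebroid of an atlas. -/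
def iso [FiniteDimensional ℝ 𝔤] : T.courantAlgebroid.Iso G.A where
  map := T.fibMap G
  smooth_iff e x := by
    have hi := T.mem_idx x
    rw [← G.chart_smooth_iff _ x hi, ← T.smooth_iff _ x hi]
    exact stdSmoothAt_congr ((eventually_mem_opens hi).mono fun y hy => T.chart_fibMap G hy _)
  map_anchor x e := by
    have hi := T.mem_idx x
    rw [G.chart_anchor _ x hi, T.chart_fibMap G hi]
    exact (T.anchor_eq hi e).symm
  map_pairing x u v := by
    have hi := T.mem_idx x
    rw [G.chart_pairing _ x hi, T.chart_fibMap G hi, T.chart_fibMap G hi]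
    exact (T.pairing_eq hi u v).symm
  map_bracket e₁ e₂ e₁' e₂' h₁ h₂ x := by
    have hi := T.mem_idx x
    refine (G.chart_bijective _ x hi).1 ?_
    rw [T.chart_fibMap G hi]
    have hn : ∀ (e : C.Sec) (e' : G.C.Sec), (∀ x, e' x = T.fibMap G x (e x)) →
        ∀ᶠ y in 𝓝 x, G.chart (T.idx x) y (e' y) = T.chart (T.idx x) y (e y) := fun e e' h =>
      (eventually_mem_opens hi).mono fun y hy => by rw [h, T.chart_fibMap G hy]
    exact (G.chart_bracket _ x hi e₁' e₂').unique
      ((T.isBracketAt_bracket e₁ e₂ x _ hi).congr (hn _ _ h₁) (hn _ _ h₂))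

end StdAtlas

namespace Glued

variable {D : CourantData E 𝔮 U} (G : Glued D) (hU : ∀ x : M, ∃ i, x ∈ U i)

/-! ### The induced connection -/

lemma gchart_mdiff [FiniteDimensional ℝ 𝔤] {i : ι} (hx : x ∈ U i) {a : ∀ y, G.𝒢.Fib y}
    (ha : MDifferentiableAt 𝓘(ℝ, E) (𝓘(ℝ, E).prod 𝓘(ℝ, 𝔤))
      (fun y => TotalSpace.mk' 𝔤 y (a y)) x) :
    MDifferentiableAt 𝓘(ℝ, E) 𝓘(ℝ, 𝔤) (fun y => G.gchart i y (a y)) x := by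
  obtain ⟨n, s, l, hs, -, hl, hsum⟩ := exists_frame (E := E) (F := 𝔤) (V := G.𝒢.Fib) x
  have key : MDifferentiableAt 𝓘(ℝ, E) 𝓘(ℝ, 𝔤)
      (fun y => ∑ k, l k y (a y) • G.gchart i y (s k y)) x :=
    (MDifferentiableAt.sum (t := Finset.univ) fun k _ => (hl a ha k).smul (FnSmoothAt.mdiff
      ((G.gchart_smooth_iff i x hx (s k)).2 (hs k).self_of_nhds))).congr_of_eventuallyEq
      (Eventually.of_forall fun y => by simp)
  refine key.congr_of_eventuallyEq (hsum.mono fun y hy => ?_)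
  change G.gchart i y (a y) = _
  conv_lhs => rw [hy (a y)]
  rw [map_sum]
  simp

/-- The inverse, on the fibre over `x`, of a chart of `𝒢` around `x`. -/
def gsymm [FiniteDimensional ℝ 𝔤] (x : M) : 𝔤 →L[ℝ] G.𝒢.Fib x :=
  LinearMap.toContinuousLinearMap
    (LinearEquiv.ofBijective _ (G.gchart_bijective _ x (hU x).choose_spec)).symm.toLinearMap

lemma gchart_gsymm [FiniteDimensional ℝ 𝔤] (x : M) (a : 𝔤) :
    G.gchart (hU x).choose x (G.gsymm hU x a) = a :=
  LinearEquiv.apply_symm_apply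
    (LinearEquiv.ofBijective _ (G.gchart_bijective _ x (hU x).choose_spec)) a

/-- The covariant derivative in a chart. -/
def localCov (D : CourantData E 𝔮 U) (i : ι) (b : M → 𝔤) (x : M) : Tan (E := E) x →L[ℝ] 𝔤 :=
  mvfderiv 𝓘(ℝ, E) b x + (𝔮.bracket.flip (b x)).comp ((D.obj i).θ x)

/-- The covariant derivative `∇`. -/
def covFun [FiniteDimensional ℝ 𝔤] (a : ∀ y, G.𝒢.Fib y) (x : M) :
    Tan (E := E) x →L[ℝ] G.𝒢.Fib x :=
  (G.gsymm hU x).comp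
    (localCov D (hU x).choose (fun y => G.gchart (hU x).choose y (a y)) x)

lemma gchart_covFun_choose [FiniteDimensional ℝ 𝔤] (a : ∀ y, G.𝒢.Fib y) (x : M)
    (v : Tan (E := E) x) :
    G.gchart (hU x).choose x (G.covFun hU a x v) =
      dd (fun y => G.gchart (hU x).choose y (a y)) x v
        + 𝔮.bracket ((D.obj (hU x).choose).θ x v) (G.gchart (hU x).choose x (a x)) :=
  G.gchart_gsymm hU x _

lemma gchart_covFun [FiniteDimensional ℝ 𝔤] {i : ι} (hi : x ∈ U i) {a : ∀ y, G.𝒢.Fib y}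
    (ha : G.𝒢.SmoothAt a x) (v : Tan (E := E) x) :
    G.gchart i x (G.covFun hU a x v) = dd (fun y => G.gchart i y (a y)) x v
      + 𝔮.bracket ((D.obj i).θ x v) (G.gchart i x (a x)) := by
  have hj := (hU x).choose_spec
  have hij : x ∈ U i ⊓ U (hU x).choose := ⟨hi, hj⟩
  have hb := (G.gchart_smooth_iff _ x hj a).2 ha
  rw [G.gchart_transition i _ x hij, gchart_covFun_choose, ← (D.isMor i _).cov_eq hij hb,
    ← G.gchart_transition i _ x hij]
  congr 1
  exact dd_congr ((eventually_mem_opens hij).mono fun y hy =>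
    (G.gchart_transition i _ y hy (a y)).symm) v

/-- The covariant derivative `∇` on `𝒢`. -/
def cov [FiniteDimensional ℝ 𝔤] : CovariantDerivative 𝓘(ℝ, E) 𝔤 G.𝒢.Fib where
  toFun := G.covFun hU
  isCovariantDerivativeOnUniv :=
    { add := fun {a a' x} ha ha' _ => by
        have hj := (hU x).choose_spec
        refine ContinuousLinearMap.ext fun v => (G.gchart_bijective _ x hj).1 ?_
        have h := dd_add (G.gchart_mdiff hj ha) (G.gchart_mdiff hj ha') v
        rw [add_apply, map_add]
        simp only [gchart_covFun_choose, Pi.add_apply, map_add]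
        rw [h]
        abel
      leibniz := fun {a c x} ha hc _ => by
        have hj := (hU x).choose_spec
        refine ContinuousLinearMap.ext fun v => (G.gchart_bijective _ x hj).1 ?_
        have h := dd_smul hc (G.gchart_mdiff hj ha) v
        rw [add_apply, map_add, smul_apply, map_smul, ContinuousLinearMap.smulRight_apply, map_smul]
        simp only [gchart_covFun_choose, Pi.smul_apply', map_smul]
        rw [h, smul_add]
        abel }

lemma gchart_cov [FiniteDimensional ℝ 𝔤] {i : ι} (hi : x ∈ U i) {a : ∀ y, G.𝒢.Fib y}
    (ha : G.𝒢.SmoothAt a x) (v : Tan (E := E) x) :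
    G.gchart i x (G.cov hU a x v) = dd (fun y => G.gchart i y (a y)) x v
      + 𝔮.bracket ((D.obj i).θ x v) (G.gchart i x (a x)) := G.gchart_covFun hU hi ha v

lemma cov_contMDiff [FiniteDimensional ℝ 𝔤] :
    CovariantDerivative.ContMDiffCovariantDerivative (G.cov hU) ∞ := by
  refine ⟨⟨fun {a} ha x _ => ContMDiffAt.contMDiffWithinAt ?_⟩⟩
  have ha' : ∀ y, G.𝒢.SmoothAt a y := fun y => ((ha y trivial).contMDiffAt univ_mem).of_le (by simp)
  refine contMDiffAt_section_hom (e := fun y => G.cov hU a y) fun X hX => ?_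
  obtain ⟨i, hi⟩ := hU x
  refine (G.gchart_smooth_iff i x hi _).1 ?_
  have hX' : VFSmoothAt X x := hX.self_of_nhds
  have hb := (G.gchart_smooth_iff i x hi a).2 (ha' x)
  refine FnSmoothAt.congr ((dd_smooth hb hX').fadd
    (FnSmoothAt.bilin 𝔮.bracket ((D.obj i).θ_smooth x hi X hX') hb)) ?_
  exact (eventually_mem_opens hi).mono fun y hy => G.gchart_cov hU hy (ha' y) _

/-! ### The curvature and the 3-form -/

/-- The 2-form `R` with values in `𝒢`. -/
def curvature [FiniteDimensional ℝ 𝔤] (x : M) : Tan (E := E) x [⋀^Fin 2]→ₗ[ℝ] G.𝒢.Fib x :=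
  (G.gsymm hU x).toLinearMap.compAlternatingMap
    ((D.obj (hU x).choose).exists_curvature 𝔮 (hU x).choose_spec).choose

lemma gchart_curvature [FiniteDimensional ℝ 𝔤] {i : ι} (hi : x ∈ U i)
    {X Y : ∀ y : M, Tan (E := E) y} (hX : VFSmoothAt X x) (hY : VFSmoothAt Y x) :
    G.gchart i x (G.curvature hU x ![X x, Y x]) = dOne (D.obj i).θ X Y x
      + 𝔮.bracket ((D.obj i).θ x (X x)) ((D.obj i).θ x (Y x)) := by
  have hij : x ∈ U i ⊓ U (hU x).choose := ⟨hi, (hU x).choose_spec⟩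
  have h := ((D.obj (hU x).choose).exists_curvature 𝔮 (hU x).choose_spec).choose_spec X Y hX hY
  rw [G.gchart_transition i _ x hij, (D.isMor i _).curvature_eq hij hX hY, ← h]
  exact congrArg _ (G.gchart_gsymm hU x _)

lemma curvature_smooth [FiniteDimensional ℝ 𝔤] : SmoothBundleTwoForm G.𝒢 (G.curvature hU) := by
  intro x X Y hX hY
  obtain ⟨i, hi⟩ := hU x
  refine (G.gchart_smooth_iff i x hi _).1 ?_
  refine smooth_two_of_smooth_near
    (α := fun y => (G.gchart i y).compAlternatingMap (G.curvature hU y))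
    (fun X Y hX hY => ?_) hX hY
  have hθ := (D.obj i).θ_smooth x hi
  refine FnSmoothAt.congr ((dOne_smooth hθ hX.self_of_nhds hY.self_of_nhds).fadd
    (FnSmoothAt.bilin 𝔮.bracket (hθ X hX.self_of_nhds) (hθ Y hY.self_of_nhds))) ?_
  filter_upwards [eventually_mem_opens hi, hX, hY] with y hy hXy hYy
  exact G.gchart_curvature hU hy hXy hYy

end Glued

namespace CourantData

variable (D : CourantData E 𝔮 U) (hU : ∀ x : M, ∃ i, x ∈ U i)

/-- The 3-form `H`. -/
def threeForm (x : M) : Tan (E := E) x [⋀^Fin 3]→ₗ[ℝ] ℝ :=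
  ((D.obj (hU x).choose).exists_threeForm 𝔮 (hU x).choose_spec).choose

lemma threeForm_eq {i : ι} (hi : x ∈ U i) {X Y Z : ∀ y : M, Tan (E := E) y}
    (hX : VFSmoothAt X x) (hY : VFSmoothAt Y x) (hZ : VFSmoothAt Z x) :
    D.threeForm hU x ![X x, Y x, Z x] =
      cs3 𝔮 (D.obj i).θ X Y Z x - dTwo (D.obj i).B X Y Z x := by
  have hij : x ∈ U i ⊓ U (hU x).choose := ⟨hi, (hU x).choose_spec⟩
  rw [(D.isMor i _).threeForm_eq hij hX hY hZ]
  exact ((D.obj (hU x).choose).exists_threeForm 𝔮 (hU x).choose_spec).choose_spec X Y Z hX hY hZ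

lemma threeForm_smooth : SmoothThreeForm (D.threeForm hU) := by
  intro x X Y Z hX hY hZ
  obtain ⟨i, hi⟩ := hU x
  refine smooth_three_of_smooth_near (fun X Y Z hX hY hZ => ?_) hX hY hZ
  refine FnSmoothAt.congr
    ((cs3_smooth (𝔮 := 𝔮) (D.obj i).θ_smooth hi hX.self_of_nhds hY.self_of_nhds
      hZ.self_of_nhds).fsub
    (dTwo_smooth (D.obj i).B_smooth hi hX.self_of_nhds hY.self_of_nhds hZ.self_of_nhds)) ?_
  filter_upwards [eventually_mem_opens hi, hX, hY, hZ] with y hy hXy hYy hZy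
  exact D.threeForm_eq hU hy hXy hYy hZy

end CourantData

namespace Glued

variable {D : CourantData E 𝔮 U} (G : Glued D) (hU : ∀ x : M, ∃ i, x ∈ U i)

/-! ### The Courant algebroid in split form -/

/-- The atlas of `TM ⊕ 𝒢 ⊕ T*M`. -/
def atlas : StdAtlas D (splitBundle G.𝒢) :=
  D.splitAtlas hU G.gchart G.gchart_bijective G.gchart_smooth_iff G.gchart_transition

lemma atlas_chart (i : ι) (x : M) (e : (splitBundle G.𝒢).Fib x) :
    (G.atlas hU).chart i x e = (D.obj i).twist 𝔮 x (e.1, G.gchart i x e.2.1, e.2.2) := rfl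

lemma isSplitCourant [FiniteDimensional ℝ 𝔤] :
    IsSplitCourant G.L (G.cov hU) (G.curvature hU) (D.threeForm hU)
      (G.atlas hU).courantAlgebroid := by
  have hs : ∀ (e : (splitBundle G.𝒢).Sec) (x : M) (i : ι), x ∈ U i →
      StdSmoothAt (fun y => ((e y).1, G.gchart i y (e y).2.1, (e y).2.2)) x := fun e x i hi =>
    (ConnData.stdSmoothAt_twist_iff (𝔮 := 𝔮) (P := D.obj i) hi).1 ((G.atlas hU).smooth hi e)
  have ha : ∀ (e : (splitBundle G.𝒢).Sec) (x : M), G.𝒢.SmoothAt (fun y => (e y).2.1) x :=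
    fun e x => (splitBundle_smoothAt_iff.1 (e.smoothAt x)).2.1
  refine ⟨fun x e => rfl, fun x u v => ?_, fun e₁ e₂ x => ?_, fun e₁ e₂ x => ?_,
    fun e₁ e₂ x Z hZ => ?_⟩
  · obtain ⟨i, hi⟩ := hU x
    refine ((G.atlas hU).pairing_eq hi u v).trans ?_
    rw [atlas_chart, atlas_chart, ConnData.stdPairing_twist, G.gchart_metric i x hi]
    rfl
  · obtain ⟨i, hi⟩ := hU x
    exact ((G.atlas hU).isBracketAt_bracket e₁ e₂ x i hi).1
  · obtain ⟨i, hi⟩ := hU x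
    refine (G.gchart_bijective i x hi).1 ?_
    have h := ConnData.adj_of_isStdBracketAt_twist hi (hs e₁ x i hi) (hs e₂ x i hi)
      ((G.atlas hU).isBracketAt_bracket e₁ e₂ x i hi)
    refine h.trans ?_
    rw [map_add, map_add, map_sub, G.gchart_cov hU hi (ha e₂ x), G.gchart_cov hU hi (ha e₁ x),
      G.gchart_bracket i x hi, G.gchart_curvature hU hi (hs e₁ x i hi).1 (hs e₂ x i hi).1]
  · obtain ⟨i, hi⟩ := hU x
    have h := ConnData.cot_of_isStdBracketAt_twist hi (hs e₁ x i hi) (hs e₂ x i hi)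
      ((G.atlas hU).isBracketAt_bracket e₁ e₂ x i hi) hZ
    refine h.trans ?_
    rw [G.gchart_metric i x hi, G.gchart_metric i x hi, G.gchart_metric i x hi,
      G.gchart_cov hU hi (ha e₁ x), G.gchart_curvature hU hi (hs e₁ x i hi).1 hZ,
      G.gchart_curvature hU hi (hs e₂ x i hi).1 hZ,
      D.threeForm_eq hU hi (hs e₁ x i hi).1 (hs e₂ x i hi).1 hZ]

/-- The glued Courant algebroid in split form. -/
theorem exists_split [FiniteDimensional ℝ 𝔤] (hU : ∀ x : M, ∃ i, x ∈ U i) :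
    ∃ (cov : CovariantDerivative 𝓘(ℝ, E) 𝔤 G.𝒢.Fib)
      (R : ∀ x : M, Tan (E := E) x [⋀^Fin 2]→ₗ[ℝ] G.𝒢.Fib x)
      (H : ∀ x : M, Tan (E := E) x [⋀^Fin 3]→ₗ[ℝ] ℝ),
      CovariantDerivative.ContMDiffCovariantDerivative cov ∞ ∧
      SmoothBundleTwoForm G.𝒢 R ∧ SmoothThreeForm H ∧
      (∀ i, ∀ x ∈ U i, ∀ a : ∀ y, G.𝒢.Fib y, G.𝒢.SmoothAt a x → ∀ v : Tan (E := E) x,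
        G.gchart i x (cov a x v) = dd (fun y => G.gchart i y (a y)) x v
          + 𝔮.bracket ((D.obj i).θ x v) (G.gchart i x (a x))) ∧
      (∀ i, ∀ x ∈ U i, ∀ X Y Z : ∀ y : M, Tan (E := E) y,
        VFSmoothAt X x → VFSmoothAt Y x → VFSmoothAt Z x →
        G.gchart i x (R x ![X x, Y x]) = dOne (D.obj i).θ X Y x
          + 𝔮.bracket ((D.obj i).θ x (X x)) ((D.obj i).θ x (Y x)) ∧
        H x ![X x, Y x, Z x] = cs3 𝔮 (D.obj i).θ X Y Z x - dTwo (D.obj i).B X Y Z x) ∧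
      ∃ A' : CourantAlgebroid (splitBundle G.𝒢), IsSplitCourant G.L cov R H A' ∧
        ∃ S : A'.Iso G.A, ∀ i, ∀ x ∈ U i, ∀ (v : Tan (E := E) x) (a : G.𝒢.Fib x)
          (ξ : Tan (E := E) x →L[ℝ] ℝ),
          G.chart i x (S.map x (v, a, ξ) - G.conn.s x v - G.conn.σ x a) = (0, 0, ξ) := by
  refine ⟨G.cov hU, G.curvature hU, D.threeForm hU, G.cov_contMDiff hU, G.curvature_smooth hU,
    D.threeForm_smooth hU, fun i x hi a ha v => G.gchart_cov hU hi ha v,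
    fun i x hi X Y Z hX hY hZ => ⟨G.gchart_curvature hU hi hX hY, D.threeForm_eq hU hi hX hY hZ⟩,
    _, G.isSplitCourant hU, (G.atlas hU).iso G, fun i x hi v a ξ => ?_⟩
  have h1 : G.chart i x (((G.atlas hU).iso G).map x (v, a, ξ)) =
      (D.obj i).twist 𝔮 x (v, G.gchart i x a, ξ) := (G.atlas hU).chart_fibMap G hi _
  rw [map_sub, map_sub, h1, G.chart_s_eq hi, G.chart_σ_eq hi, ← map_sub, ← map_sub]
  have h2 : ((v, G.gchart i x a, ξ) : StdFib E 𝔤 x) - (v, 0, 0) - (0, G.gchart i x a, 0) =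
      (0, 0, ξ) := by simp
  rw [h2]
  refine Prod.ext rfl (Prod.ext ?_ (ContinuousLinearMap.ext fun z => ?_))
  · rw [ConnData.twist_adj, map_zero, zero_add]
  · have := alt_two_smul_left ((D.obj i).B x) 0 0 z
    rw [zero_smul, zero_smul] at this
    rw [ConnData.twist_cot, this]
    simp

end Glued

end SplitForm

end TCA

end

theorem mainTheorem5
    {E : Type*} [NormedAddCommGroup E] [NormedSpace ℝ E] [FiniteDimensional ℝ E]
    {M : Type*} [TopologicalSpace M] [T2Space M] [SecondCountableTopology M]
    [ChartedSpace E M] [IsManifold 𝓘(ℝ, E) ∞ M]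
    {𝔤 : Type*} [NormedAddCommGroup 𝔤] [NormedSpace ℝ 𝔤] [FiniteDimensional ℝ 𝔤]
    (𝔮 : TCA.QuadraticLieAlgebra 𝔤)
    {ι : Type*} (U : ι → Opens M) (hU : ∀ x : M, ∃ i, x ∈ U i) :
    -- transitive Courant data glue to a transitive Courant algebroid with connection
    (∀ D : TCA.CourantData E 𝔮 U, ∃ G : TCA.Glued D, G.A.IsTransitive) ∧
    -- 1-morphisms glue to isomorphisms of Courant algebroids that preserve the connections
    (∀ (D' D : TCA.CourantData E 𝔮 U) (Λ : D'.Hom D) (G' : TCA.Glued D') (G : TCA.Glued D),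
      ∃ Φ : G'.A.Iso G.A,
        (∀ i, ∀ x ∈ U i, ∀ e, G.chart i x (Φ.map x e) = (Λ.aut i).act x (G'.chart i x e)) ∧
        (∀ Φ' : G'.A.Iso G.A,
          (∀ i, ∀ x ∈ U i, ∀ e, G.chart i x (Φ'.map x e) = (Λ.aut i).act x (G'.chart i x e)) →
          Φ' = Φ) ∧
        (∀ (x : M) (v : TangentSpace 𝓘(ℝ, E) x), Φ.map x (G'.conn.s x v) = G.conn.s x v) ∧
        (∀ (x : M) (e' : G'.A.Ker x) (e : G.A.Ker x), (e : G.C.Fib x) = Φ.map x e' →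
          Φ.map x (G'.conn.σ x (G'.L.proj x e')) = G.conn.σ x (G.L.proj x e))) ∧
    -- the glued Courant algebroid in split form
    (∀ (D : TCA.CourantData E 𝔮 U) (G : TCA.Glued D),
      ∃ (cov : CovariantDerivative 𝓘(ℝ, E) 𝔤 G.𝒢.Fib)
        (R : ∀ x : M, TangentSpace 𝓘(ℝ, E) x [⋀^Fin 2]→ₗ[ℝ] G.𝒢.Fib x)
        (H : ∀ x : M, TangentSpace 𝓘(ℝ, E) x [⋀^Fin 3]→ₗ[ℝ] ℝ),
        CovariantDerivative.ContMDiffCovariantDerivative cov ∞ ∧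
        TCA.SmoothBundleTwoForm G.𝒢 R ∧ TCA.SmoothThreeForm H ∧
        -- `∇_X a = X(a) + [θ_i(X), a]` on `U_i`
        (∀ i, ∀ x ∈ U i, ∀ a : ∀ y, G.𝒢.Fib y, G.𝒢.SmoothAt a x →
          ∀ v : TangentSpace 𝓘(ℝ, E) x,
          G.gchart i x (cov a x v) =
            TCA.dd (fun y => G.gchart i y (a y)) x v
              + 𝔮.bracket ((D.obj i).θ x v) (G.gchart i x (a x))) ∧
        -- `R = dθ_i + ½ [θ_i, θ_i]` and `H = cs₃(θ_i) - dB_i` on `U_i`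
        (∀ i, ∀ x ∈ U i, ∀ X Y Z : ∀ y : M, TangentSpace 𝓘(ℝ, E) y,
          TCA.VFSmoothAt X x → TCA.VFSmoothAt Y x → TCA.VFSmoothAt Z x →
          G.gchart i x (R x ![X x, Y x]) =
            TCA.dOne (D.obj i).θ X Y x
              + 𝔮.bracket ((D.obj i).θ x (X x)) ((D.obj i).θ x (Y x)) ∧
          H x ![X x, Y x, Z x] =
            TCA.cs3 𝔮 (D.obj i).θ X Y Z x - TCA.dTwo (D.obj i).B X Y Z x) ∧
        ∃ A' : TCA.CourantAlgebroid (TCA.splitBundle G.𝒢),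
          TCA.IsSplitCourant G.L cov R H A' ∧
          -- `S(X + a + ξ) = s(X) + σ(a) + ξ` is an isomorphism from `TM ⊕ 𝒢 ⊕ T*M` to `C`
          ∃ S : A'.Iso G.A, ∀ i, ∀ x ∈ U i, ∀ (v : TangentSpace 𝓘(ℝ, E) x) (a : G.𝒢.Fib x)
            (ξ : TangentSpace 𝓘(ℝ, E) x →L[ℝ] ℝ),
            G.chart i x (S.map x (v, a, ξ) - G.conn.s x v - G.conn.σ x a) = (0, 0, ξ)) := by
  have := FiniteDimensional.complete ℝ E
  exact ⟨fun D => ⟨D.glued hU, D.glued_isTransitive hU⟩,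
    fun D' D Λ G' G => Λ.exists_iso G' G hU, fun D G => G.exists_split hU⟩
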